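/- Let $p,q\ge 1$ be odd integers and put $n:=(p+q)/2-1$. Let $F$ be a totally real Galois extension of $\mathbb{Q}$ of finite degree $d>1$ with Galois group $\Sigma$, and fix an embedding $F\subset\mathbb{R}$. Let $\alpha_1,\dots,\alpha_{p+q}\in F^*$ be such that $\alpha_j>0$ for $j\le p$, $\alpha_j<0$ for $j>p$, and $\sigma(\alpha_j)>0$ for all $j$ and all $\sigma\in\Sigma\setminus\{1\}$. Let $Q(x)=\sum_{j}\alpha_jx_j^2$, let $G=\operatorname{SO}_Q\subset\operatorname{GL}_{p+q}$ be its special orthogonal group (an algebraic group over $F$), and let $G'=\operatorname{Res}_{F/\mathbb{Q}}(G)$ be the algebraic $\mathbb{Q}$-group obtained by restriction of scalars, so that $G'(\mathbb{R})\cong\prod_{\sigma\in\Sigma}\operatorname{SO}_{Q^\sigma}(\mathbb{R})$ with $Q^\sigma(x)=\sum_j\sigma(\alpha_j)x_j^2$. Let $G'(\mathbb{R})^0\cong \operatorname{SO}^0(p,q)\times\prod_{\sigma\ne1}\operatorname{SO}(p+q)$ be the identity component of $G'(\mathbb{R})$, and let $\theta$ be the involution of $G'(\mathbb{R})^0$ which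 is the standard Cartan involution $g\mapsto I_{p,q}\,g\,I_{p,q}$, $I_{p,q}=\operatorname{diag}(1,\dots,1,-1,\dots,-1)$, on the factor belonging to $\sigma=1$ and the identity on the other factors. Then there exists a sequence $\rho(m)$, $m=1,2,3,\dots$, of $\mathbb{Q}$-rational representations of $G'$ on finite-dimensional $\mathbb{Q}$-vector spaces $V_{\rho(m)}$ such that: 1. Regarded as a complex representation of $G'(\mathbb{R})^0$ on $V_{\rho(m)}\otimes_{\mathbb{Q}}\mathbb{C}$, $\rho(m)$ is a direct sum of irreducible representations, and every finite-dimensional irreducible complex representation $\tau$ of $G'(\mathbb{R})^0$ with multiplicity $[\rho(m):\tau]\neq 0$ satisfies $\tau\not\cong\tau\circ\theta$. 2. $\dim V_{\rho(m)}$ is a polynomial in $m$ of degree $dn(n+1)/2$ with leading term $C\,d\,m^{dn(n+1)/2}$, i.e. $$\dim V_{\rho(m)}=C\,d\,m^{dn(n+1)/2}+O\bigl(m^{dn(n+1)/2-1}\bigr)\quad (m\to\infty),$$ where $C=c^{\,d}$ with a constant $c>0$ that depends only on $n$. -/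

import Mathlib

open scoped TensorProduct

noncomputable section

namespace ArithSO

/-! ### The special orthogonal group of a diagonal quadratic form, and its Weil restriction -/

/-- For a commutative ring `S` and coefficients `a`, the group of all matrices over `S` of
determinant one that leave the quadratic form `∑ j, a j * x j ^ 2` invariant. -/
def SO {N : ℕ} {S : Type*} [CommRing S] (a : Fin N → S) :
    Subgroup (Matrix.SpecialLinearGroup (Fin N) S) where
  carrier := {g | (g : Matrix (Fin N) (Fin N) S).transpose * Matrix.diagonal a *
    (g : Matrix (Fin N) (Fin N) S) = Matrix.diagonal a}
  one_mem' := by simp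
  mul_mem' := by
    intro g h hg hh
    simp only [Set.mem_ofPred_eq] at hg hh ⊢
    rw [Matrix.SpecialLinearGroup.coe_mul, Matrix.transpose_mul]
    calc _ = (h : Matrix (Fin N) (Fin N) S).transpose *
          ((g : Matrix (Fin N) (Fin N) S).transpose * Matrix.diagonal a *
            (g : Matrix (Fin N) (Fin N) S)) * (h : Matrix (Fin N) (Fin N) S) := by
          simp only [Matrix.mul_assoc]
      _ = _ := by rw [hg, hh]
  inv_mem' := by
    intro g hg
    simp only [Set.mem_ofPred_eq] at hg ⊢
    have h1 : (g : Matrix (Fin N) (Fin N) S) *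
        ((g⁻¹ : Matrix.SpecialLinearGroup (Fin N) S) : Matrix (Fin N) (Fin N) S) = 1 := by
      rw [← Matrix.SpecialLinearGroup.coe_mul, mul_inv_cancel, Matrix.SpecialLinearGroup.coe_one]
    have h2 : ((g⁻¹ : Matrix.SpecialLinearGroup (Fin N) S) :
        Matrix (Fin N) (Fin N) S).transpose *
        (g : Matrix (Fin N) (Fin N) S).transpose = 1 := by
      rw [← Matrix.transpose_mul, h1, Matrix.transpose_one]
    calc _ = ((g⁻¹ : Matrix.SpecialLinearGroup (Fin N) S) :
          Matrix (Fin N) (Fin N) S).transpose *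
          ((g : Matrix (Fin N) (Fin N) S).transpose * Matrix.diagonal a *
            (g : Matrix (Fin N) (Fin N) S)) *
          ((g⁻¹ : Matrix.SpecialLinearGroup (Fin N) S) : Matrix (Fin N) (Fin N) S) := by
          rw [hg]
      _ = (((g⁻¹ : Matrix.SpecialLinearGroup (Fin N) S) :
          Matrix (Fin N) (Fin N) S).transpose *
          (g : Matrix (Fin N) (Fin N) S).transpose) * Matrix.diagonal a *
          ((g : Matrix (Fin N) (Fin N) S) *
          ((g⁻¹ : Matrix.SpecialLinearGroup (Fin N) S) : Matrix (Fin N) (Fin N) S)) := by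
          simp only [Matrix.mul_assoc]
      _ = _ := by rw [h1, h2, Matrix.one_mul, Matrix.mul_one]

theorem mem_SO {N : ℕ} {S : Type*} [CommRing S] {a : Fin N → S}
    {g : Matrix.SpecialLinearGroup (Fin N) S} :
    g ∈ SO a ↔ (g : Matrix (Fin N) (Fin N) S).transpose * Matrix.diagonal a *
      (g : Matrix (Fin N) (Fin N) S) = Matrix.diagonal a := Iff.rfl

theorem map_mem_SO {N : ℕ} {S T : Type*} [CommRing S] [CommRing T] (f : S →+* T)
    {a : Fin N → S} {b : Fin N → T} (hab : ∀ j, f (a j) = b j)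
    {g : Matrix.SpecialLinearGroup (Fin N) S} (hg : g ∈ SO a) :
    Matrix.SpecialLinearGroup.map f g ∈ SO b := by
  rw [mem_SO] at hg ⊢
  have hb : b = fun j => f (a j) := funext fun j => (hab j).symm
  have hd : (Matrix.diagonal a).map f = Matrix.diagonal b := by
    rw [hb, Matrix.diagonal_map (map_zero f)]
  have h := congrArg (fun M : Matrix (Fin N) (Fin N) S => M.map f) hg
  simp only [Matrix.map_mul, hd, Matrix.transpose_map] at h
  simpa only [Matrix.SpecialLinearGroup.map_apply_coe, RingHom.mapMatrix_apply] using h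

/-- The map `SO_a(S) → SO_b(T)` induced by a ring homomorphism that carries `a` to `b`. -/
def SO.map {N : ℕ} {S T : Type*} [CommRing S] [CommRing T] (f : S →+* T)
    {a : Fin N → S} {b : Fin N → T} (hab : ∀ j, f (a j) = b j) : SO a →* SO b :=
  ((Matrix.SpecialLinearGroup.map f).comp (SO a).subtype).codRestrict (SO b)
    fun g => map_mem_SO f hab g.2

section WeilRestriction

variable {F : Type*} [Field F] [Algebra ℚ F] {N : ℕ} (α : Fin N → F)

/-- The group `G'(R) = G(R ⊗ F)` of `R`-points of `G' = Res_{F/ℚ} G`, where `G = SO_Q` for the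
quadratic form `Q = ∑ j, α j * x j ^ 2` over `F`, and `R` is a `ℚ`-algebra. -/
abbrev ResSO (R : Type*) [CommRing R] [Algebra ℚ R] : Type _ :=
  SO (fun j => (1 : R) ⊗ₜ[ℚ] α j)

/-- Functoriality of `R ↦ G'(R)`. -/
def ResSO.map {R S : Type*} [CommRing R] [Algebra ℚ R] [CommRing S] [Algebra ℚ S]
    (f : R →ₐ[ℚ] S) : ResSO α R →* ResSO α S :=
  SO.map (Algebra.TensorProduct.map f (AlgHom.id ℚ F)).toRingHom (by intro j; simp)

/-- A `ℚ`-rational representation of the algebraic group `G'` on the `ℚ`-vector space `V`, i.e. a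
morphism `G' → GL(V)` of group functors on commutative `ℚ`-algebras: representations of `G'(R)`
on `R ⊗ V`, natural in `R`. (`G'` is of finite type, so `ℚ`-algebras in `Type` suffice.) -/
structure RationalRep (V : Type*) [AddCommGroup V] [Module ℚ V] where
  /-- the action of `R`-points -/
  toRep : ∀ (R : Type) [CommRing R] [Algebra ℚ R], Representation R (ResSO α R) (R ⊗[ℚ] V)
  /-- compatibility with change of the `ℚ`-algebra -/
  natural : ∀ (R S : Type) [CommRing R] [Algebra ℚ R] [CommRing S] [Algebra ℚ S]
    (f : R →ₐ[ℚ] S) (g : ResSO α R) (v : R ⊗[ℚ] V),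
    toRep S (ResSO.map α f g) (f.toLinearMap.rTensor V v) =
      f.toLinearMap.rTensor V (toRep R g v)

end WeilRestriction

/-! ### Real points -/

section RealPoints

variable {F : Type*} [Field F] [NumberField F]

/-- `ℝ ⊗ F` carries its canonical topology as a finite-dimensional real vector space. -/
instance instTopTensor : TopologicalSpace (ℝ ⊗[ℚ] F) := moduleTopology ℝ (ℝ ⊗[ℚ] F)

instance instModTopTensor : IsModuleTopology ℝ (ℝ ⊗[ℚ] F) := ⟨rfl⟩

instance instTopRingTensor : IsTopologicalRing (ℝ ⊗[ℚ] F) :=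
  IsModuleTopology.isTopologicalRing ℝ (ℝ ⊗[ℚ] F)

variable {N : ℕ} (α : Fin N → F)

/-- The identity component `G'(ℝ)⁰` of the Lie group `G'(ℝ) = SO_Q(ℝ ⊗ F)`. -/
abbrev RealPointsId : Subgroup (ResSO α ℝ) := Subgroup.connectedComponentOfOne (ResSO α ℝ)

/-- The homomorphism `ℝ ⊗ F → ℝ`, `x ⊗ a ↦ x * ι (σ a)`. -/
def place (ι : F →ₐ[ℚ] ℝ) (σ : F ≃ₐ[ℚ] F) : ℝ ⊗[ℚ] F →ₐ[ℝ] ℝ :=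
  Algebra.TensorProduct.lift (AlgHom.id ℝ ℝ) (ι.comp (σ : F →ₐ[ℚ] F)) fun _ _ => Commute.all _ _

@[simp]
theorem place_tmul (ι : F →ₐ[ℚ] ℝ) (σ : F ≃ₐ[ℚ] F) (x : ℝ) (a : F) :
    place ι σ (x ⊗ₜ a) = x * ι (σ a) := by
  simp [place]

/-- All the maps `place ι σ` together. -/
def places (ι : F →ₐ[ℚ] ℝ) : ℝ ⊗[ℚ] F →ₐ[ℝ] ((F ≃ₐ[ℚ] F) → ℝ) :=
  AlgHom.pi (place ι)

theorem places_bijective [IsGalois ℚ F] (ι : F →ₐ[ℚ] ℝ) : Function.Bijective (places ι) := by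
  classical
  have hsurj : Function.Surjective (places ι).toLinearMap := by
    rw [← LinearMap.range_eq_top]
    by_contra hne
    obtain ⟨f, hf0, hf⟩ := Submodule.exists_le_ker_of_lt_top _ (lt_top_iff_ne_top.2 hne)
    have hli := linearIndependent_monoidHom F ℝ
    have hinj : Function.Injective
        (fun σ : F ≃ₐ[ℚ] F => ((ι.comp (σ : F →ₐ[ℚ] F) : F →ₐ[ℚ] ℝ) : F →* ℝ)) := by
      intro σ τ h
      ext a
      exact ι.toRingHom.injective (DFunLike.congr_fun h a)
    have hli' := hli.comp _ hinj
    rw [Fintype.linearIndependent_iff] at hli'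
    have hz := hli' (fun σ => f (Pi.single σ 1)) (by
      ext a
      have h1 : f (places ι (1 ⊗ₜ a)) = 0 :=
        hf (LinearMap.mem_range.2 ⟨1 ⊗ₜ a, rfl⟩)
      rw [LinearMap.pi_apply_eq_sum_univ f] at h1
      simp only [Finset.sum_apply, Pi.smul_apply, Function.comp, smul_eq_mul, Pi.zero_apply]
      rw [← h1]
      refine Finset.sum_congr rfl fun σ _ => ?_
      have h3 : (fun j => if σ = j then (1 : ℝ) else 0) = Pi.single σ 1 := by
        ext j; simp [Pi.single_apply, eq_comm]
      rw [h3, smul_eq_mul, mul_comm]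
      simp [places])
    apply hf0
    refine LinearMap.ext fun x => ?_
    rw [LinearMap.pi_apply_eq_sum_univ f]
    refine Finset.sum_eq_zero fun σ _ => ?_
    have h3 : (fun j => if σ = j then (1 : ℝ) else 0) = Pi.single σ 1 := by
      ext j; simp [Pi.single_apply, eq_comm]
    rw [h3, hz σ, smul_zero]
  have hrank : Module.finrank ℝ (ℝ ⊗[ℚ] F) = Module.finrank ℝ ((F ≃ₐ[ℚ] F) → ℝ) := by
    rw [Module.finrank_baseChange, Module.finrank_fintype_fun_eq_card,
      ← Nat.card_eq_fintype_card, IsGalois.card_aut_eq_finrank]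
  exact ⟨(LinearMap.injective_iff_surjective_of_finrank_eq_finrank hrank).2 hsurj, hsurj⟩

/-- The canonical isomorphism `ℝ ⊗ F ≃ ∏_σ ℝ`, which identifies `G'(ℝ)` with `∏_σ G^σ(ℝ)`. -/
def placesEquiv [IsGalois ℚ F] (ι : F →ₐ[ℚ] ℝ) : ℝ ⊗[ℚ] F ≃ₐ[ℝ] ((F ≃ₐ[ℚ] F) → ℝ) :=
  AlgEquiv.ofBijective (places ι) (places_bijective ι)

/-! ### The Cartan involution -/

open scoped Classical in
/-- The diagonal entries of the matrix over `ℝ ⊗ F ≃ ∏_σ ℝ` whose component at `σ = 1` is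
`I_{p,q} = diag(1, …, 1, -1, …, -1)` and whose components at `σ ≠ 1` are the identity matrix. -/
def signDiag [IsGalois ℚ F] (ι : F →ₐ[ℚ] ℝ) (p : ℕ) (j : Fin N) : ℝ ⊗[ℚ] F :=
  (placesEquiv ι).symm fun σ => if σ = 1 ∧ p ≤ (j : ℕ) then -1 else 1

theorem signDiag_mul_self [IsGalois ℚ F] (ι : F →ₐ[ℚ] ℝ) (p : ℕ) (j : Fin N) :
    signDiag ι p j * signDiag ι p j = 1 := by
  rw [signDiag, ← map_mul, ← map_one (placesEquiv ι).symm]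
  congr 1
  ext σ
  by_cases h : σ = 1 ∧ p ≤ (j : ℕ) <;> simp [h]

theorem diagonal_signDiag_mul_self [IsGalois ℚ F] (ι : F →ₐ[ℚ] ℝ) (p : ℕ) :
    Matrix.diagonal (signDiag (N := N) ι p) * Matrix.diagonal (signDiag ι p) = 1 := by
  rw [Matrix.diagonal_mul_diagonal, ← Matrix.diagonal_one]
  congr 1
  ext j
  exact signDiag_mul_self ι p j

/-- The involution `g ↦ s g s`, `s = diag(signDiag)`, of `SL_N(ℝ ⊗ F)`. -/
def conjSign [IsGalois ℚ F] (ι : F →ₐ[ℚ] ℝ) (p : ℕ) :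
    Matrix.SpecialLinearGroup (Fin N) (ℝ ⊗[ℚ] F) →*
      Matrix.SpecialLinearGroup (Fin N) (ℝ ⊗[ℚ] F) where
  toFun g := ⟨Matrix.diagonal (signDiag ι p) * (g : Matrix (Fin N) (Fin N) (ℝ ⊗[ℚ] F)) *
    Matrix.diagonal (signDiag ι p), by
      rw [Matrix.det_mul, Matrix.det_mul, g.det_coe, mul_one, ← Matrix.det_mul,
        diagonal_signDiag_mul_self, Matrix.det_one]⟩
  map_one' := Subtype.ext <| by
    change Matrix.diagonal (signDiag ι p) * 1 * Matrix.diagonal (signDiag ι p) = 1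
    rw [Matrix.mul_one, diagonal_signDiag_mul_self]
  map_mul' g h := Subtype.ext <| by
    change Matrix.diagonal (signDiag ι p) * ((g : Matrix (Fin N) (Fin N) (ℝ ⊗[ℚ] F)) *
        (h : Matrix (Fin N) (Fin N) (ℝ ⊗[ℚ] F))) * Matrix.diagonal (signDiag ι p) =
      Matrix.diagonal (signDiag ι p) * (g : Matrix (Fin N) (Fin N) (ℝ ⊗[ℚ] F)) *
        Matrix.diagonal (signDiag ι p) *
      (Matrix.diagonal (signDiag ι p) * (h : Matrix (Fin N) (Fin N) (ℝ ⊗[ℚ] F)) *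
        Matrix.diagonal (signDiag ι p))
    simp only [Matrix.mul_assoc]
    rw [← Matrix.mul_assoc (Matrix.diagonal (signDiag ι p)) (Matrix.diagonal (signDiag ι p)),
      diagonal_signDiag_mul_self, Matrix.one_mul]

theorem conjSign_mem [IsGalois ℚ F] (ι : F →ₐ[ℚ] ℝ) (p : ℕ)
    {a : Fin N → ℝ ⊗[ℚ] F} {g : Matrix.SpecialLinearGroup (Fin N) (ℝ ⊗[ℚ] F)} (hg : g ∈ SO a) :
    conjSign ι p g ∈ SO a := by
  rw [mem_SO] at hg ⊢
  change (Matrix.diagonal (signDiag ι p) * (g : Matrix (Fin N) (Fin N) (ℝ ⊗[ℚ] F)) *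
    Matrix.diagonal (signDiag ι p)).transpose * Matrix.diagonal a *
    (Matrix.diagonal (signDiag ι p) * (g : Matrix (Fin N) (Fin N) (ℝ ⊗[ℚ] F)) *
    Matrix.diagonal (signDiag ι p)) = Matrix.diagonal a
  have h1 : Matrix.diagonal (signDiag ι p) * Matrix.diagonal a *
      Matrix.diagonal (signDiag ι p) = Matrix.diagonal a := by
    simp only [Matrix.diagonal_mul_diagonal]
    congr 1
    ext j
    rw [mul_right_comm, signDiag_mul_self, one_mul]
  simp only [Matrix.transpose_mul, Matrix.diagonal_transpose]
  calc _ = Matrix.diagonal (signDiag ι p) *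
        ((g : Matrix (Fin N) (Fin N) (ℝ ⊗[ℚ] F)).transpose *
          (Matrix.diagonal (signDiag ι p) * Matrix.diagonal a *
            Matrix.diagonal (signDiag ι p)) * (g : Matrix (Fin N) (Fin N) (ℝ ⊗[ℚ] F))) *
        Matrix.diagonal (signDiag ι p) := by simp only [Matrix.mul_assoc]
    _ = _ := by rw [h1, hg, h1]

/-- The involution `g ↦ s g s` of `G'(ℝ)`. -/
def thetaFull [IsGalois ℚ F] (ι : F →ₐ[ℚ] ℝ) (p : ℕ) : ResSO α ℝ →* ResSO α ℝ :=
  ((conjSign ι p).comp (SO fun j => (1 : ℝ) ⊗ₜ[ℚ] α j).subtype).codRestrict _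
    fun g => conjSign_mem ι p g.2

theorem continuous_thetaFull [IsGalois ℚ F] (ι : F →ₐ[ℚ] ℝ) (p : ℕ) :
    Continuous (thetaFull α ι p) := by
  refine Continuous.subtype_mk (Continuous.subtype_mk ?_ _) _
  have h : Continuous fun g : ResSO α ℝ => (g.1 : Matrix (Fin N) (Fin N) (ℝ ⊗[ℚ] F)) :=
    continuous_subtype_val.comp continuous_subtype_val
  exact (continuous_const.matrix_mul h).matrix_mul continuous_const

/-- The Cartan involution `θ` of `G'(ℝ)⁰ ≃ SO⁰(p,q) × ∏_{σ ≠ 1} SO(p+q)`: the standard Cartan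
involution `g ↦ I_{p,q} g I_{p,q}` on the component `σ = 1` and the identity on the other ones.
(The isomorphism of the component at `σ = 1` with `SO⁰(p,q)` is conjugation by a diagonal matrix,
which commutes with `I_{p,q}`.) -/
def theta [IsGalois ℚ F] (ι : F →ₐ[ℚ] ℝ) (p : ℕ) : RealPointsId α →* RealPointsId α :=
  ((thetaFull α ι p).comp (RealPointsId α).subtype).codRestrict _ fun g => by
    have h := (continuous_thetaFull α ι p).image_connectedComponent_subset 1
    rw [map_one] at h
    exact h ⟨g.1, g.2, rfl⟩

/-- The complex representation of `G'(ℝ)⁰` on `ℂ ⊗ V` given by a `ℚ`-rational representation. -/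
def RationalRep.complexRep {α : Fin N → F} {V : Type*} [AddCommGroup V] [Module ℚ V]
    (ρ : RationalRep α V) : Representation ℂ (RealPointsId α) (ℂ ⊗[ℚ] V) :=
  ((ρ.toRep ℂ).comp (ResSO.map α (Complex.ofRealAm.restrictScalars ℚ))).comp
    (RealPointsId α).subtype

end RealPoints

/-- The multiplicity `[π : τ]`, the dimension of the space of intertwining maps `τ → π`, of an
irreducible representation `τ` in a semisimple representation `π`. -/
def multiplicity {G V W : Type*} [Group G] [AddCommGroup V] [Module ℂ V] [AddCommGroup W]
    [Module ℂ W] (π : Representation ℂ G V) (τ : Representation ℂ G W) : ℕ :=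
  Module.finrank ℂ (Representation.IntertwiningMap τ π)

end ArithSO

end

/-! For the split quadratic form in 2n+2 variables, the graphs of skew matrices A of size n+1 form
the big cell of one of the two families of maximal isotropic subspaces. Let W_m be the span of the
vectors (l₀ ∧ … ∧ lₙ)^{⊗m}, where l runs through the frames of these graphs. It models the
representation generated by the m-th power of the highest weight vector in one half of Λ^{n+1}, but
no highest weight theory is used.

Invariance (`CellBasis.stable_conj`): W_m is defined over ℚ and stable under the special orthogonal
group over every ℚ-algebra. Stability is local on the base; over a local ring the group is generated
by Cayley transforms (`specialOrthogonal_induction`); and a Cayley transform lies on a polynomial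
path from the identity, along which a cell frame stays in the cell over formal power series
(`proj_frameVec_cayleyNum`).

Rationality: over a finite ℚ-algebra E containing i and square roots of all conjugates of the α_j,
every conjugate form is twice the split form in a suitable basis. The tensor product over Σ of the
conjugates of W_m is then given by matrices over E; the columns over E, regarded as a ℚ-space, are
V_{ρ(m)}. E is padded to dimension d·2^{(2n+3)d}, so that the constant depends on n alone
(`exists_splitData`).

Dimension: dim W_m is the dimension of the span of degree m monomials in the maximal minors of the
generic frame (1; A) (`finrank_cellSpan`). Counting standard monomials makes it eventually
polynomial; two-sided bounds give degree n(n+1)/2, the number of coordinates of A, and a positive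
leading coefficient.

Constituents: in the hyperbolic basis the conjugate transpose of the action of g is the action of
θ(g⁻¹), so orthogonal projections are equivariant and the representation is semisimple. At the place
σ = 1, θ is conjugation by a matrix of determinant (-1)^q = -1, which exchanges the two families of
isotropic subspaces. An isomorphism τ ≅ τ∘θ would, after untwisting by this matrix, commute with the
group, hence with all complex Cayley transforms (`kron_cayleyNum_complex`). It would preserve the
extremal torus weight of the cyclic vector, while the extremal coordinates vanish on the other
family (`det_signBlock_mul_cell`); so it would be zero (`mul_kron_vecs_eq_zero`). -/

noncomputable section

open scoped Matrix

namespace ArithSO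

/-! ### Kronecker products of finite families of matrices -/

section Kron

variable {κ I J L S S' : Type*} [Fintype κ] [CommRing S] [CommRing S']

/-- The Kronecker product of a finite family of matrices. -/
def kron (M : κ → Matrix I J S) : Matrix (κ → I) (κ → J) S :=
  Matrix.of fun x y => ∏ k, M k (x k) (y k)

theorem kron_apply (M : κ → Matrix I J S) (x : κ → I) (y : κ → J) :
    kron M x y = ∏ k, M k (x k) (y k) := rfl

theorem kron_mul [DecidableEq κ] [Fintype J] (M : κ → Matrix I J S) (M' : κ → Matrix J L S) :
    kron M * kron M' = kron fun k => M k * M' k := by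
  ext x y
  simp only [Matrix.mul_apply, kron_apply, ← Finset.prod_mul_distrib]
  rw [Finset.prod_univ_sum, Fintype.piFinset_univ]

theorem kron_one [DecidableEq κ] [DecidableEq I] :
    kron (fun _ : κ => (1 : Matrix I I S)) = 1 := by
  ext x y
  rw [kron_apply]
  by_cases h : x = y
  · subst h; simp
  · obtain ⟨k, hk⟩ := Function.ne_iff.1 h
    rw [Matrix.one_apply_ne h]
    exact Finset.prod_eq_zero (Finset.mem_univ k) (Matrix.one_apply_ne hk)

theorem kron_map (f : S →+* S') (M : κ → Matrix I J S) :
    (kron M).map f = kron fun k => (M k).map f := by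
  ext x y
  simp [kron_apply]

theorem kron_smul (c : κ → S) (M : κ → Matrix I J S) :
    kron (fun k => c k • M k) = (∏ k, c k) • kron M := by
  ext x y
  simp [kron_apply, Finset.prod_mul_distrib]

theorem kron_conjTranspose [StarRing S] (M : κ → Matrix I J S) :
    (kron M).conjTranspose = kron fun k => (M k).conjTranspose := by
  ext x y
  simp [kron_apply]

theorem kron_mulVec [DecidableEq κ] [Fintype J] (M : κ → Matrix I J S) (v : κ → J → S) :
    kron M *ᵥ (fun y => ∏ k, v k (y k)) = fun x => ∏ k, (M k *ᵥ v k) (x k) := by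
  ext x
  simp only [Matrix.mulVec, dotProduct, kron_apply, ← Finset.prod_mul_distrib]
  rw [Finset.prod_univ_sum, Fintype.piFinset_univ]

end Kron

/-! ### Tensor powers of the top exterior power of an `(n+1)`-frame -/

section Frames

variable {n m : ℕ} {X S S' : Type*} [CommRing S] [CommRing S']

/-- The action of a matrix on the tensor power with `m * (n + 1)` factors. -/
def tensorPow (n m : ℕ) {X Y : Type*} (M : Matrix X Y S) :
    Matrix (Fin m × Fin (n + 1) → X) (Fin m × Fin (n + 1) → Y) S :=
  kron fun _ => M

theorem tensorPow_mul {X Y Z : Type*} [Fintype Y] (M : Matrix X Y S) (M' : Matrix Y Z S) :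
    tensorPow n m (M * M') = tensorPow n m M * tensorPow n m M' :=
  (kron_mul _ _).symm

theorem tensorPow_one [DecidableEq X] : tensorPow n m (1 : Matrix X X S) = 1 := kron_one

theorem tensorPow_map {Y : Type*} (f : S →+* S') (M : Matrix X Y S) :
    (tensorPow n m M).map f = tensorPow n m (M.map f) := kron_map f _

theorem tensorPow_smul {Y : Type*} (c : S) (M : Matrix X Y S) :
    tensorPow n m (c • M) = c ^ (m * (n + 1)) • tensorPow n m M := by
  unfold tensorPow
  rw [kron_smul (fun _ => c)]
  simp

theorem tensorPow_conjTranspose {Y : Type*} [StarRing S] (M : Matrix X Y S) :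
    (tensorPow n m M).conjTranspose = tensorPow n m M.conjTranspose := kron_conjTranspose _

/-- The `m`-th tensor power of the vector `l₀ ∧ … ∧ lₙ`, where the `lᵢ` are the columns of `l`. -/
def frameVec (m : ℕ) (l : Matrix X (Fin (n + 1)) S) : (Fin m × Fin (n + 1) → X) → S :=
  fun x => ∏ s, (l.submatrix (fun a => x (s, a)) id).det

/-- Cauchy–Binet before symmetrization: each row of the product is a combination of rows of `l`, and
the determinant is multilinear. Summing over all maps `y`, injective or not, matches the sum in a
tensor power. -/
theorem det_submatrix_mul [Fintype X] (M : Matrix X X S) (l : Matrix X (Fin (n + 1)) S)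
    (x : Fin (n + 1) → X) :
    ((M * l).submatrix x id).det =
      ∑ y : Fin (n + 1) → X, (∏ a, M (x a) (y a)) * (l.submatrix y id).det := by
  classical
  have h : (M * l).submatrix x id = fun a => ∑ j, M (x a) j • l j := by
    ext a b
    simp [Matrix.mul_apply]
  have h2 := (Matrix.detRowAlternating (n := Fin (n + 1)) (R := S)).toMultilinearMap.map_sum
    (fun a j => M (x a) j • l j)
  rw [h]
  refine h2.trans (Finset.sum_congr rfl fun y _ => ?_)
  exact (Matrix.detRowAlternating (n := Fin (n + 1)) (R := S)).toMultilinearMap.map_smul_univ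
    (fun a => M (x a) (y a)) (fun a => l (y a))

/-- This is g(l₀ ∧ … ∧ lₙ) = gl₀ ∧ … ∧ glₙ; it turns every question about the tensor representation
into one about frames. -/
theorem tensorPow_mulVec_frameVec [Fintype X] (M : Matrix X X S) (l : Matrix X (Fin (n + 1)) S) :
    tensorPow n m M *ᵥ frameVec m l = frameVec m (M * l) := by
  classical
  ext x
  simp only [frameVec, det_submatrix_mul, Matrix.mulVec, dotProduct, tensorPow, kron_apply]
  rw [Finset.prod_univ_sum, Fintype.piFinset_univ]
  refine Fintype.sum_equiv (Equiv.curry _ _ _) _ _ fun y => ?_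
  rw [Fintype.prod_prod_type, ← Finset.prod_mul_distrib]
  rfl

/-- Up to a scalar the vector depends only on the span of the frame. -/
theorem frameVec_mul_right (l : Matrix X (Fin (n + 1)) S)
    (h : Matrix (Fin (n + 1)) (Fin (n + 1)) S) :
    frameVec m (l * h) = h.det ^ m • frameVec m l := by
  ext x
  have : ∀ y : Fin (n + 1) → X, (l * h).submatrix y id = l.submatrix y id * h := by
    intro y; ext; simp [Matrix.mul_apply]
  simp [frameVec, this, Finset.prod_mul_distrib, mul_comm]

theorem frameVec_map (f : S →+* S') (l : Matrix X (Fin (n + 1)) S)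
    (x : Fin m × Fin (n + 1) → X) : frameVec m (l.map f) x = f (frameVec m l x) := by
  simp only [frameVec, map_prod, RingHom.map_det, RingHom.mapMatrix_apply, Matrix.submatrix_map]

end Frames

end ArithSO

end

noncomputable section

open scoped Matrix

namespace ArithSO

/-! ### The big cell of isotropic frames of the split quadratic form -/

section Cell

variable {n m : ℕ} {S S' : Type*} [CommRing S] [CommRing S']

/-- The Gram matrix of the split quadratic form. -/
def splitForm (n : ℕ) (S : Type*) [CommRing S] :
    Matrix (Fin (n + 1) ⊕ Fin (n + 1)) (Fin (n + 1) ⊕ Fin (n + 1)) S :=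
  Matrix.fromBlocks 0 1 1 0

/-- The frame whose span is the graph of `A`; it is isotropic for the split form if `A` is skew. -/
def cell (A : Matrix (Fin (n + 1)) (Fin (n + 1)) S) :
    Matrix (Fin (n + 1) ⊕ Fin (n + 1)) (Fin (n + 1)) S :=
  Matrix.fromRows 1 A

theorem cell_map (f : S →+* S') (A : Matrix (Fin (n + 1)) (Fin (n + 1)) S) :
    (cell A).map f = cell (A.map f) := by
  ext i j
  rcases i with i | i
  · by_cases h : i = j <;> simp [cell, h]
  · simp [cell]

/-- The coordinates of a skew matrix. -/
abbrev Pairs (n : ℕ) : Type := {z : Fin (n + 1) × Fin (n + 1) // z.1 < z.2}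

/-- The generic skew matrix. -/
def genSkew (n : ℕ) : Matrix (Fin (n + 1)) (Fin (n + 1)) (MvPolynomial (Pairs n) ℚ) :=
  Matrix.of fun i j => if h : i < j then MvPolynomial.X ⟨(i, j), h⟩
    else if h : j < i then - MvPolynomial.X ⟨(j, i), h⟩ else 0

theorem genSkew_transpose : (genSkew n)ᵀ = - genSkew n := by
  ext1 i j
  rcases lt_trichotomy i j with h | h | h
  · simp [genSkew, h, h.not_gt]
  · simp [genSkew, h]
  · simp [genSkew, h, h.not_gt]

theorem genSkew_map_transpose [Algebra ℚ S] (f : MvPolynomial (Pairs n) ℚ →+* S) :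
    ((genSkew n).map f)ᵀ = - (genSkew n).map f := by
  rw [← Matrix.transpose_map, genSkew_transpose]
  ext; simp

theorem diag_eq_zero_of_skew [Algebra ℚ S] {A : Matrix (Fin (n + 1)) (Fin (n + 1)) S}
    (hA : Aᵀ = - A) (i : Fin (n + 1)) : A i i = 0 := by
  have h1 : A i i = - A i i := congrFun (congrFun hA i) i
  have h2 : (2 : ℚ) • A i i = 0 := by
    rw [two_smul]
    nth_rewrite 1 [h1]
    simp
  calc A i i = (2⁻¹ : ℚ) • ((2 : ℚ) • A i i) := by rw [smul_smul]; norm_num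
    _ = 0 := by rw [h2, smul_zero]

/-- Universal property of the generic skew matrix: identities proved for it specialize to all skew
matrices over all ℚ-algebras. -/
theorem exists_genSkew_map_eq [Algebra ℚ S] {A : Matrix (Fin (n + 1)) (Fin (n + 1)) S}
    (hA : Aᵀ = - A) :
    (genSkew n).map (MvPolynomial.aeval fun z : Pairs n => A z.1.1 z.1.2).toRingHom = A := by
  ext i j
  have h2 : A j i = - A i j := congrFun (congrFun hA i) j
  rcases lt_trichotomy i j with h | h | h
  · simp [genSkew, h]
  · subst h
    simp [genSkew, diag_eq_zero_of_skew hA]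
  · simp [genSkew, h, h.not_gt, h2]

/-- The span of the vectors that belong to the big cell. -/
def cellSpan (n m : ℕ) :
    Submodule ℚ ((Fin m × Fin (n + 1) → Fin (n + 1) ⊕ Fin (n + 1)) → ℚ) :=
  Submodule.span ℚ
    ((fun A => frameVec m (cell A)) '' {A : Matrix (Fin (n + 1)) (Fin (n + 1)) ℚ | Aᵀ = - A})

/-- A basis of `cellSpan n m` that consists of vectors from the big cell, with dual coordinates. -/
structure CellBasis (n m r : ℕ) where
  /-- the points of the cell -/
  pt : Fin r → Matrix (Fin (n + 1)) (Fin (n + 1)) ℚ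
  skew : ∀ i, (pt i)ᵀ = - pt i
  /-- the coordinate functions -/
  coord : Matrix (Fin r) (Fin m × Fin (n + 1) → Fin (n + 1) ⊕ Fin (n + 1)) ℚ
  coord_mul : coord * (Matrix.of fun x i => frameVec m (cell (pt i)) x) = 1
  mulVec_mem : ∀ v ∈ cellSpan n m,
    ((Matrix.of fun x i => frameVec m (cell (pt i)) x) * coord) *ᵥ v = v

/-- The basis is extracted from the spanning set. `coord` is an arbitrary left inverse of the matrix
of basis columns, so vectors times coordinates is a projector onto the span, with no condition on
its kernel. -/
theorem exists_cellBasis (n m : ℕ) :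
    Nonempty (CellBasis n m (Module.finrank ℚ (cellSpan n m))) := by
  classical
  obtain ⟨f, hf, hspan, hli⟩ : ∃ f : Fin (Module.finrank ℚ (cellSpan n m)) → _,
      (∀ i, f i ∈ (fun A => frameVec m (cell A)) ''
        {A : Matrix (Fin (n + 1)) (Fin (n + 1)) ℚ | Aᵀ = - A}) ∧
      Submodule.span ℚ (Set.range f) = cellSpan n m ∧ LinearIndependent ℚ f :=
    Submodule.exists_fun_fin_finrank_span_eq ℚ _
  choose A hA hfA using hf
  set β : Matrix (Fin m × Fin (n + 1) → Fin (n + 1) ⊕ Fin (n + 1)) _ ℚ :=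
    Matrix.of fun x i => frameVec m (cell (A i)) x with hβ
  have hcol : ∀ c, β *ᵥ c = ∑ i, c i • f i := by
    intro c
    ext x
    simp [Matrix.mulVec, dotProduct, hβ, ← hfA, mul_comm]
  have hinj : Function.Injective (Matrix.toLin' β) := by
    rw [← LinearMap.ker_eq_bot, LinearMap.ker_eq_bot']
    intro c hc
    rw [Matrix.toLin'_apply, hcol] at hc
    exact funext (Fintype.linearIndependent_iff.1 hli c hc)
  obtain ⟨g, hg⟩ := LinearMap.exists_leftInverse_of_injective (Matrix.toLin' β)
    (LinearMap.ker_eq_bot.2 hinj)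
  have h1 : LinearMap.toMatrix' g * β = 1 := by
    apply Matrix.toLin'.injective
    rw [Matrix.toLin'_mul, Matrix.toLin'_toMatrix', hg, Matrix.toLin'_one]
  refine ⟨⟨A, hA, LinearMap.toMatrix' g, h1, fun v hv => ?_⟩⟩
  rw [← hspan] at hv
  obtain ⟨c, rfl⟩ := (Submodule.mem_span_range_iff_exists_fun ℚ).1 hv
  rw [← hcol]
  change (β * _) *ᵥ _ = _
  rw [Matrix.mulVec_mulVec, Matrix.mul_assoc, h1, Matrix.mul_one]

namespace CellBasis

variable {r : ℕ} (b : CellBasis n m r)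

/-- The matrix whose columns are the vectors of the basis. -/
def vecs (S : Type*) [CommRing S] [Algebra ℚ S] :
    Matrix (Fin m × Fin (n + 1) → Fin (n + 1) ⊕ Fin (n + 1)) (Fin r) S :=
  Matrix.of fun x i => frameVec m (cell ((b.pt i).map (algebraMap ℚ S))) x

/-- The matrix of the coordinate functions over a `ℚ`-algebra. -/
def coords (S : Type*) [CommRing S] [Algebra ℚ S] :
    Matrix (Fin r) (Fin m × Fin (n + 1) → Fin (n + 1) ⊕ Fin (n + 1)) S :=
  b.coord.map (algebraMap ℚ S)

theorem vecs_eq_map [Algebra ℚ S] : b.vecs S = (b.vecs ℚ).map (algebraMap ℚ S) := by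
  ext x i
  simp only [vecs, Matrix.of_apply, Matrix.map_apply, ← frameVec_map, ← cell_map]
  rfl

theorem vecs_map [Algebra ℚ S] [Algebra ℚ S'] (f : S →+* S') : (b.vecs S).map f = b.vecs S' := by
  rw [vecs_eq_map, b.vecs_eq_map (S := S')]
  ext x i
  simp

theorem coords_map [Algebra ℚ S] [Algebra ℚ S'] (f : S →+* S') :
    (b.coords S).map f = b.coords S' := by
  ext x i
  simp [coords]

theorem coords_mul_vecs [Algebra ℚ S] : b.coords S * b.vecs S = 1 := by
  have h : b.coord * b.vecs ℚ = 1 := b.coord_mul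
  rw [vecs_eq_map, coords, ← Matrix.map_mul, h]
  simp

/-- Every vector from the big cell is a combination of the vectors of the basis. -/
theorem vecs_mul_coords_mulVec [Algebra ℚ S] {A : Matrix (Fin (n + 1)) (Fin (n + 1)) S}
    (hA : Aᵀ = - A) :
    (b.vecs S * b.coords S) *ᵥ frameVec m (cell A) = frameVec m (cell A) := by
  classical
  -- For the generic matrix this is an identity of polynomials over the infinite field ℚ, so it may
  -- be checked at rational points, where the vector lies in the span by definition.
  have hgen : (b.vecs (MvPolynomial (Pairs n) ℚ) * b.coords (MvPolynomial (Pairs n) ℚ)) *ᵥ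
      frameVec m (cell (genSkew n)) = frameVec m (cell (genSkew n)) := by
    ext1 x
    refine MvPolynomial.funext fun a => ?_
    have h := b.mulVec_mem (frameVec m (cell ((genSkew n).map (MvPolynomial.eval a))))
      (Submodule.subset_span ⟨_, genSkew_map_transpose _, rfl⟩)
    have h' := congrFun h x
    rw [← cell_map, frameVec_map] at h'
    rw [← h', RingHom.map_mulVec, Matrix.map_mul, vecs_map (S' := ℚ), coords_map (S' := ℚ)]
    congr 1
    ext1 y
    rw [frameVec_map]
    rfl
  have := congrArg (fun v => (MvPolynomial.aeval fun z : Pairs n => A z.1.1 z.1.2).toRingHom ∘ v)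
    hgen
  ext1 x
  have h2 := congrFun this x
  simp only [Function.comp] at h2
  rw [RingHom.map_mulVec, Matrix.map_mul, vecs_map (S' := S), coords_map (S' := S)] at h2
  have h3 : (fun y => (MvPolynomial.aeval fun z : Pairs n => A z.1.1 z.1.2).toRingHom
      (frameVec m (cell (genSkew n)) y)) = frameVec m (cell A) := by
    ext1 y
    rw [← frameVec_map, cell_map, exists_genSkew_map_eq hA]
  rw [← h3]
  exact h2

end CellBasis

end Cell

end ArithSO

end

noncomputable section

open scoped Matrix

namespace ArithSO

/-! ### The Cayley transform -/

section Cayley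

variable {X S S' : Type*} [Fintype X] [DecidableEq X] [CommRing S] [CommRing S']

/-- The numerator `(1 - ξ) adj(1 + ξ)` of the Cayley transform of `ξ`. -/
def cayleyNum (ξ : Matrix X X S) : Matrix X X S := (1 - ξ) * (1 + ξ).adjugate

theorem cayleyNum_map (f : S →+* S') (ξ : Matrix X X S) :
    (cayleyNum ξ).map f = cayleyNum (ξ.map f) := by
  have h := RingHom.map_adjugate f (1 + ξ)
  simp only [RingHom.mapMatrix_apply] at h
  rw [cayleyNum, cayleyNum, Matrix.map_mul, h, Matrix.map_sub f (map_sub f),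
    Matrix.map_add f (map_add f), Matrix.map_one f (map_zero f) (map_one f)]

theorem cayleyNum_zero : cayleyNum (0 : Matrix X X S) = 1 := by
  simp [cayleyNum]

theorem cayleyNum_mul (ξ : Matrix X X S) :
    cayleyNum ξ * (1 + ξ) = (1 + ξ).det • (1 - ξ) := by
  rw [cayleyNum, Matrix.mul_assoc, Matrix.adjugate_mul]
  simp

/-- The adjoint for `B` exchanges 1 - ξ and 1 + ξ, and these commute. Keeping the numerator instead
of the quotient gives a similitude without any invertibility, so the result applies over polynomial
rings. -/
theorem cayleyNum_isometry {B ξ : Matrix X X S} (h : ξᵀ * B = - (B * ξ)) :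
    (cayleyNum ξ)ᵀ * B * cayleyNum ξ = (1 + ξ).det ^ 2 • B := by
  have hc : (1 + ξ) * (1 - ξ) = (1 - ξ) * (1 + ξ) := by noncomm_ring
  have h1 : (1 - ξ)ᵀ * B = B * (1 + ξ) := by
    rw [Matrix.transpose_sub, Matrix.transpose_one, sub_mul, h]; noncomm_ring
  have h2 : B * (1 - ξ) = (1 + ξ)ᵀ * B := by
    rw [Matrix.transpose_add, Matrix.transpose_one, add_mul, h]; noncomm_ring
  have h3 : ((1 + ξ).adjugate)ᵀ * (1 + ξ)ᵀ = (1 + ξ).det • 1 := by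
    rw [← Matrix.transpose_mul, Matrix.mul_adjugate]; simp
  calc (cayleyNum ξ)ᵀ * B * cayleyNum ξ
      = ((1 + ξ).adjugate)ᵀ * ((1 - ξ)ᵀ * B) * ((1 - ξ) * (1 + ξ).adjugate) := by
        rw [cayleyNum, Matrix.transpose_mul]; simp only [Matrix.mul_assoc]
    _ = ((1 + ξ).adjugate)ᵀ * B * ((1 + ξ) * (1 - ξ)) * (1 + ξ).adjugate := by
        rw [h1]; simp only [Matrix.mul_assoc]
    _ = ((1 + ξ).adjugate)ᵀ * (B * (1 - ξ)) * ((1 + ξ) * (1 + ξ).adjugate) := by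
        rw [hc]; simp only [Matrix.mul_assoc]
    _ = ((1 + ξ).adjugate)ᵀ * (1 + ξ)ᵀ * B * ((1 + ξ).det • 1) := by
        rw [h2, Matrix.mul_adjugate]; simp only [Matrix.mul_assoc]
    _ = _ := by rw [h3]; simp [smul_smul, pow_two]

end Cayley

/-! ### Isotropic frames in the chart of the big cell -/

section Isotropic

variable {n m : ℕ} {S S' : Type*} [CommRing S] [CommRing S']

theorem splitForm_map (f : S →+* S') : (splitForm n S).map f = splitForm n S' := by
  simp [splitForm, Matrix.fromBlocks_map, Matrix.map_one f (map_zero f) (map_one f)]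

theorem transpose_mul_splitForm_mul (l : Matrix (Fin (n + 1) ⊕ Fin (n + 1)) (Fin (n + 1)) S) :
    lᵀ * splitForm n S * l = l.toRows₁ᵀ * l.toRows₂ + l.toRows₂ᵀ * l.toRows₁ := by
  conv_lhs => rw [← Matrix.fromRows_toRows l]
  rw [splitForm, Matrix.transpose_fromRows, Matrix.fromCols_mul_fromBlocks,
    Matrix.fromCols_mul_fromRows]
  simp [add_comm]

theorem cell_isotropic {A : Matrix (Fin (n + 1)) (Fin (n + 1)) S} (hA : Aᵀ = - A) :
    (cell A)ᵀ * splitForm n S * cell A = 0 := by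
  rw [transpose_mul_splitForm_mul]
  simp [cell, hA]

/-- An isotropic frame with invertible upper block belongs to the big cell, up to a change of
basis. -/
theorem exists_eq_cell_mul {l : Matrix (Fin (n + 1) ⊕ Fin (n + 1)) (Fin (n + 1)) S}
    (hl : lᵀ * splitForm n S * l = 0) (hu : IsUnit l.toRows₁.det) :
    ∃ A : Matrix (Fin (n + 1)) (Fin (n + 1)) S, Aᵀ = - A ∧ l = cell A * l.toRows₁ := by
  -- The subspace is the graph of lower block times inverse upper block; isotropy, transported by
  -- the inverse upper block on both sides, says that this matrix is skew.
  refine ⟨l.toRows₂ * l.toRows₁⁻¹, ?_, ?_⟩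
  · rw [transpose_mul_splitForm_mul] at hl
    have h1 : l.toRows₁⁻¹ᵀ * l.toRows₁ᵀ = 1 := by
      rw [← Matrix.transpose_mul, Matrix.mul_nonsing_inv _ hu, Matrix.transpose_one]
    have h2 : l.toRows₁⁻¹ᵀ * (l.toRows₁ᵀ * l.toRows₂ + l.toRows₂ᵀ * l.toRows₁) * l.toRows₁⁻¹
        = 0 := by rw [hl]; simp
    rw [Matrix.mul_add, Matrix.add_mul, ← Matrix.mul_assoc, h1, Matrix.one_mul,
      Matrix.mul_assoc, Matrix.mul_assoc, Matrix.mul_nonsing_inv _ hu, Matrix.mul_one,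
      ← Matrix.transpose_mul] at h2
    exact eq_neg_of_add_eq_zero_right h2
  · rw [cell, Matrix.fromRows_mul, Matrix.one_mul, Matrix.mul_assoc,
      Matrix.nonsing_inv_mul _ hu, Matrix.mul_one, Matrix.fromRows_toRows]

end Isotropic

/-! ### Invariance of the cell span under Cayley transforms, and the resulting matrices -/

namespace CellBasis

variable {n m r : ℕ} (b : CellBasis n m r) {S S' : Type*} [CommRing S] [Algebra ℚ S]
  [CommRing S'] [Algebra ℚ S']

theorem proj_frameVec_of_isUnit {l : Matrix (Fin (n + 1) ⊕ Fin (n + 1)) (Fin (n + 1)) S}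
    (hl : lᵀ * splitForm n S * l = 0) (hu : IsUnit l.toRows₁.det) :
    (b.vecs S * b.coords S) *ᵥ frameVec m l = frameVec m l := by
  obtain ⟨A, hA, h⟩ := exists_eq_cell_mul hl hu
  rw [h, frameVec_mul_right, Matrix.mulVec_smul, b.vecs_mul_coords_mulVec hA]

theorem proj_frameVec_map (f : S →+* S') {l : Matrix (Fin (n + 1) ⊕ Fin (n + 1)) (Fin (n + 1)) S}
    (h : (b.vecs S * b.coords S) *ᵥ frameVec m l = frameVec m l) :
    (b.vecs S' * b.coords S') *ᵥ frameVec m (l.map f) = frameVec m (l.map f) := by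
  ext1 x
  rw [frameVec_map]
  nth_rewrite 1 [← h]
  rw [RingHom.map_mulVec, Matrix.map_mul, vecs_map (S' := S'), coords_map (S' := S')]
  congr 1
  ext1 y
  rw [frameVec_map]
  rfl

theorem proj_frameVec_of_injective (f : S →+* S') (hf : Function.Injective f)
    {l : Matrix (Fin (n + 1) ⊕ Fin (n + 1)) (Fin (n + 1)) S}
    (h : (b.vecs S' * b.coords S') *ᵥ frameVec m (l.map f) = frameVec m (l.map f)) :
    (b.vecs S * b.coords S) *ᵥ frameVec m l = frameVec m l := by
  ext1 x
  apply hf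
  rw [← frameVec_map, ← h, RingHom.map_mulVec, Matrix.map_mul, vecs_map (S' := S'),
    coords_map (S' := S')]
  congr 1
  ext1 y
  rw [frameVec_map]
  rfl

/-- The span of the big cell is stable under Cayley transforms. -/
theorem proj_frameVec_cayleyNum
    {ξ : Matrix (Fin (n + 1) ⊕ Fin (n + 1)) (Fin (n + 1) ⊕ Fin (n + 1)) S}
    (hξ : ξᵀ * splitForm n S = - (splitForm n S * ξ))
    {A : Matrix (Fin (n + 1)) (Fin (n + 1)) S} (hA : Aᵀ = - A) :
    (b.vecs S * b.coords S) *ᵥ frameVec m (cayleyNum ξ * cell A) =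
      frameVec m (cayleyNum ξ * cell A) := by
  classical
  -- Join 0 to ξ by the line Xξ. The frame `l` over S[X] is isotropic, equals the cell frame at X =
  -- 0 and the frame in question at X = 1, so it suffices to treat `l` over S[X].
  let η : Matrix (Fin (n + 1) ⊕ Fin (n + 1)) (Fin (n + 1) ⊕ Fin (n + 1)) (Polynomial S) :=
    (Polynomial.X : Polynomial S) • ξ.map Polynomial.C
  let l := cayleyNum η * cell (A.map Polynomial.C)
  have hη1 : η.map (Polynomial.evalRingHom 1) = ξ := by
    ext i j
    simp [η]
  have hη0 : η.map (Polynomial.evalRingHom 0) = 0 := by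
    ext i j
    simp [η]
  have hAC : ∀ x : S, (A.map Polynomial.C).map (Polynomial.evalRingHom x) = A := by
    intro x
    ext i j
    simp
  have hη : ηᵀ * splitForm n (Polynomial S) = - (splitForm n (Polynomial S) * η) := by
    have := congrArg (fun M => (Polynomial.X : Polynomial S) • Matrix.map M Polynomial.C) hξ
    simp only [Matrix.map_mul, Matrix.transpose_map, splitForm_map] at this
    rw [Matrix.transpose_smul, Matrix.smul_mul, Matrix.mul_smul, this,
      Matrix.map_neg _ (map_neg _), Matrix.map_mul, splitForm_map, smul_neg]
  have hAC' : (A.map Polynomial.C)ᵀ = - A.map Polynomial.C := by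
    rw [← Matrix.transpose_map, hA, Matrix.map_neg Polynomial.C (map_neg _)]
  have hiso : lᵀ * splitForm n (Polynomial S) * l = 0 := by
    calc _ = (cell (A.map Polynomial.C))ᵀ *
          ((cayleyNum η)ᵀ * splitForm n (Polynomial S) * cayleyNum η) *
          cell (A.map Polynomial.C) := by
          simp only [l, Matrix.transpose_mul, Matrix.mul_assoc]
      _ = 0 := by
          rw [cayleyNum_isometry hη, Matrix.mul_smul, Matrix.smul_mul, cell_isotropic hAC',
            smul_zero]
  have hl0 : l.map (Polynomial.evalRingHom 0) = cell A := by
    simp only [l, Matrix.map_mul, cayleyNum_map, hη0, cayleyNum_zero, cell_map, hAC,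
      Matrix.one_mul]
  have hl1 : l.map (Polynomial.evalRingHom 1) = cayleyNum ξ * cell A := by
    simp only [l, Matrix.map_mul, cayleyNum_map, hη1, cell_map, hAC]
  rw [← hl1]
  apply proj_frameVec_map
  -- Over S[X] the upper block need not be invertible, but S[X] embeds in S[[X]], where
  -- invertibility depends only on the constant term.
  have hinj : Function.Injective (Polynomial.coeToPowerSeries.ringHom (R := S)) :=
    Polynomial.coe_injective S
  apply b.proj_frameVec_of_injective _ hinj
  apply proj_frameVec_of_isUnit
  · have := congrArg (fun M => Matrix.map M (Polynomial.coeToPowerSeries.ringHom (R := S))) hiso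
    simpa only [Matrix.map_mul, Matrix.transpose_map, splitForm_map,
      Matrix.map_zero _ (map_zero (Polynomial.coeToPowerSeries.ringHom (R := S)))] using this
  -- The constant term is the upper minor at X = 0, which is the determinant of the identity block
  -- of the cell.
  · rw [PowerSeries.isUnit_iff_constantCoeff]
    have h1 : (l.map (Polynomial.coeToPowerSeries.ringHom (R := S))).toRows₁.det =
        Polynomial.coeToPowerSeries.ringHom (R := S) l.toRows₁.det := by
      rw [RingHom.map_det]; rfl
    have h2 : (PowerSeries.constantCoeff (R := S))
        (Polynomial.coeToPowerSeries.ringHom (R := S) l.toRows₁.det) =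
        Polynomial.evalRingHom 0 l.toRows₁.det := by
      simp [Polynomial.coeff_zero_eq_eval_zero]
    rw [h1, h2, RingHom.map_det]
    have h3 : (Polynomial.evalRingHom (0 : S)).mapMatrix l.toRows₁ =
        (l.map (Polynomial.evalRingHom 0)).toRows₁ := rfl
    rw [h3, hl0]
    simp [cell]

/-- The condition that a matrix preserves the span of the big cell. -/
def Stable (g : Matrix (Fin (n + 1) ⊕ Fin (n + 1)) (Fin (n + 1) ⊕ Fin (n + 1)) S) : Prop :=
  b.vecs S * (b.coords S * (tensorPow n m g * b.vecs S)) = tensorPow n m g * b.vecs S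

theorem Stable.mul {b : CellBasis n m r}
    {g h : Matrix (Fin (n + 1) ⊕ Fin (n + 1)) (Fin (n + 1) ⊕ Fin (n + 1)) S}
    (hg : b.Stable g) (hh : b.Stable h) : b.Stable (g * h) := by
  rw [Stable, tensorPow_mul, Matrix.mul_assoc, ← hh, ← Matrix.mul_assoc (tensorPow n m g)]
  nth_rewrite 2 [← hg]
  nth_rewrite 1 [← hg]
  have h1 : b.coords S * b.vecs S = 1 := b.coords_mul_vecs
  simp only [Matrix.mul_assoc]
  rw [← Matrix.mul_assoc (b.coords S) (b.vecs S), h1, Matrix.one_mul]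

/-- The tensor power is homogeneous, so the denominator of a Cayley transform can be ignored. -/
theorem Stable.smul {b : CellBasis n m r}
    {g : Matrix (Fin (n + 1) ⊕ Fin (n + 1)) (Fin (n + 1) ⊕ Fin (n + 1)) S}
    (hg : b.Stable g) (c : S) : b.Stable (c • g) := by
  rw [Stable, tensorPow_smul, Matrix.smul_mul, Matrix.mul_smul, Matrix.mul_smul, hg]

theorem stable_cayleyNum
    {ξ : Matrix (Fin (n + 1) ⊕ Fin (n + 1)) (Fin (n + 1) ⊕ Fin (n + 1)) S}
    (hξ : ξᵀ * splitForm n S = - (splitForm n S * ξ)) : b.Stable (cayleyNum ξ) := by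
  rw [Stable, ← Matrix.mul_assoc]
  ext x i
  have hA : ((b.pt i).map (algebraMap ℚ S))ᵀ = - (b.pt i).map (algebraMap ℚ S) := by
    rw [← Matrix.transpose_map, b.skew, Matrix.map_neg _ (map_neg _)]
  have h := b.proj_frameVec_cayleyNum hξ hA
  rw [← tensorPow_mulVec_frameVec] at h
  exact congrFun h x

/-- Stability is the vanishing of finitely many ring elements that commute with base change; in this
form it can be tested on localizations. -/
theorem stable_map_iff (f : S →+* S')
    (g : Matrix (Fin (n + 1) ⊕ Fin (n + 1)) (Fin (n + 1) ⊕ Fin (n + 1)) S) :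
    b.Stable (g.map f) ↔ ∀ x i, f ((b.vecs S * (b.coords S * (tensorPow n m g * b.vecs S)) -
      tensorPow n m g * b.vecs S) x i) = 0 := by
  have h : (b.vecs S * (b.coords S * (tensorPow n m g * b.vecs S)) -
      tensorPow n m g * b.vecs S).map f =
      b.vecs S' * (b.coords S' * (tensorPow n m (g.map f) * b.vecs S')) -
      tensorPow n m (g.map f) * b.vecs S' := by
    rw [Matrix.map_sub f (map_sub f)]
    simp only [Matrix.map_mul, vecs_map (S' := S'), coords_map (S' := S'), tensorPow_map]
  rw [Stable, ← sub_eq_zero, ← h, ← Matrix.ext_iff]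
  rfl

/-- Stability can be checked locally. -/
theorem stable_of_localization
    {g : Matrix (Fin (n + 1) ⊕ Fin (n + 1)) (Fin (n + 1) ⊕ Fin (n + 1)) S}
    (h : ∀ (P : Ideal S) [P.IsMaximal],
      b.Stable (g.map (algebraMap S (Localization.AtPrime P)))) : b.Stable g := by
  rw [Stable, ← sub_eq_zero]
  ext x i
  refine eq_zero_of_localization _ fun P hP => ?_
  exact (b.stable_map_iff _ _).1 (h P) x i

/-- The matrix by which `g` acts on the span of the big cell. -/
def rep (g : Matrix (Fin (n + 1) ⊕ Fin (n + 1)) (Fin (n + 1) ⊕ Fin (n + 1)) S) :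
    Matrix (Fin r) (Fin r) S :=
  b.coords S * (tensorPow n m g * b.vecs S)

theorem rep_one : b.rep (1 : Matrix _ _ S) = 1 := by
  rw [rep, tensorPow_one, Matrix.one_mul, coords_mul_vecs]

theorem Stable.vecs_mul_rep {b : CellBasis n m r}
    {g : Matrix (Fin (n + 1) ⊕ Fin (n + 1)) (Fin (n + 1) ⊕ Fin (n + 1)) S} (hg : b.Stable g) :
    b.vecs S * b.rep g = tensorPow n m g * b.vecs S := hg

/-- Only the right factor must be stable: the projector is then the identity on what `h` produces,
before `g` acts. -/
theorem Stable.rep_mul {b : CellBasis n m r}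
    (g : Matrix (Fin (n + 1) ⊕ Fin (n + 1)) (Fin (n + 1) ⊕ Fin (n + 1)) S)
    {h : Matrix (Fin (n + 1) ⊕ Fin (n + 1)) (Fin (n + 1) ⊕ Fin (n + 1)) S} (hh : b.Stable h) :
    b.rep (g * h) = b.rep g * b.rep h := by
  rw [rep, rep, tensorPow_mul, Matrix.mul_assoc, ← hh.vecs_mul_rep]
  simp only [Matrix.mul_assoc]

theorem rep_map (f : S →+* S')
    (g : Matrix (Fin (n + 1) ⊕ Fin (n + 1)) (Fin (n + 1) ⊕ Fin (n + 1)) S) :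
    (b.rep g).map f = b.rep (g.map f) := by
  simp only [rep, Matrix.map_mul, vecs_map (S' := S'), coords_map (S' := S'), tensorPow_map]

end CellBasis

end ArithSO

end

noncomputable section

open scoped Matrix

namespace ArithSO

/-! ### Special orthogonal groups over local rings are generated by Cayley transforms -/

section LocalRing

variable {X S : Type*} [Fintype X] [CommRing S]

theorem isometry_mul {B g h : Matrix X X S} (hg : gᵀ * B * g = B) (hh : hᵀ * B * h = B) :
    (g * h)ᵀ * B * (g * h) = B := by
  calc _ = hᵀ * (gᵀ * B * g) * h := by simp only [Matrix.transpose_mul, Matrix.mul_assoc]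
    _ = B := by rw [hg, hh]

variable [DecidableEq X]

/-- The genuine Cayley transform, with `u` in the role of the inverse of 1 + ξ. -/
theorem isometry_of_skew {B ξ u : Matrix X X S} (h : ξᵀ * B = - (B * ξ)) (hu : (1 + ξ) * u = 1) :
    ((1 - ξ) * u)ᵀ * B * ((1 - ξ) * u) = B := by
  have h1 : (1 - ξ)ᵀ * B = B * (1 + ξ) := by
    rw [Matrix.transpose_sub, Matrix.transpose_one, sub_mul, h]; noncomm_ring
  have h2 : B * (1 - ξ) = (1 + ξ)ᵀ * B := by
    rw [Matrix.transpose_add, Matrix.transpose_one, add_mul, h]; noncomm_ring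
  have h3 : uᵀ * (1 + ξ)ᵀ = 1 := by rw [← Matrix.transpose_mul, hu, Matrix.transpose_one]
  have hc : (1 + ξ) * (1 - ξ) = (1 - ξ) * (1 + ξ) := by noncomm_ring
  calc _ = uᵀ * ((1 - ξ)ᵀ * B) * (1 - ξ) * u := by
        simp only [Matrix.transpose_mul, Matrix.mul_assoc]
    _ = uᵀ * B * ((1 + ξ) * (1 - ξ)) * u := by rw [h1]; simp only [Matrix.mul_assoc]
    _ = uᵀ * (B * (1 - ξ)) * ((1 + ξ) * u) := by rw [hc]; simp only [Matrix.mul_assoc]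
    _ = B := by rw [h2, hu, ← Matrix.mul_assoc, h3, Matrix.one_mul, Matrix.mul_one]

theorem isUnit_ofNat_of_algebra_rat [Algebra ℚ S] (k : ℕ) [k.AtLeastTwo] :
    IsUnit (OfNat.ofNat k : S) := by
  have h := (isUnit_iff_ne_zero.2 (OfNat.ofNat_ne_zero (R := ℚ) k)).map (algebraMap ℚ S)
  rwa [map_ofNat] at h

/-- An isometry `g` such that `1 + g` is invertible is a multiple of a Cayley transform. -/
theorem exists_cayleyNum_eq [Algebra ℚ S] {B g : Matrix X X S} (hg : gᵀ * B * g = B)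
    (hu : IsUnit (1 + g)) :
    ∃ ξ : Matrix X X S, ξᵀ * B = - (B * ξ) ∧ ∃ c : S, g = c • cayleyNum ξ := by
  obtain ⟨u, hu1⟩ := hu.exists_right_inv
  have hu2 : u * (1 + g) = 1 := mul_eq_one_comm.1 hu1
  have h2 : IsUnit (2 : S) := isUnit_ofNat_of_algebra_rat 2
  -- The Cayley transform is an involution: for ξ = (1 - g)u one has 1 + ξ = 2u and 1 - ξ = 2gu, so
  -- the transform of ξ is g once 2 is inverted.
  have hp : 1 + (1 - g) * u = (2 : S) • u := by
    nth_rewrite 1 [← hu1]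
    rw [← add_mul, two_smul]; noncomm_ring
  have hm : 1 - (1 - g) * u = (2 : S) • (g * u) := by
    nth_rewrite 1 [← hu1]
    rw [← sub_mul, two_smul]; noncomm_ring
  refine ⟨(1 - g) * u, ?_, ?_⟩
  · have hut : uᵀ * (1 + gᵀ) = 1 := by
      rw [← Matrix.transpose_one, ← Matrix.transpose_add, ← Matrix.transpose_mul, hu1]
    have key : (1 - gᵀ) * B * (1 + g) = - ((1 + gᵀ) * B * (1 - g)) := by
      have e1 : (1 - gᵀ) * B * (1 + g) = B + B * g - gᵀ * B - gᵀ * B * g := by noncomm_ring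
      have e2 : (1 + gᵀ) * B * (1 - g) = B - B * g + gᵀ * B - gᵀ * B * g := by noncomm_ring
      rw [e1, e2, hg]; noncomm_ring
    calc ((1 - g) * u)ᵀ * B = uᵀ * ((1 - gᵀ) * B) * ((1 + g) * u) := by
          rw [hu1, Matrix.mul_one, Matrix.transpose_mul, Matrix.transpose_sub,
            Matrix.transpose_one, Matrix.mul_assoc]
      _ = uᵀ * ((1 - gᵀ) * B * (1 + g)) * u := by simp only [Matrix.mul_assoc]
      _ = - (uᵀ * (1 + gᵀ) * B * ((1 - g) * u)) := by
          rw [key]; simp only [Matrix.mul_neg, Matrix.neg_mul, Matrix.mul_assoc]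
      _ = _ := by rw [hut, Matrix.one_mul]
  · have hdet : IsUnit (1 + (1 - g) * u).det := by
      rw [hp, Matrix.det_smul]
      refine (h2.pow _).mul ?_
      rw [← Matrix.isUnit_iff_isUnit_det]
      exact IsUnit.of_mul_eq_one _ hu2
    have h := cayleyNum_mul ((1 - g) * u)
    have h3 : cayleyNum ((1 - g) * u) = (1 + (1 - g) * u).det • g := by
      have h4 := congrArg (fun M => (Ring.inverse (2 : S)) • (M * (1 + g))) h
      rw [hm] at h4
      nth_rewrite 1 [hp] at h4
      rw [Matrix.mul_smul, Matrix.smul_mul, smul_smul, Ring.inverse_mul_cancel _ h2,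
        one_smul, Matrix.mul_assoc, hu2, Matrix.mul_one, smul_comm, Matrix.smul_mul,
        smul_smul, Ring.inverse_mul_cancel _ h2, one_smul, Matrix.smul_mul, Matrix.mul_assoc, hu2,
        Matrix.mul_one] at h4
      exact h4
    refine ⟨Ring.inverse (1 + (1 - g) * u).det, ?_⟩
    rw [h3, smul_smul, Ring.inverse_mul_cancel _ hdet, one_smul]

/-- With A the diagonal form, gᵀA(1 + g) = (1 + g)ᵀA; take determinants and cancel det A · det(1 +
g). -/
theorem det_eq_one_of_isUnit_one_add {a : X → S} (ha : ∀ j, IsUnit (a j)) {g : Matrix X X S}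
    (hg : gᵀ * Matrix.diagonal a * g = Matrix.diagonal a) (hu : IsUnit (1 + g)) : g.det = 1 := by
  have h1 : gᵀ * Matrix.diagonal a * (1 + g) = (1 + g)ᵀ * Matrix.diagonal a := by
    rw [Matrix.mul_add, hg, Matrix.mul_one, Matrix.transpose_add, Matrix.transpose_one,
      Matrix.add_mul, Matrix.one_mul, add_comm]
  have h2 := congrArg Matrix.det h1
  simp only [Matrix.det_mul, Matrix.det_transpose, Matrix.det_diagonal] at h2
  have hA : IsUnit (∏ j, a j) := by
    rw [IsUnit.prod_univ_iff]; exact ha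
  rw [Matrix.isUnit_iff_isUnit_det] at hu
  have h3 : g.det * ((∏ j, a j) * (1 + g).det) = 1 * ((∏ j, a j) * (1 + g).det) := by
    rw [← mul_assoc, h2, one_mul, mul_comm]
  exact (hA.mul hu).mul_right_cancel h3

/-- Rows of the identity matrix are exchanged one by one for rows of g + diag(s). At each exchange
the determinants for the two signs differ by 2 times the previous determinant, a unit, so in a local
ring at least one of them is a unit. -/
theorem exists_sign_isUnit_det [IsLocalRing S] (h2 : IsUnit (2 : S)) (g : Matrix X X S) :
    ∃ s : X → ℤˣ, IsUnit (g + Matrix.diagonal fun j => ((s j : ℤ) : S)).det := by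
  suffices H : ∀ t : Finset X, ∃ s : X → ℤˣ, IsUnit (Matrix.det
      (Matrix.of fun i => if i ∈ t then g i + ((s i : ℤ) : S) • (1 : Matrix X X S) i
        else (1 : Matrix X X S) i)) by
    obtain ⟨s, hs⟩ := H Finset.univ
    refine ⟨s, ?_⟩
    convert hs using 1
    congr 1
    ext i j
    simp [Matrix.diagonal_apply, Matrix.one_apply]
  intro t
  induction t using Finset.induction_on with
  | empty =>
    refine ⟨1, ?_⟩
    have : (Matrix.of fun i => (1 : Matrix X X S) i) = 1 := rfl
    simp [this]
  | insert j t hj ih =>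
    obtain ⟨s, hs⟩ := ih
    set M : Matrix X X S := Matrix.of fun i => if i ∈ t then g i + ((s i : ℤ) : S) • (1 : Matrix X X S) i
        else (1 : Matrix X X S) i with hM
    have hMj : M.updateRow j ((1 : Matrix X X S) j) = M := by
      have : M j = (1 : Matrix X X S) j := by
        ext k
        simp [hM, hj]
      rw [← this, Matrix.updateRow_eq_self]
    have key : ∀ e : ℤˣ, (Matrix.det (Matrix.of fun i => if i ∈ insert j t then
        g i + (((Function.update s j e) i : ℤ) : S) • (1 : Matrix X X S) i
        else (1 : Matrix X X S) i)) = (M.updateRow j (g j)).det + ((e : ℤ) : S) * M.det := by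
      intro e
      nth_rewrite 2 [← hMj]
      rw [← Matrix.det_updateRow_smul, ← Matrix.det_updateRow_add]
      congr 1
      ext i k
      by_cases hi : i = j
      · subst hi
        simp
      · rw [Matrix.updateRow_ne hi]
        simp [hi, hM]
    by_contra hcon
    push Not at hcon
    have e1 := hcon (Function.update s j 1)
    have e2 := hcon (Function.update s j (-1))
    rw [key] at e1 e2
    have hsub : (2 : S) * M.det = ((M.updateRow j (g j)).det + (((1 : ℤˣ) : ℤ) : S) * M.det) -
        ((M.updateRow j (g j)).det + (((-1 : ℤˣ) : ℤ) : S) * M.det) := by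
      push_cast; ring
    have hn := (IsLocalRing.maximalIdeal S).sub_mem
      ((IsLocalRing.mem_maximalIdeal _).2 e1) ((IsLocalRing.mem_maximalIdeal _).2 e2)
    rw [← hsub, IsLocalRing.mem_maximalIdeal] at hn
    exact hn (h2.mul hs)

/-- The half turn in a coordinate plane is a product of two Cayley transforms. -/
theorem halfTurn_of_cayley [IsLocalRing S] [Algebra ℚ S] {a : X → S} (ha : ∀ j, IsUnit (a j))
    {Pr : Matrix X X S → Prop} (hmul : ∀ g h, Pr g → Pr h → Pr (g * h))
    (hcay : ∀ g, gᵀ * Matrix.diagonal a * g = Matrix.diagonal a → IsUnit (1 + g) → Pr g)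
    {i j : X} (hij : i ≠ j) :
    Pr (Matrix.diagonal fun k => if k = i ∨ k = j then -1 else 1) := by
  -- The values for w = 1 and w = 2 differ by the unit 3 aᵢaⱼ, so they do not both lie in the
  -- maximal ideal.
  obtain ⟨w, hw, hw1⟩ : ∃ w : S, IsUnit w ∧ IsUnit (1 + w ^ 2 * (a i * a j)) := by
    by_contra hcon
    push Not at hcon
    have e1 := hcon 1 isUnit_one
    have e2 := hcon 2 (isUnit_ofNat_of_algebra_rat 2)
    have hn := (IsLocalRing.maximalIdeal S).sub_mem
      ((IsLocalRing.mem_maximalIdeal _).2 e2) ((IsLocalRing.mem_maximalIdeal _).2 e1)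
    have : (1 + 2 ^ 2 * (a i * a j)) - (1 + 1 ^ 2 * (a i * a j)) = 3 * (a i * a j) := by ring
    rw [this, IsLocalRing.mem_maximalIdeal] at hn
    exact hn ((isUnit_ofNat_of_algebra_rat 3 : IsUnit (3 : S)).mul ((ha i).mul (ha j)))
  set c := w ^ 2 * (a i * a j) with hc
  have hcu : IsUnit c := (hw.pow 2).mul ((ha i).mul (ha j))
  obtain ⟨c', hc'⟩ := hcu.exists_left_inv
  obtain ⟨e, he⟩ := hw1.exists_left_inv
  set t : Matrix X X S := Matrix.diagonal fun k => if k = i ∨ k = j then -1 else 1 with ht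
  -- An infinitesimal rotation in the plane of `i` and `j`. It satisfies ξ³ = -cξ, so the identities
  -- below are polynomial identities modulo X³ + cX; `hev` transfers them.
  set ξ : Matrix X X S := Matrix.single j i (w * a i) - Matrix.single i j (w * a j) with hξ
  have hsq : ξ * ξ = - (Matrix.single i i c + Matrix.single j j c) := by
    simp only [hξ, sub_mul, mul_sub, Matrix.single_mul_single_same,
      Matrix.single_mul_single_of_ne _ _ _ _ hij, Matrix.single_mul_single_of_ne _ _ _ _ hij.symm]
    have e1 : w * a i * (w * a j) = c := by rw [hc]; ring
    have e2 : w * a j * (w * a i) = c := by rw [hc]; ring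
    rw [e1, e2]
    abel
  have hcube : ξ ^ 3 = - (c • ξ) := by
    rw [pow_succ, pow_two, hsq]
    simp only [hξ, neg_mul, mul_sub, add_mul, Matrix.single_mul_single_same,
      Matrix.single_mul_single_of_ne _ _ _ _ hij, Matrix.single_mul_single_of_ne _ _ _ _ hij.symm,
      smul_sub, Matrix.smul_single, smul_eq_mul]
    abel
  have hteq : t = 1 + (2 * c') • ξ ^ 2 := by
    rw [pow_two, hsq, smul_neg, smul_add, Matrix.smul_single, Matrix.smul_single, smul_eq_mul,
      mul_assoc, hc', mul_one]
    ext k l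
    by_cases hkl : k = l
    · subst hkl
      by_cases h1 : k = i
      · subst h1
        simp [ht, hij.symm]
        ring
      · by_cases h3 : k = j
        · subst h3
          simp [ht, hij]
          ring
        · simp [ht, h1, h3, Ne.symm h1, Ne.symm h3]
    · simp only [ht, Matrix.diagonal_apply_ne _ hkl, Matrix.add_apply, Matrix.one_apply_ne hkl,
        Matrix.neg_apply, Matrix.single_apply]
      have h1 : ¬ (i = k ∧ i = l) := fun h => hkl (h.1.symm.trans h.2)
      have h3 : ¬ (j = k ∧ j = l) := fun h => hkl (h.1.symm.trans h.2)
      simp [h1, h3]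
  have hskew : ξᵀ * Matrix.diagonal a = - (Matrix.diagonal a * ξ) := by
    ext k l
    simp only [hξ, Matrix.mul_diagonal, Matrix.transpose_apply, Matrix.neg_apply,
      Matrix.diagonal_mul, Matrix.sub_apply, Matrix.single_apply]
    by_cases h1 : i = k ∧ j = l
    · obtain ⟨rfl, rfl⟩ := h1
      simp [hij, hij.symm]; ring
    · by_cases h3 : j = k ∧ i = l
      · obtain ⟨rfl, rfl⟩ := h3
        simp [hij, hij.symm]; ring
      · have h1' : ¬ (j = l ∧ i = k) := fun h => h1 h.symm
        have h3' : ¬ (i = l ∧ j = k) := fun h => h3 h.symm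
        simp [h1, h3, h1', h3']
  have hev : ∀ P Q R : Polynomial S, P - Q = R * (Polynomial.X ^ 3 + Polynomial.C c * Polynomial.X) →
      Polynomial.aeval ξ P = Polynomial.aeval ξ Q := by
    intro P Q R h
    rw [← sub_eq_zero, ← map_sub, h, map_mul]
    have : Polynomial.aeval ξ (Polynomial.X ^ 3 + Polynomial.C c * Polynomial.X) = 0 := by
      simp only [map_add, map_mul, map_pow, Polynomial.aeval_X, Polynomial.aeval_C, hcube]
      rw [← Algebra.smul_def]; simp
    rw [this, mul_zero]
  have hCe : Polynomial.C e * (1 + Polynomial.C c) = 1 := by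
    rw [← Polynomial.C_1, ← Polynomial.C_add, ← Polynomial.C_mul, he]
  have hCc : Polynomial.C c' * Polynomial.C c = 1 := by
    rw [← Polynomial.C_mul, hc', Polynomial.C_1]
  -- On the plane ξ² = -c, hence (1 + ξ)(1 - ξ) = 1 + c there, with inverse `e`; off the plane ξ =
  -- 0.
  have hp1 : (1 + ξ) * (1 - e • ξ + e • ξ ^ 2) = 1 := by
    have := hev ((1 + Polynomial.X) * (1 - Polynomial.C e * Polynomial.X +
      Polynomial.C e * Polynomial.X ^ 2)) 1 (Polynomial.C e)
      (by linear_combination (-Polynomial.X) * hCe)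
    simpa [Algebra.smul_def] using this
  have hm1 : (1 - ξ) * (1 + e • ξ + e • ξ ^ 2) = 1 := by
    have := hev ((1 - Polynomial.X) * (1 + Polynomial.C e * Polynomial.X +
      Polynomial.C e * Polynomial.X ^ 2)) 1 (- Polynomial.C e)
      (by linear_combination (Polynomial.X) * hCe)
    simpa [Algebra.smul_def] using this
  -- On the plane 1 + c'ξ² = 0, so the factors reduce to -ξ and c'ξ.
  have hq1 : (1 - ξ + c' • ξ ^ 2) * (1 + c' • ξ ^ 2 + c' • ξ) = 1 := by
    have := hev ((1 - Polynomial.X + Polynomial.C c' * Polynomial.X ^ 2) *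
      (1 + Polynomial.C c' * Polynomial.X ^ 2 + Polynomial.C c' * Polynomial.X)) 1
      (Polynomial.C c' ^ 2 * (Polynomial.X + 1) - Polynomial.C c')
      (by linear_combination (- Polynomial.C c' * Polynomial.X ^ 2 - Polynomial.C c' * Polynomial.X
            + Polynomial.X) * hCc)
    simpa [Algebra.smul_def] using this
  have hs1 : (1 - ξ) + t * (1 + ξ) = (2 : S) • (1 - ξ + c' • ξ ^ 2) := by
    have := hev ((1 - Polynomial.X) + (1 + Polynomial.C 2 * Polynomial.C c' * Polynomial.X ^ 2) *
        (1 + Polynomial.X)) (Polynomial.C 2 *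
        (1 - Polynomial.X + Polynomial.C c' * Polynomial.X ^ 2)) (Polynomial.C 2 * Polynomial.C c')
      (by
        rw [show (Polynomial.C 2 : Polynomial S) = 2 from rfl]
        linear_combination (-2 * Polynomial.X) * hCc)
    simp only [map_add, map_sub, map_mul, map_one, map_pow, Polynomial.aeval_X,
      Polynomial.aeval_C] at this
    rw [hteq]
    simp only [Algebra.smul_def, map_mul]
    exact this
  set u := 1 - e • ξ + e • ξ ^ 2 with hu
  set v := 1 + e • ξ + e • ξ ^ 2 with hv
  have h2u : IsUnit ((2 : S) • (1 : Matrix X X S)) := by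
    rw [← Algebra.algebraMap_eq_smul_one]
    exact (isUnit_ofNat_of_algebra_rat 2).map _
  have hg2 := isometry_of_skew hskew hp1
  have hg1 : ((1 + ξ) * v)ᵀ * Matrix.diagonal a * ((1 + ξ) * v) = Matrix.diagonal a := by
    have hskew' : (-ξ)ᵀ * Matrix.diagonal a = - (Matrix.diagonal a * (-ξ)) := by
      rw [Matrix.transpose_neg, Matrix.neg_mul, hskew, Matrix.mul_neg]
    have := isometry_of_skew hskew' (u := v) (by rw [← sub_eq_add_neg]; exact hm1)
    rwa [sub_neg_eq_add] at this
  have htt : tᵀ * Matrix.diagonal a * t = Matrix.diagonal a := by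
    rw [ht, Matrix.diagonal_transpose, Matrix.diagonal_mul_diagonal, Matrix.diagonal_mul_diagonal]
    congr 1
    ext k
    split_ifs <;> ring
  -- Split the half turn as (t R⁻¹) R with R the Cayley transform of ξ. Neither factor has
  -- eigenvalue -1, although `t` does.
  have hfac : t = (t * ((1 + ξ) * v)) * ((1 - ξ) * u) := by
    have hm1' : v * (1 - ξ) = 1 := mul_eq_one_comm.1 hm1
    calc t = t * ((1 + ξ) * (v * (1 - ξ)) * u) := by
          rw [hm1', Matrix.mul_one, hp1, Matrix.mul_one]
      _ = _ := by simp only [Matrix.mul_assoc]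
  rw [hfac]
  refine hmul _ _ (hcay _ (isometry_mul htt hg1) ?_) (hcay _ hg2 ?_)
  · have h1 : 1 + t * ((1 + ξ) * v) = (2 : S) • (1 : Matrix X X S) * (1 - ξ + c' • ξ ^ 2) * v := by
      rw [Matrix.smul_mul, Matrix.one_mul, ← hs1, add_mul (1 - ξ), hm1, Matrix.mul_assoc t]
    rw [h1]
    exact (h2u.mul (IsUnit.of_mul_eq_one _ hq1)).mul (IsUnit.of_mul_eq_one_right _ hm1)
  · have h1 : 1 + (1 - ξ) * u = (2 : S) • (1 : Matrix X X S) * u := by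
      nth_rewrite 1 [← hp1]
      rw [← add_mul, add_add_sub_cancel, Matrix.smul_mul, Matrix.one_mul, two_smul, add_mul,
        Matrix.one_mul]
    rw [h1]
    exact h2u.mul (IsUnit.of_mul_eq_one_right _ hp1)

/-- Over a local `ℚ`-algebra the special orthogonal group of a nondegenerate diagonal form is
generated by the isometries `g` such that `1 + g` is invertible. -/
theorem specialOrthogonal_induction [IsLocalRing S] [Algebra ℚ S] {a : X → S}
    (ha : ∀ j, IsUnit (a j)) {Pr : Matrix X X S → Prop}
    (hmul : ∀ g h, Pr g → Pr h → Pr (g * h))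
    (hcay : ∀ g, gᵀ * Matrix.diagonal a * g = Matrix.diagonal a → IsUnit (1 + g) → Pr g)
    {g : Matrix X X S} (hg : gᵀ * Matrix.diagonal a * g = Matrix.diagonal a) (hdet : g.det = 1) :
    Pr g := by
  -- Diagonal sign matrices of determinant one are products of half turns: the number of entries
  -- different from 1 drops by two at each step.
  have hsign : ∀ (k : ℕ) (s : X → ℤˣ), (Finset.univ.filter fun j => s j ≠ 1).card = k →
      ∏ j, s j = 1 → Pr (Matrix.diagonal fun j => ((s j : ℤ) : S)) := by
    intro k
    induction k using Nat.strong_induction_on with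
    | _ k ih =>
      intro s hk hs
      by_cases h1 : ∀ j, s j = 1
      · simp only [h1, Units.val_one, Int.cast_one, Matrix.diagonal_one]
        refine hcay 1 (by simp) ?_
        rw [one_add_one_eq_two]
        have := (isUnit_ofNat_of_algebra_rat (S := S) 2).map (algebraMap S (Matrix X X S))
        rwa [map_ofNat] at this
      · push Not at h1
        obtain ⟨i, hi⟩ := h1
        obtain ⟨j, hji, hj⟩ : ∃ j, j ≠ i ∧ s j ≠ 1 := by
          by_contra hcon
          push Not at hcon
          rw [Finset.prod_eq_single i (fun j _ hj => hcon j hj) (by simp)] at hs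
          exact hi hs
        have hi' : s i = -1 := (Int.units_eq_one_or _).resolve_left hi
        have hj' : s j = -1 := (Int.units_eq_one_or _).resolve_left hj
        let s' : X → ℤˣ := fun k => if k = i ∨ k = j then 1 else s k
        have hss : ∀ k, s k = (if k = i ∨ k = j then -1 else 1) * s' k := by
          intro k
          by_cases hk : k = i ∨ k = j
          · rcases hk with rfl | rfl <;> simp [s', hi', hj']
          · simp [s', hk]
        have hprod : ∏ k, (if k = i ∨ k = j then (-1 : ℤˣ) else 1) = 1 := by
          rw [Finset.prod_ite, Finset.prod_const_one, mul_one, Finset.prod_const]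
          have : (Finset.univ.filter fun k => k = i ∨ k = j) = {i, j} := by
            ext; simp
          rw [this, Finset.card_pair hji.symm]
          rfl
        have hP := ih (Finset.univ.filter fun j => s' j ≠ 1).card (by
          rw [← hk]
          refine Finset.card_lt_card (Finset.ssubset_iff.2 ⟨i, by simp [s'], ?_⟩)
          intro k hk
          rw [Finset.mem_insert] at hk
          rcases hk with rfl | hk
          · simpa using hi
          · simp only [Finset.mem_filter, Finset.mem_univ, true_and, s'] at hk ⊢
            by_contra h
            exact hk (by simp [h])) s' rfl (by
            rw [← hs]
            conv_rhs => rw [Finset.prod_congr rfl fun k _ => hss k]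
            rw [Finset.prod_mul_distrib, hprod, one_mul])
        have := hmul _ _ (halfTurn_of_cayley ha hmul hcay hji.symm) hP
        rw [Matrix.diagonal_mul_diagonal] at this
        convert this using 2
        ext k
        rw [hss k]
        push_cast
        split_ifs <;> simp
  -- Choose signs D with g + D invertible. Then 1 + Dg = D(g + D) is invertible, so det(Dg) = 1,
  -- which forces det D = 1; hence g = D(Dg) splits into the two cases already available.
  obtain ⟨s, hs⟩ := exists_sign_isUnit_det (isUnit_ofNat_of_algebra_rat 2) g
  set D : Matrix X X S := Matrix.diagonal fun j => ((s j : ℤ) : S) with hD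
  have hss : ∀ j, ((s j : ℤ) : S) * ((s j : ℤ) : S) = 1 := by
    intro j
    rcases Int.units_eq_one_or (s j) with h | h <;> simp [h]
  have hDD : D * D = 1 := by
    rw [hD, Matrix.diagonal_mul_diagonal, ← Matrix.diagonal_one]
    congr 1
    ext j
    exact hss j
  have hDa : Dᵀ * Matrix.diagonal a * D = Matrix.diagonal a := by
    rw [hD, Matrix.diagonal_transpose, Matrix.diagonal_mul_diagonal, Matrix.diagonal_mul_diagonal]
    congr 1
    ext j
    rw [mul_right_comm, hss, one_mul]
  have hiso := isometry_mul hDa hg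
  have hu : IsUnit (1 + D * g) := by
    have h1 : 1 + D * g = D * (g + D) := by rw [Matrix.mul_add, hDD, add_comm]
    rw [h1]
    exact (IsUnit.of_mul_eq_one _ hDD).mul ((Matrix.isUnit_iff_isUnit_det _).2 hs)
  have hdD : D.det = 1 := by
    have := det_eq_one_of_isUnit_one_add ha hiso hu
    rwa [Matrix.det_mul, hdet, mul_one] at this
  have hprod : ∏ j, s j = 1 := by
    rw [hD, Matrix.det_diagonal] at hdD
    rcases Int.units_eq_one_or (∏ j, s j) with h | h
    · exact h
    · exfalso
      have h3 : ((∏ j, s j : ℤˣ) : ℤ) = -1 := by rw [h]; rfl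
      have h4 : ∏ j, ((s j : ℤ) : S) = -1 := by
        rw [← Int.cast_prod, ← Units.coe_prod, h3]; simp
      rw [h4] at hdD
      have h5 : (2 : S) = 0 := by
        rw [← one_add_one_eq_two]
        nth_rewrite 1 [← hdD]
        simp
      exact (isUnit_ofNat_of_algebra_rat (S := S) 2).ne_zero h5
  have hg' : g = D * (D * g) := by rw [← Matrix.mul_assoc, hDD, Matrix.one_mul]
  rw [hg']
  exact hmul _ _ (hsign _ s rfl hprod) (hcay _ hiso hu)

end LocalRing

/-! ### Invariance of the cell span under special orthogonal groups -/

namespace CellBasis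

variable {n m r N : ℕ} (b : CellBasis n m r) {S : Type*} [CommRing S] [Algebra ℚ S]

/-- The span of the big cell is stable under the special orthogonal group of any diagonal form
that is isometric to twice the split form. -/
theorem stable_conj {a : Fin N → S} (ha : ∀ j, IsUnit (a j))
    {T : Matrix (Fin N) (Fin (n + 1) ⊕ Fin (n + 1)) S}
    {T' : Matrix (Fin (n + 1) ⊕ Fin (n + 1)) (Fin N) S} (h1 : T' * T = 1) (h2 : T * T' = 1)
    (hT : Tᵀ * Matrix.diagonal a * T = (2 : S) • splitForm n S)
    {g : Matrix (Fin N) (Fin N) S} (hg : gᵀ * Matrix.diagonal a * g = Matrix.diagonal a)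
    (hdet : g.det = 1) : b.Stable (T' * g * T) := by
  apply b.stable_of_localization
  intro P hP
  set f := algebraMap S (Localization.AtPrime P) with hf
  set T₁ := T.map f with hT₁
  set T₁' := T'.map f with hT₁'
  have h1' : T₁' * T₁ = 1 := by
    rw [hT₁, hT₁', ← Matrix.map_mul, h1, Matrix.map_one f (map_zero f) (map_one f)]
  have h2' : T₁ * T₁' = 1 := by
    rw [hT₁, hT₁', ← Matrix.map_mul, h2, Matrix.map_one f (map_zero f) (map_one f)]
  have hdiag : (Matrix.diagonal a).map f = Matrix.diagonal fun j => f (a j) :=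
    Matrix.diagonal_map (map_zero f)
  have hT' : T₁ᵀ * (Matrix.diagonal fun j => f (a j)) * T₁ =
      (2 : Localization.AtPrime P) • splitForm n _ := by
    have := congrArg (fun M => Matrix.map M f) hT
    simp only [Matrix.map_mul, Matrix.transpose_map, hdiag] at this
    rw [hT₁, this, Matrix.map_smul' f _ _ (map_mul f), splitForm_map, map_ofNat]
  have hg' : (g.map f)ᵀ * (Matrix.diagonal fun j => f (a j)) * g.map f =
      Matrix.diagonal fun j => f (a j) := by
    have := congrArg (fun M => Matrix.map M f) hg
    simpa only [Matrix.map_mul, Matrix.transpose_map, hdiag] using this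
  have hdet' : (g.map f).det = 1 := by
    rw [← RingHom.mapMatrix_apply, ← RingHom.map_det, hdet, map_one]
  rw [Matrix.map_mul, Matrix.map_mul]
  refine specialOrthogonal_induction (Pr := fun h => b.Stable (T₁' * h * T₁))
    (a := fun j => f (a j)) (fun j => (ha j).map f) ?_ ?_ hg' hdet'
  · intro x y hx hy
    have h3 : T₁' * (x * y) * T₁ = (T₁' * x * T₁) * (T₁' * y * T₁) := by
      calc _ = T₁' * x * (T₁ * T₁') * y * T₁ := by
            rw [h2', Matrix.mul_one]; simp only [Matrix.mul_assoc]
        _ = _ := by simp only [Matrix.mul_assoc]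
    rw [h3]
    exact hx.mul hy
  · intro x hx hu
    have hiso : (T₁' * x * T₁)ᵀ * splitForm n _ * (T₁' * x * T₁) =
        splitForm n (Localization.AtPrime P) := by
      -- The transported form is twice the split form; the factor 2 cancels.
      have h2u : IsUnit (2 : Localization.AtPrime P) := isUnit_ofNat_of_algebra_rat 2
      have h4 : (2 : Localization.AtPrime P) • ((T₁' * x * T₁)ᵀ * splitForm n _ * (T₁' * x * T₁))
          = (2 : Localization.AtPrime P) • splitForm n _ := by
        rw [← Matrix.smul_mul, ← Matrix.mul_smul, ← hT']
        have h2t : T₁'ᵀ * T₁ᵀ = 1 := by rw [← Matrix.transpose_mul, h2', Matrix.transpose_one]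
        calc _ = T₁ᵀ * xᵀ * (T₁'ᵀ * T₁ᵀ) * (Matrix.diagonal fun j => f (a j)) * (T₁ * T₁') * x * T₁
              := by simp only [Matrix.transpose_mul, Matrix.mul_assoc]
          _ = T₁ᵀ * (xᵀ * (Matrix.diagonal fun j => f (a j)) * x) * T₁ := by
              rw [h2t, h2']; simp only [Matrix.mul_assoc, Matrix.one_mul]
          _ = _ := by rw [hx]
      exact (h2u.smul_left_cancel).1 h4
    have hu' : IsUnit (1 + T₁' * x * T₁) := by
      obtain ⟨u, hu1⟩ := hu.exists_right_inv
      refine IsUnit.of_mul_eq_one (T₁' * u * T₁) ?_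
      have : 1 + T₁' * x * T₁ = T₁' * (1 + x) * T₁ := by
        rw [Matrix.mul_add, Matrix.add_mul, Matrix.mul_one, h1']
      rw [this]
      calc _ = T₁' * (1 + x) * (T₁ * T₁') * u * T₁ := by simp only [Matrix.mul_assoc]
        _ = T₁' * ((1 + x) * u) * T₁ := by
            rw [h2', Matrix.mul_one]; simp only [Matrix.mul_assoc]
        _ = 1 := by rw [hu1, Matrix.mul_one, h1']
    obtain ⟨ξ, hξ, c, hc⟩ := exists_cayleyNum_eq hiso hu'
    rw [hc]
    exact (b.stable_cayleyNum hξ).smul c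

end CellBasis

end ArithSO

end

noncomputable section

open scoped Matrix

namespace ArithSO

/-! ### Eventually polynomial functions -/

/-- The function `h` agrees with a polynomial for large arguments. -/
def EventuallyPoly (h : ℕ → ℚ) : Prop :=
  ∃ q : Polynomial ℚ, ∃ m₀ : ℕ, ∀ m, m₀ ≤ m → h m = q.eval (m : ℚ)

theorem EventuallyPoly.add {h h' : ℕ → ℚ} (hh : EventuallyPoly h) (hh' : EventuallyPoly h') :
    EventuallyPoly fun m => h m + h' m := by
  obtain ⟨q, m₀, hq⟩ := hh
  obtain ⟨q', m₀', hq'⟩ := hh'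
  refine ⟨q + q', max m₀ m₀', fun m hm => ?_⟩
  simp only
  rw [hq m (le_of_max_le_left hm), hq' m (le_of_max_le_right hm), Polynomial.eval_add]

theorem EventuallyPoly.sum {ι : Type*} {s : Finset ι} {h : ι → ℕ → ℚ}
    (hh : ∀ i ∈ s, EventuallyPoly (h i)) : EventuallyPoly fun m => ∑ i ∈ s, h i m := by
  classical
  induction s using Finset.induction_on with
  | empty => exact ⟨0, 0, fun m _ => by simp⟩
  | insert i s hi ih =>
    simp only [Finset.sum_insert hi]
    exact (hh i (Finset.mem_insert_self i s)).add
      (ih fun k hk => hh k (Finset.mem_insert_of_mem hk))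

theorem EventuallyPoly.shift {h : ℕ → ℚ} (hh : EventuallyPoly h) (j : ℕ) :
    EventuallyPoly fun m => h (m - j) := by
  obtain ⟨q, m₀, hq⟩ := hh
  -- From m₀ + j on, the truncated subtraction agrees with the one in ℚ.
  refine ⟨q.comp (Polynomial.X - Polynomial.C (j : ℚ)), m₀ + j, fun m hm => ?_⟩
  simp only
  rw [hq _ (by omega), Polynomial.eval_comp, Nat.cast_sub (by omega)]
  simp

theorem EventuallyPoly.congr {h h' : ℕ → ℚ} (hh : EventuallyPoly h) (m₁ : ℕ)
    (e : ∀ m, m₁ ≤ m → h' m = h m) : EventuallyPoly h' := by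
  obtain ⟨q, m₀, hq⟩ := hh
  exact ⟨q, max m₀ m₁, fun m hm => by
    rw [e m (le_of_max_le_right hm), hq m (le_of_max_le_left hm)]⟩

/-- Faulhaber's formula, extended linearly from monomials. -/
theorem exists_sum_range_eval (q : Polynomial ℚ) :
    ∃ Q : Polynomial ℚ, ∀ m : ℕ, ∑ i ∈ Finset.range m, q.eval (i : ℚ) = Q.eval (m : ℚ) := by
  induction q using Polynomial.induction_on' with
  | add p q hp hq =>
    obtain ⟨P, hP⟩ := hp
    obtain ⟨Q, hQ⟩ := hq
    exact ⟨P + Q, fun m => by simp [Finset.sum_add_distrib, hP, hQ]⟩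
  | monomial k c =>
    refine ⟨Polynomial.C c * ∑ i ∈ Finset.range (k + 1), Polynomial.C
      (bernoulli i * ((k + 1).choose i) / (k + 1)) * Polynomial.X ^ (k + 1 - i), fun m => ?_⟩
    simp only [Polynomial.eval_monomial, ← Finset.mul_sum, sum_range_pow, Polynomial.eval_mul,
      Polynomial.eval_C, Polynomial.eval_finsetSum, Polynomial.eval_pow, Polynomial.eval_X]
    congr 1
    refine Finset.sum_congr rfl fun i _ => ?_
    ring

theorem EventuallyPoly.sum_range {h : ℕ → ℚ} (hh : EventuallyPoly h) :
    EventuallyPoly fun m => ∑ i ∈ Finset.range m, h i := by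
  obtain ⟨q, m₀, hq⟩ := hh
  obtain ⟨Q, hQ⟩ := exists_sum_range_eval q
  -- The finitely many arguments at which `h` is not yet polynomial contribute a constant.
  refine ⟨Q + Polynomial.C (∑ i ∈ Finset.range m₀, (h i - q.eval (i : ℚ))), m₀, fun m hm => ?_⟩
  rw [Polynomial.eval_add, Polynomial.eval_C, ← hQ, ← sub_eq_iff_eq_add', ← Finset.sum_sub_distrib]
  symm
  refine Finset.sum_subset (Finset.range_mono hm) fun i _ hi => ?_
  rw [hq i (by simpa using hi), sub_self]

/-! ### Counting the elements of a lower set by degree -/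

open scoped Classical in
/-- The number of elements of degree `m` of a set of exponents. -/
def degreeCount {k : ℕ} (D : Set (Fin k → ℕ)) (m : ℕ) : ℕ :=
  ((Finset.Nat.antidiagonalTuple k m).filter (· ∈ D)).card

/-- Dickson's lemma: the complement of a lower set has only finitely many minimal elements. Beyond
the largest of their first coordinates the slices no longer change. -/
theorem exists_stable_slice {k : ℕ} {D : Set (Fin (k + 1) → ℕ)} (hD : IsLowerSet D) :
    ∃ j₀ : ℕ, ∀ j, j₀ ≤ j → ∀ a : Fin k → ℕ,
      (Fin.cons j a : Fin (k + 1) → ℕ) ∈ D ↔ (Fin.cons j₀ a : Fin (k + 1) → ℕ) ∈ D := by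
  have hfin : {b : Fin (k + 1) → ℕ | Minimal (· ∈ Dᶜ) b}.Finite :=
    WellQuasiOrderedLE.finite_of_isAntichain (setOfPred_minimal_antichain _)
  obtain ⟨j₀, hj₀⟩ := (hfin.image fun b => b 0).bddAbove
  refine ⟨j₀, fun j hj a => ⟨fun h => hD ?_ h, fun h => ?_⟩⟩
  · exact Fin.cons_le_cons.2 ⟨hj, le_rfl⟩
  · by_contra hcon
    obtain ⟨b, hb, hbmin⟩ := exists_minimal_le_of_wellFoundedLT (· ∈ Dᶜ) _ hcon
    refine hbmin.prop (hD ?_ h)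
    have h0 : b 0 ≤ j₀ := hj₀ ⟨b, hbmin, rfl⟩
    intro i
    refine Fin.cases ?_ (fun i => ?_) i
    · simpa using h0
    · simpa using hb i.succ

theorem degreeCount_succ {k : ℕ} (D : Set (Fin (k + 1) → ℕ)) (m : ℕ) :
    degreeCount D m = ∑ j ∈ Finset.range (m + 1),
      degreeCount {a : Fin k → ℕ | (Fin.cons j a : Fin (k + 1) → ℕ) ∈ D} (m - j) := by
  classical
  simp only [degreeCount]
  rw [← Finset.card_sigma]
  refine Finset.card_nbij' (fun b => ⟨b 0, Fin.tail b⟩) (fun c => Fin.cons c.1 c.2) ?_ ?_ ?_ ?_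
  · intro b hb
    simp only [Finset.coe_filter, Finset.Nat.mem_antidiagonalTuple, Set.mem_ofPred_eq,
      Fin.sum_univ_succ] at hb
    simp only [Finset.coe_sigma, Set.mem_sigma_iff, Finset.coe_range, Set.mem_Iio,
      Finset.coe_filter, Finset.Nat.mem_antidiagonalTuple, Set.mem_ofPred_eq, Fin.cons_self_tail]
    refine ⟨by omega, ?_, hb.2⟩
    have : ∑ i, Fin.tail b i = ∑ i : Fin k, b i.succ := rfl
    omega
  · rintro ⟨j, a⟩ hc
    simp only [Finset.coe_sigma, Set.mem_sigma_iff, Finset.coe_range, Set.mem_Iio,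
      Finset.coe_filter, Finset.Nat.mem_antidiagonalTuple, Set.mem_ofPred_eq] at hc
    simp only [Finset.coe_filter, Finset.Nat.mem_antidiagonalTuple, Set.mem_ofPred_eq,
      Fin.sum_univ_succ, Fin.cons_zero, Fin.cons_succ]
    exact ⟨by omega, hc.2.2⟩
  · intro b _
    simp
  · rintro ⟨j, a⟩ _
    simp

/-- Induct on the number of variables and slice by the first exponent: finitely many slices before
`j₀` give shifted counts, and the remaining equal slices give a summatory function, both eventually
polynomial. -/
theorem eventuallyPoly_degreeCount {k : ℕ} {D : Set (Fin k → ℕ)} (hD : IsLowerSet D) :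
    EventuallyPoly fun m => degreeCount D m := by
  induction k with
  | zero =>
    -- Without variables there is nothing of positive degree; degree 0 is the exception that the
    -- threshold 1 skips.
    refine ⟨0, 1, fun m hm => ?_⟩
    obtain ⟨m, rfl⟩ := Nat.exists_eq_add_of_le' hm
    simp [degreeCount, Finset.Nat.antidiagonalTuple_zero_succ]
  | succ k ih =>
    obtain ⟨j₀, hj₀⟩ := exists_stable_slice hD
    have hlow : ∀ j, IsLowerSet {a : Fin k → ℕ | (Fin.cons j a : Fin (k + 1) → ℕ) ∈ D} :=
      fun j a b hab ha => hD (Fin.cons_le_cons.2 ⟨le_rfl, hab⟩) ha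
    have h1 : EventuallyPoly fun m => ∑ j ∈ Finset.range j₀,
        (degreeCount {a : Fin k → ℕ | (Fin.cons j a : Fin (k + 1) → ℕ) ∈ D} (m - j) : ℚ) :=
      EventuallyPoly.sum fun j _ => (ih (hlow j)).shift j
    have h2 := ((ih (hlow j₀)).sum_range).shift j₀
    have h3 := h1.add ((h2.congr (h' := fun m => ∑ i ∈ Finset.range (m - j₀),
      (degreeCount {a : Fin k → ℕ | (Fin.cons j₀ a : Fin (k + 1) → ℕ) ∈ D} i : ℚ)) 0
        fun _ _ => rfl).add (ih (hlow j₀) |>.shift j₀))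
    refine h3.congr j₀ fun m hm => ?_
    rw [degreeCount_succ, Nat.cast_sum, ← Finset.sum_range_add_sum_Ico _ (by omega : j₀ ≤ m + 1)]
    congr 1
    rw [← Finset.sum_range_succ, Finset.sum_Ico_eq_sum_range, ← Finset.sum_range_reflect]
    have hmj : m + 1 - j₀ = m - j₀ + 1 := by omega
    rw [hmj]
    refine Finset.sum_congr rfl fun i hi => ?_
    rw [Finset.mem_range] at hi
    have e1 : m - (j₀ + (m - j₀ + 1 - 1 - i)) = i := by omega
    rw [e1]
    congr 2
    ext a
    exact hj₀ _ (by omega) a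

/-! ### Standard monomials -/

open scoped Classical in
-- Greedy choice of a basis: run through the indices in increasing order and keep a vector exactly
-- when it is not in the span of the earlier ones.
theorem finrank_span_image_eq_card {ι W : Type*} [LinearOrder ι] [AddCommGroup W] [Module ℚ W]
    (v : ι → W) (s : Finset ι) :
    Module.finrank ℚ (Submodule.span ℚ (v '' s)) =
      (s.filter fun i => v i ∉ Submodule.span ℚ (v '' {j | j ∈ s ∧ j < i})).card := by
  induction s using Finset.induction_on_max with
  | empty => rw [Finset.coe_empty, Set.image_empty, Submodule.span_empty]; simp
  | insert i s hlt ih =>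
    have hi : i ∉ s := fun h => lt_irrefl _ (hlt i h)
    have hset : ∀ j ∈ s, {l | l ∈ insert i s ∧ l < j} = {l | l ∈ s ∧ l < j} := by
      intro j hj
      ext l
      simp only [Finset.mem_insert, Set.mem_ofPred_eq]
      constructor
      · rintro ⟨rfl | h, h2⟩
        · exact absurd h2 (hlt j hj).not_gt
        · exact ⟨h, h2⟩
      · rintro ⟨h, h2⟩
        exact ⟨Or.inr h, h2⟩
    have hseti : {l | l ∈ insert i s ∧ l < i} = (s : Set ι) := by
      ext l
      simp only [Finset.mem_insert, Set.mem_ofPred_eq, Finset.mem_coe]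
      constructor
      · rintro ⟨rfl | h, h2⟩
        · exact absurd h2 (lt_irrefl _)
        · exact h
      · exact fun h => ⟨Or.inr h, hlt l h⟩
    have hfil : s.filter (fun j => v j ∉ Submodule.span ℚ (v '' {l | l ∈ insert i s ∧ l < j})) =
        s.filter (fun j => v j ∉ Submodule.span ℚ (v '' {l | l ∈ s ∧ l < j})) :=
      Finset.filter_congr fun j hj => by rw [hset j hj]
    rw [Finset.filter_insert, hseti, hfil, Finset.coe_insert, Set.image_insert_eq]
    by_cases h : v i ∈ Submodule.span ℚ (v '' s)
    · rw [if_neg (not_not.2 h), Submodule.span_insert_eq_span h, ih]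
    · rw [if_pos h, Finset.card_insert_of_notMem (fun h2 => hi (Finset.mem_filter.1 h2).1), ← ih]
      have : FiniteDimensional ℚ (Submodule.span ℚ (v '' (s : Set ι))) :=
        FiniteDimensional.span_of_finite ℚ (s.finite_toSet.image v)
      have hne : v i ≠ 0 := fun h0 => h (h0 ▸ Submodule.zero_mem _)
      have hdis : Submodule.span ℚ {v i} ⊓ Submodule.span ℚ (v '' (s : Set ι)) = ⊥ :=
        disjoint_iff.1 ((Submodule.disjoint_span_singleton' hne).2 h).symm
      have hsum := Submodule.finrank_sup_add_finrank_inf_eq (Submodule.span ℚ {v i})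
        (Submodule.span ℚ (v '' (s : Set ι)))
      rw [hdis, finrank_bot, add_zero, finrank_span_singleton hne] at hsum
      rw [Submodule.span_insert, hsum, add_comm]

/-- The monomial with exponents `a` in the elements `f i`. -/
def monom {k : ℕ} {R : Type*} [CommRing R] (f : Fin k → R) (a : Fin k → ℕ) : R :=
  ∏ i, f i ^ a i

theorem monom_add {k : ℕ} {R : Type*} [CommRing R] (f : Fin k → R) (a b : Fin k → ℕ) :
    monom f (a + b) = monom f a * monom f b := by
  simp [monom, pow_add, Finset.prod_mul_distrib]

/-- The dimension of the span of the monomials of degree `m` in finitely many elements of a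
commutative algebra is a polynomial in `m` for large `m`. -/
theorem eventuallyPoly_finrank_span_monom {k : ℕ} {R : Type*} [CommRing R] [Algebra ℚ R]
    (f : Fin k → R) :
    EventuallyPoly fun m =>
      (Module.finrank ℚ (Submodule.span ℚ (monom f '' {a | ∑ i, a i = m})) : ℚ) := by
  classical
  let v : Lex (Fin k → ℕ) → R := fun a => monom f (ofLex a)
  -- The standard monomials: those not spanned by lexicographically smaller ones of the same degree.
  -- Multiplying a relation by a monomial preserves order and homogeneity, so multiples of
  -- nonstandard monomials are nonstandard and `D` is a lower set.
  let D : Set (Fin k → ℕ) := {a | monom f a ∉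
    Submodule.span ℚ (monom f '' {b | ∑ i, b i = ∑ i, a i ∧ toLex b < toLex a})}
  have hD : IsLowerSet D := by
    intro a c hca ha hc
    apply ha
    obtain ⟨e, rfl⟩ := exists_add_of_le hca
    have h := Submodule.mem_map_of_mem (f := LinearMap.mulRight ℚ (monom f e)) hc
    rw [Submodule.map_span, ← Set.image_comp] at h
    rw [LinearMap.mulRight_apply, ← monom_add] at h
    refine Submodule.span_mono ?_ h
    rintro _ ⟨b, ⟨hb, hlt⟩, rfl⟩
    refine ⟨b + e, ⟨?_, ?_⟩, ?_⟩
    · simp [Finset.sum_add_distrib, hb]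
    · rw [toLex_add, toLex_add]
      exact add_lt_add_left hlt _
    · simp [monom_add]
  refine (eventuallyPoly_degreeCount hD).congr 0 fun m _ => ?_
  have h1 := finrank_span_image_eq_card v ((Finset.Nat.antidiagonalTuple k m).map
    toLex.toEmbedding)
  have himg : v '' ((Finset.Nat.antidiagonalTuple k m).map toLex.toEmbedding) =
      monom f '' {a | ∑ i, a i = m} := by
    ext x
    simp [v, Finset.Nat.mem_antidiagonalTuple]
  rw [← himg, h1, Finset.filter_map, Finset.card_map, degreeCount]
  congr 2
  ext a
  simp only [Finset.mem_filter]
  refine and_congr_right fun ha => ?_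
  rw [Finset.Nat.mem_antidiagonalTuple] at ha
  simp only [D, Function.comp, Set.mem_ofPred_eq, ha]
  have h2 : v '' {j | j ∈ (Finset.Nat.antidiagonalTuple k m).map toLex.toEmbedding ∧
      j < toLex.toEmbedding a} = monom f '' {b | ∑ i, b i = m ∧ toLex b < toLex a} := by
    ext x
    constructor
    · rintro ⟨j, ⟨hj, hlt⟩, rfl⟩
      rw [Finset.mem_map] at hj
      obtain ⟨b, hb, rfl⟩ := hj
      exact ⟨b, ⟨Finset.Nat.mem_antidiagonalTuple.1 hb, hlt⟩, rfl⟩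
    · rintro ⟨b, ⟨hb, hlt⟩, rfl⟩
      exact ⟨toLex b, ⟨Finset.mem_map.2 ⟨b, Finset.Nat.mem_antidiagonalTuple.2 hb, rfl⟩, hlt⟩, rfl⟩
  exact Iff.of_eq (congrArg (fun T => monom f a ∉ Submodule.span ℚ T) h2)

end ArithSO

end

noncomputable section

open scoped Matrix

namespace ArithSO

/-! ### The dimension of the span of the big cell -/

section Dimension

/-- The maximal minors of the frame that belongs to the generic skew matrix. -/
def genMinor (n : ℕ) (x : Fin (n + 1) → Fin (n + 1) ⊕ Fin (n + 1)) : MvPolynomial (Pairs n) ℚ :=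
  ((cell (genSkew n)).submatrix x id).det

theorem exists_prod_eq_of_card {ι R : Type*} [CommMonoid R] (g : ι → R) (M : Multiset ι) :
    ∃ x : Fin (Multiset.card M) → ι, ∏ s, g (x s) = (M.map g).prod := by
  obtain ⟨l, rfl⟩ := Quot.exists_rep M
  refine ⟨fun s => l.get s, ?_⟩
  change ∏ s : Fin l.length, g (l.get s) = _
  rw [show (∏ s : Fin l.length, g (l.get s)) = (l.map g).prod from Fin.prod_univ_fun_getElem l g]
  rfl

/-- A product of `m` generators is determined by how often each occurs; this passes from tensor
indices to exponents. -/
theorem range_prod_eq_image_monom {k m : ℕ} {R : Type*} [CommRing R] (f : Fin k → R) :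
    Set.range (fun x : Fin m → Fin k => ∏ s, f (x s)) = monom f '' {a | ∑ i, a i = m} := by
  classical
  ext y
  constructor
  · rintro ⟨x, rfl⟩
    refine ⟨fun i => (Finset.univ.filter fun s => x s = i).card, ?_, ?_⟩
    · have := Finset.card_eq_sum_card_fiberwise (s := Finset.univ) (t := Finset.univ) (f := x)
        (fun _ _ => by simp)
      simpa using this.symm
    · simp only [monom]
      rw [← Finset.prod_fiberwise' Finset.univ x f]
      simp
  · rintro ⟨a, ha, rfl⟩
    obtain ⟨x, hx⟩ := exists_prod_eq_of_card f (∑ i, a i • ({i} : Multiset (Fin k)))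
    have hcard : Multiset.card (∑ i, a i • ({i} : Multiset (Fin k))) = m := by
      rw [Multiset.card_sum]; simpa using ha
    subst hcard
    refine ⟨x, hx.trans ?_⟩
    rw [← Multiset.coe_mapAddMonoidHom, map_sum]
    simp only [map_nsmul, Multiset.coe_mapAddMonoidHom, Multiset.map_singleton,
      Multiset.prod_sum, Multiset.prod_nsmul, Multiset.prod_singleton, monom]

theorem range_frameVec_genSkew (n m : ℕ) :
    Set.range (frameVec m (cell (genSkew n))) =
      Set.range (fun x : Fin m → Fin (n + 1) → Fin (n + 1) ⊕ Fin (n + 1) =>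
        ∏ s, genMinor n (x s)) := by
  ext y
  constructor
  · rintro ⟨x, rfl⟩
    exact ⟨fun s a => x (s, a), rfl⟩
  · rintro ⟨x, rfl⟩
    exact ⟨fun z => x z.1 z.2, rfl⟩

/-- Row rank equals column rank: the values of a polynomial vector span a space of the same
dimension as its entries. The coordinates of the generic vector in a cell basis span the same space
as its entries, and they are independent because evaluation at the basis points yields the identity
matrix. -/
theorem finrank_cellSpan (n m : ℕ) :
    Module.finrank ℚ (cellSpan n m) =
      Module.finrank ℚ (Submodule.span ℚ (Set.range (frameVec m (cell (genSkew n))))) := by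
  obtain ⟨b⟩ := exists_cellBasis n m
  set p := frameVec m (cell (genSkew n)) with hp
  let c : Fin (Module.finrank ℚ (cellSpan n m)) → MvPolynomial (Pairs n) ℚ :=
    b.coords (MvPolynomial (Pairs n) ℚ) *ᵥ p
  have hc : ∀ i, c i = ∑ y, b.coord i y • p y := by
    intro i
    simp [c, CellBasis.coords, Matrix.mulVec, dotProduct, Algebra.smul_def]
  have hpc : ∀ x, p x = ∑ i, b.vecs ℚ x i • c i := by
    intro x
    have h := congrFun (b.vecs_mul_coords_mulVec (m := m) (genSkew_transpose (n := n))) x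
    rw [← Matrix.mulVec_mulVec] at h
    rw [hp, ← h, b.vecs_eq_map]
    simp [Matrix.mulVec, dotProduct, Algebra.smul_def, c, hp]
  have hspan : Submodule.span ℚ (Set.range p) = Submodule.span ℚ (Set.range c) := by
    apply le_antisymm <;> rw [Submodule.span_le]
    · rintro _ ⟨x, rfl⟩
      rw [SetLike.mem_coe, hpc]
      exact Submodule.sum_mem _ fun i _ => Submodule.smul_mem _ _ (Submodule.subset_span ⟨i, rfl⟩)
    · rintro _ ⟨i, rfl⟩
      rw [SetLike.mem_coe, hc]
      exact Submodule.sum_mem _ fun i _ => Submodule.smul_mem _ _ (Submodule.subset_span ⟨i, rfl⟩)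
  have hev : ∀ i j, MvPolynomial.aeval (fun z : Pairs n => b.pt j z.1.1 z.1.2) (c i) =
      if i = j then 1 else 0 := by
    intro i j
    rw [hc, map_sum]
    have h1 : ∀ y, (MvPolynomial.aeval fun z : Pairs n => b.pt j z.1.1 z.1.2) (p y) =
        frameVec m (cell (b.pt j)) y := by
      intro y
      conv_rhs => rw [← exists_genSkew_map_eq (b.skew j), ← cell_map, frameVec_map]
      rfl
    have h2 := congrFun (congrFun b.coord_mul i) j
    rw [Matrix.mul_apply] at h2
    simp only [map_smul, h1, smul_eq_mul]
    rw [Matrix.one_apply] at h2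
    exact h2
  have hli : LinearIndependent ℚ c := by
    rw [Fintype.linearIndependent_iff]
    intro g hg j
    have := congrArg (MvPolynomial.aeval (fun z : Pairs n => b.pt j z.1.1 z.1.2)) hg
    simpa [map_sum, hev] using this
  rw [hspan, finrank_span_eq_card hli, Fintype.card_fin]

theorem genMinor_inl (n : ℕ) : genMinor n Sum.inl = 1 := by
  have : (cell (genSkew n)).submatrix Sum.inl id = 1 := by
    ext i j
    simp [cell]
  rw [genMinor, this, Matrix.det_one]

/-- Replacing one row of the identity block by a row of A leaves a single entry of A as the minor.
With `genMinor_inl`, the minors include 1 and all coordinate functions. -/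
theorem genMinor_update (n : ℕ) (z : Pairs n) :
    genMinor n (Function.update Sum.inl z.1.2 (Sum.inr z.1.1)) = MvPolynomial.X z := by
  have : (cell (genSkew n)).submatrix (Function.update Sum.inl z.1.2 (Sum.inr z.1.1)) id =
      (1 : Matrix _ _ (MvPolynomial (Pairs n) ℚ)).updateRow z.1.2 (genSkew n z.1.1) := by
    ext1 i j
    by_cases h : i = z.1.2
    · subst h
      simp [cell]
    · simp [cell, h]
  rw [genMinor, this, ← Matrix.cramer_transpose_apply, Matrix.transpose_one, Matrix.cramer_one]
  simp [genSkew, z.2]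

/-- All monomials with exponents at most `t` in the coordinates occur after padding with the minor
1. The summand 1 in the degree keeps the multiplier positive when there are no coordinates (n = 0),
so these degrees still tend to infinity. -/
theorem le_finrank_cellSpan (n t : ℕ) :
    (t + 1) ^ Fintype.card (Pairs n) ≤
      Module.finrank ℚ (cellSpan n ((Fintype.card (Pairs n) + 1) * t)) := by
  classical
  rw [finrank_cellSpan, range_frameVec_genSkew]
  let e : (Pairs n → Fin (t + 1)) → (Pairs n →₀ ℕ) := fun u =>
    Finsupp.equivFunOnFinite.symm fun z => (u z : ℕ)
  have he : Function.Injective e := by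
    intro u v h
    ext z
    exact DFunLike.congr_fun h z
  have hli := (MvPolynomial.basisMonomials (Pairs n) ℚ).linearIndependent.comp e he
  have hcard := finrank_span_eq_card hli
  rw [Fintype.card_fun, Fintype.card_fin] at hcard
  rw [← hcard]
  have hfin : Module.Finite ℚ (Submodule.span ℚ (Set.range
      (fun x : Fin ((Fintype.card (Pairs n) + 1) * t) → Fin (n + 1) → Fin (n + 1) ⊕ Fin (n + 1) =>
        ∏ s, genMinor n (x s)))) := FiniteDimensional.span_of_finite ℚ (Set.finite_range _)
  refine Submodule.finrank_mono (Submodule.span_mono ?_)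
  rintro _ ⟨u, rfl⟩
  have hle : ∑ z, (u z : ℕ) ≤ (Fintype.card (Pairs n) + 1) * t := by
    have h1 : ∑ z, (u z : ℕ) ≤ ∑ _z : Pairs n, t := Finset.sum_le_sum fun z _ => by omega
    rw [Finset.sum_const, Finset.card_univ, smul_eq_mul] at h1
    nlinarith
  obtain ⟨x, hx⟩ := exists_prod_eq_of_card (genMinor n)
    (∑ z, (u z : ℕ) • ({Function.update Sum.inl z.1.2 (Sum.inr z.1.1)} : Multiset _) +
      ((Fintype.card (Pairs n) + 1) * t - ∑ z, (u z : ℕ)) • {Sum.inl})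
  have hc : Multiset.card (∑ z, (u z : ℕ) •
      ({Function.update Sum.inl z.1.2 (Sum.inr z.1.1)} :
        Multiset (Fin (n + 1) → Fin (n + 1) ⊕ Fin (n + 1))) +
      ((Fintype.card (Pairs n) + 1) * t - ∑ z, (u z : ℕ)) • {Sum.inl}) =
      (Fintype.card (Pairs n) + 1) * t := by
    rw [Multiset.card_add, Multiset.card_sum]
    simp only [Multiset.card_nsmul, Multiset.card_singleton, mul_one]
    omega
  rw [← hc]
  refine ⟨x, hx.trans ?_⟩
  rw [Multiset.map_add, Multiset.prod_add, ← Multiset.coe_mapAddMonoidHom, map_sum]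
  simp only [map_nsmul, Multiset.coe_mapAddMonoidHom, Multiset.map_singleton, genMinor_inl,
    genMinor_update, Multiset.prod_sum, Multiset.prod_nsmul, Multiset.prod_singleton, one_pow,
    mul_one, Function.comp, MvPolynomial.coe_basisMonomials]
  rw [MvPolynomial.monomial_eq, Finsupp.prod_fintype _ _ (by simp)]
  simp [e]

/-- If `B` bounds the degrees of the minors, a product of `m` of them has exponents at most mB in
each variable; count such monomials. -/
theorem exists_finrank_cellSpan_le (n : ℕ) :
    ∃ B : ℕ, ∀ m, Module.finrank ℚ (cellSpan n m) ≤ (m * B + 1) ^ Fintype.card (Pairs n) := by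
  classical
  refine ⟨Finset.univ.sup fun x => (genMinor n x).totalDegree, fun m => ?_⟩
  set B := Finset.univ.sup fun x => (genMinor n x).totalDegree with hB
  rw [finrank_cellSpan, range_frameVec_genSkew]
  let u : {e : Pairs n →₀ ℕ | ∀ z, e z ≤ m * B} → (Pairs n → Fin (m * B + 1)) :=
    fun e z => ⟨e.1 z, Nat.lt_succ_of_le (e.2 z)⟩
  have hu : Function.Injective u := by
    intro e e' h
    ext z
    exact congrArg Fin.val (congrFun h z)
  have hfin : Finite {e : Pairs n →₀ ℕ | ∀ z, e z ≤ m * B} := Finite.of_injective u hu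
  have hfin' : Module.Finite ℚ (MvPolynomial.restrictSupport ℚ
      {e : Pairs n →₀ ℕ | ∀ z, e z ≤ m * B}) :=
    Module.Finite.of_basis (MvPolynomial.basisRestrictSupport ℚ _)
  have hcard : Module.finrank ℚ (MvPolynomial.restrictSupport ℚ
      {e : Pairs n →₀ ℕ | ∀ z, e z ≤ m * B}) ≤ (m * B + 1) ^ Fintype.card (Pairs n) := by
    rw [Module.finrank_eq_nat_card_basis (MvPolynomial.basisRestrictSupport ℚ _)]
    have := Nat.card_le_card_of_injective u hu
    simpa [Nat.card_eq_fintype_card] using this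
  refine (Submodule.finrank_mono (Submodule.span_le.2 ?_)).trans hcard
  rintro _ ⟨x, rfl⟩
  rw [SetLike.mem_coe, MvPolynomial.mem_restrictSupport_iff]
  intro e he z
  have h1 := MvPolynomial.le_totalDegree he
  have h2 := (MvPolynomial.totalDegree_finsetProd Finset.univ fun s => genMinor n (x s)).trans
    (Finset.sum_le_sum fun s _ => Finset.le_sup (f := fun x => (genMinor n x).totalDegree)
      (Finset.mem_univ (x s)))
  rw [← hB, Finset.sum_const, Finset.card_univ, Fintype.card_fin, smul_eq_mul] at h2
  refine le_trans ?_ (h1.trans h2)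
  by_cases hz : z ∈ e.support
  · exact Finset.single_le_sum (f := fun z => e z) (fun _ _ => Nat.zero_le _) hz
  · rw [Finsupp.notMem_support_iff.1 hz]
    exact Nat.zero_le _

theorem card_pairs (n : ℕ) : Fintype.card (Pairs n) = n * (n + 1) / 2 := by
  let e : Pairs n ≃ Σ j : Fin (n + 1), Fin j :=
    { toFun := fun z => ⟨z.1.2, ⟨z.1.1, z.2⟩⟩
      invFun := fun w => ⟨(⟨w.2, w.2.2.trans w.1.2⟩, w.1), w.2.2⟩
      left_inv := fun _ => rfl
      right_inv := fun _ => rfl }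
  rw [Fintype.card_congr e, Fintype.card_sigma]
  simp only [Fintype.card_fin]
  rw [Fin.sum_univ_eq_sum_range (fun i => i) (n + 1), Finset.sum_range_id, mul_comm]
  simp

open Polynomial in
-- Compare `q` with (X + 1)^D: the limit of the quotient excludes a smaller degree by the lower
-- bound and a larger one by the upper bound. The lower bound is needed only along a sequence
-- tending to infinity.
theorem natDegree_eq_of_bounds {q : ℝ[X]} {D : ℕ} {c C : ℝ} (hc : 0 < c)
    (hlow : ∀ᶠ t : ℕ in Filter.atTop, c * (((D + 1) * t : ℕ) + 1 : ℝ) ^ D ≤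
      q.eval (((D + 1) * t : ℕ) : ℝ))
    (hup : ∀ᶠ m : ℕ in Filter.atTop, q.eval (m : ℝ) ≤ C * ((m : ℝ) + 1) ^ D) :
    q.natDegree = D ∧ 0 < q.leadingCoeff := by
  set Q : ℝ[X] := (X + 1) ^ D with hQ
  have hmon : Q.Monic := (monic_X_add_C (1 : ℝ)).pow D
  have hQD : Q.degree = D := by
    rw [hQ, degree_pow, ← C_1, degree_X_add_C]; simp
  have hev : ∀ m : ℕ, Q.eval (m : ℝ) = ((m : ℝ) + 1) ^ D := by intro m; simp [hQ]
  have hpos : ∀ m : ℕ, 0 < Q.eval (m : ℝ) := by intro m; rw [hev]; positivity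
  have hsub : Filter.Tendsto (fun t : ℕ => (((D + 1) * t : ℕ) : ℝ)) Filter.atTop Filter.atTop :=
    tendsto_natCast_atTop_atTop.comp (Filter.tendsto_id.const_mul_atTop' (Nat.succ_pos D))
  have hlow' : ∀ᶠ t : ℕ in Filter.atTop, c ≤ q.eval (((D + 1) * t : ℕ) : ℝ) /
      Q.eval (((D + 1) * t : ℕ) : ℝ) := by
    filter_upwards [hlow] with t ht
    rw [le_div_iff₀ (hpos _), hev]
    exact ht
  rcases lt_trichotomy q.degree Q.degree with h | h | h
  · exfalso
    have h1 := (div_tendsto_atTop_zero_of_degree_lt q Q h).comp hsub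
    have := ge_of_tendsto h1 hlow'
    linarith
  · refine ⟨natDegree_eq_of_degree_eq_some (h.trans hQD), ?_⟩
    have h1 := (div_tendsto_atTop_leadingCoeff_div_of_degree_eq q Q h).comp hsub
    have := ge_of_tendsto h1 hlow'
    rw [hmon.leadingCoeff, div_one] at this
    linarith
  · exfalso
    have h0 : ∀ᶠ t : ℕ in Filter.atTop, |q.eval (((D + 1) * t : ℕ) : ℝ) /
        Q.eval (((D + 1) * t : ℕ) : ℝ)| ≤ C := by
      have hup' := (Filter.tendsto_id.const_mul_atTop' (Nat.succ_pos D)).eventually hup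
      filter_upwards [hlow', hup'] with t h1 h2
      rw [abs_of_pos (hc.trans_le h1), div_le_iff₀ (hpos _), hev]
      exact h2
    have h1 := (abs_div_tendsto_atTop_atTop_of_degree_gt q Q h hmon.ne_zero).comp hsub
    obtain ⟨t, h2, h3⟩ := (h0.and (h1.eventually_gt_atTop C)).exists
    exact absurd h2 (not_le.2 h3)

/-- The dimension of the span of the big cell is a polynomial of degree `n * (n + 1) / 2` in `m`
for large `m`. -/
theorem exists_finrank_cellSpan_eq_eval (n : ℕ) :
    ∃ q : Polynomial ℝ, q.natDegree = n * (n + 1) / 2 ∧ 0 < q.leadingCoeff ∧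
      ∃ m₀ : ℕ, ∀ m, m₀ ≤ m → (Module.finrank ℚ (cellSpan n m) : ℝ) = q.eval (m : ℝ) := by
  obtain ⟨q, m₀, hq⟩ : EventuallyPoly fun m => (Module.finrank ℚ (cellSpan n m) : ℚ) := by
    refine (eventuallyPoly_finrank_span_monom
      (genMinor n ∘ (Fintype.equivFin (Fin (n + 1) → Fin (n + 1) ⊕ Fin (n + 1))).symm)).congr 0
        fun m _ => ?_
    rw [finrank_cellSpan, range_frameVec_genSkew, ← range_prod_eq_image_monom]
    have hset : (Set.range fun x : Fin m → Fin (n + 1) → Fin (n + 1) ⊕ Fin (n + 1) =>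
        ∏ s, genMinor n (x s)) = Set.range fun x : Fin m → Fin _ => ∏ s, (genMinor n ∘
          (Fintype.equivFin (Fin (n + 1) → Fin (n + 1) ⊕ Fin (n + 1))).symm) (x s) := by
      ext y
      constructor
      · rintro ⟨x, rfl⟩
        exact ⟨fun s => Fintype.equivFin _ (x s), by simp⟩
      · rintro ⟨x, rfl⟩
        exact ⟨fun s => (Fintype.equivFin _).symm (x s), by simp⟩
    rw [hset]
  have hqR : ∀ m, m₀ ≤ m → (Module.finrank ℚ (cellSpan n m) : ℝ) =
      (q.map (algebraMap ℚ ℝ)).eval (m : ℝ) := by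
    intro m hm
    have h := congrArg (algebraMap ℚ ℝ) (hq m hm)
    rw [← Polynomial.eval₂_at_apply, ← Polynomial.eval_map] at h
    simpa using h
  obtain ⟨B, hB⟩ := exists_finrank_cellSpan_le n
  -- The constants come from (K + 1)t + 1 ≤ (K + 1)(t + 1), with K the number of coordinates, and mB
  -- + 1 ≤ (B + 1)(m + 1).
  have key := natDegree_eq_of_bounds (q := q.map (algebraMap ℚ ℝ)) (D := Fintype.card (Pairs n))
    (c := ((Fintype.card (Pairs n) + 1 : ℝ) ^ Fintype.card (Pairs n))⁻¹)
    (C := ((B : ℝ) + 1) ^ Fintype.card (Pairs n)) (by positivity) ?_ ?_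
  · refine ⟨_, ?_, key.2, m₀, hqR⟩
    rw [key.1, card_pairs]
  · filter_upwards [Filter.eventually_ge_atTop m₀] with t ht
    rw [← hqR _ (ht.trans (Nat.le_mul_of_pos_left _ (Nat.succ_pos _)))]
    have h1 : ((t + 1 : ℕ) ^ Fintype.card (Pairs n) : ℝ) ≤
        (Module.finrank ℚ (cellSpan n ((Fintype.card (Pairs n) + 1) * t)) : ℝ) := by
      exact_mod_cast le_finrank_cellSpan n t
    refine le_trans ?_ h1
    rw [inv_mul_le_iff₀ (by positivity), ← mul_pow]
    refine pow_le_pow_left₀ (by positivity) ?_ _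
    push_cast
    nlinarith [(Nat.cast_nonneg (Fintype.card (Pairs n)) : (0 : ℝ) ≤ _)]
  · filter_upwards [Filter.eventually_ge_atTop m₀] with m hm
    rw [← hqR m hm]
    have h1 : (Module.finrank ℚ (cellSpan n m) : ℝ) ≤
        ((m * B + 1 : ℕ) ^ Fintype.card (Pairs n) : ℝ) := by
      exact_mod_cast hB m
    refine h1.trans ?_
    rw [← mul_pow]
    refine pow_le_pow_left₀ (by positivity) ?_ _
    push_cast
    nlinarith [(Nat.cast_nonneg B : (0 : ℝ) ≤ _), (Nat.cast_nonneg m : (0 : ℝ) ≤ _)]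

end Dimension

end ArithSO

end

noncomputable section

open scoped Matrix

namespace ArithSO

/-! ### A hyperbolic basis for a diagonal form -/

section HyperbolicBasis

variable {n N : ℕ} {S S' : Type*} [CommRing S] [CommRing S']

/-- The matrix whose columns are `e ± i e'` for the pairs `e, e'` of standard basis vectors. -/
def hypBlock (n : ℕ) (im : S) :
    Matrix (Fin (n + 1) ⊕ Fin (n + 1)) (Fin (n + 1) ⊕ Fin (n + 1)) S :=
  Matrix.fromBlocks 1 1 (im • 1) (-(im • 1))

/-- A hyperbolic basis for the diagonal form with coefficients `a j`, where `u j ^ 2 * a j = 1`. -/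
def hypBasis (ε : Fin (n + 1) ⊕ Fin (n + 1) ≃ Fin N) (im : S) (u : Fin N → S) :
    Matrix (Fin N) (Fin (n + 1) ⊕ Fin (n + 1)) S :=
  Matrix.diagonal u * (hypBlock n im).submatrix ε.symm id

/-- The inverse of `hypBasis`. -/
def hypBasisInv [Algebra ℚ S] (ε : Fin (n + 1) ⊕ Fin (n + 1) ≃ Fin N) (im : S) (u a : Fin N → S) :
    Matrix (Fin (n + 1) ⊕ Fin (n + 1)) (Fin N) S :=
  algebraMap ℚ S 2⁻¹ • (splitForm n S * (hypBasis ε im u)ᵀ * Matrix.diagonal a)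

theorem hypBlock_map (f : S →+* S') (im : S) : (hypBlock n im).map f = hypBlock n (f im) := by
  rw [hypBlock, hypBlock, Matrix.fromBlocks_map, Matrix.map_one f (map_zero f) (map_one f),
    Matrix.map_neg f (map_neg f), Matrix.map_smul' f _ _ (map_mul f),
    Matrix.map_one f (map_zero f) (map_one f)]

theorem hypBasis_map (f : S →+* S') (ε : Fin (n + 1) ⊕ Fin (n + 1) ≃ Fin N) (im : S)
    (u : Fin N → S) : (hypBasis ε im u).map f = hypBasis ε (f im) fun j => f (u j) := by
  rw [hypBasis, hypBasis, Matrix.map_mul, Matrix.diagonal_map (map_zero f), ← Matrix.submatrix_map,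
    hypBlock_map]

theorem hypBasisInv_map [Algebra ℚ S] [Algebra ℚ S'] (f : S →+* S')
    (ε : Fin (n + 1) ⊕ Fin (n + 1) ≃ Fin N) (im : S) (u a : Fin N → S) :
    (hypBasisInv ε im u a).map f = hypBasisInv ε (f im) (fun j => f (u j)) fun j => f (a j) := by
  have h : ∀ (c : S) (M : Matrix (Fin (n + 1) ⊕ Fin (n + 1)) (Fin N) S),
      (c • M).map f = f c • M.map f := by
    intro c M
    ext
    simp
  rw [hypBasisInv, hypBasisInv, h, Matrix.map_mul, Matrix.map_mul,
    Matrix.diagonal_map (map_zero f), Matrix.transpose_map, hypBasis_map, splitForm_map]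
  congr 1
  simp

theorem splitForm_mul_self : splitForm n S * splitForm n S = 1 := by
  simp [splitForm, Matrix.fromBlocks_multiply]

/-- The columns e ± ie' are isotropic and pair to 1 - i² = 2, the origin of the factor 2 throughout.
-/
theorem hypBlock_transpose_mul {im : S} (him : im * im = -1) :
    (hypBlock n im)ᵀ * hypBlock n im = (2 : S) • splitForm n S := by
  rw [hypBlock, splitForm, Matrix.fromBlocks_transpose, Matrix.fromBlocks_multiply,
    Matrix.fromBlocks_smul]
  have h2 : (1 : Matrix (Fin (n + 1)) (Fin (n + 1)) S) + 1 = (2 : S) • 1 := by rw [two_smul]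
  congr 1 <;> simp [smul_smul, him, h2]

theorem hypBasis_gram {ε : Fin (n + 1) ⊕ Fin (n + 1) ≃ Fin N} {im : S} {u a : Fin N → S}
    (him : im * im = -1) (hu : ∀ j, u j * u j * a j = 1) :
    (hypBasis ε im u)ᵀ * Matrix.diagonal a * hypBasis ε im u = (2 : S) • splitForm n S := by
  have h1 : Matrix.diagonal u * Matrix.diagonal a * Matrix.diagonal u = 1 := by
    rw [Matrix.diagonal_mul_diagonal, Matrix.diagonal_mul_diagonal, ← Matrix.diagonal_one]
    congr 1
    ext j
    rw [mul_right_comm, hu]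
  calc _ = ((hypBlock n im).submatrix ε.symm id)ᵀ * (Matrix.diagonal u * Matrix.diagonal a *
        Matrix.diagonal u) * (hypBlock n im).submatrix ε.symm id := by
        simp only [hypBasis, Matrix.transpose_mul, Matrix.diagonal_transpose, Matrix.mul_assoc]
    _ = (hypBlock n im)ᵀ * hypBlock n im := by
        rw [h1, Matrix.mul_one, Matrix.transpose_submatrix, Matrix.submatrix_mul_equiv,
          Matrix.submatrix_id_id]
    _ = _ := hypBlock_transpose_mul him

theorem hypBasisInv_mul [Algebra ℚ S] {ε : Fin (n + 1) ⊕ Fin (n + 1) ≃ Fin N} {im : S}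
    {u a : Fin N → S} (him : im * im = -1) (hu : ∀ j, u j * u j * a j = 1) :
    hypBasisInv ε im u a * hypBasis ε im u = 1 := by
  have h2 : algebraMap ℚ S 2⁻¹ * 2 = 1 := by
    rw [← map_ofNat (algebraMap ℚ S) 2, ← map_mul]
    simp
  rw [hypBasisInv, Matrix.smul_mul, Matrix.mul_assoc, Matrix.mul_assoc, ← Matrix.mul_assoc _ᵀ,
    hypBasis_gram him hu, Matrix.mul_smul, splitForm_mul_self, smul_smul, h2, one_smul]

theorem hypBasis_mul_inv [Algebra ℚ S] {ε : Fin (n + 1) ⊕ Fin (n + 1) ≃ Fin N} {im : S}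
    {u a : Fin N → S} (him : im * im = -1) (hu : ∀ j, u j * u j * a j = 1) :
    hypBasis ε im u * hypBasisInv ε im u a = 1 :=
  (Matrix.mul_eq_one_comm_of_equiv ε).1 (hypBasisInv_mul him hu)

end HyperbolicBasis

/-! ### Rational representations from matrices -/

section OfMatrix

variable {F : Type*} [Field F] [Algebra ℚ F] {N : ℕ} {α : Fin N → F}

/-- A family of homomorphisms into matrices over `R ⊗ E`, natural in `R`, gives a rational
representation on the free `E`-module of columns. -/
def RationalRep.ofMatrix {J : Type} [Fintype J] [DecidableEq J] {E : Type} [CommRing E]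
    [Algebra ℚ E] (M : ∀ (R : Type) [CommRing R] [Algebra ℚ R], ResSO α R →* Matrix J J (R ⊗[ℚ] E))
    (hM : ∀ (R S : Type) [CommRing R] [Algebra ℚ R] [CommRing S] [Algebra ℚ S] (f : R →ₐ[ℚ] S)
      (g : ResSO α R), (M R g).map (Algebra.TensorProduct.map f (AlgHom.id ℚ E)) =
        M S (ResSO.map α f g)) : RationalRep α (J → E) where
  toRep R _ _ :=
    { toFun := fun g => (TensorProduct.piRight ℚ R R fun _ : J => E).symm.toLinearMap ∘ₗ
        ((M R g).mulVecLin.restrictScalars R) ∘ₗ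
        (TensorProduct.piRight ℚ R R fun _ : J => E).toLinearMap
      map_one' := by
        refine LinearMap.ext fun v => ?_
        simp
      map_mul' := fun g h => by
        refine LinearMap.ext fun v => ?_
        simp [Matrix.mulVec_mulVec] }
  natural R S _ _ _ _ f g v := by
    have key : ∀ w : R ⊗[ℚ] (J → E),
        TensorProduct.piRight ℚ S S (fun _ : J => E) (f.toLinearMap.rTensor (J → E) w) =
        fun i => Algebra.TensorProduct.map f (AlgHom.id ℚ E)
          (TensorProduct.piRight ℚ R R (fun _ : J => E) w i) := by
      intro w
      induction w using TensorProduct.induction_on with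
      | zero => ext; simp
      | tmul x y => ext; simp
      | add x y hx hy =>
        ext i
        simp [map_add, hx, hy]
    apply (TensorProduct.piRight ℚ S S (fun _ : J => E)).injective
    rw [key]
    simp only [MonoidHom.coe_mk, OneHom.coe_mk, LinearMap.comp_apply, LinearEquiv.coe_coe,
      LinearEquiv.apply_symm_apply, LinearMap.coe_restrictScalars, Matrix.mulVecLin_apply]
    rw [key, ← hM]
    ext1 i
    exact (RingHom.map_mulVec (Algebra.TensorProduct.map f (AlgHom.id ℚ E)).toRingHom
      (M R g) _ i).symm

/-- The evaluation of the columns over `ℂ ⊗ E` at a point `e : E → ℂ`. -/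
def evalColumns {J : Type} [Fintype J] [DecidableEq J] {E : Type} [CommRing E] [Algebra ℚ E]
    (e : E →ₐ[ℚ] ℂ) : ℂ ⊗[ℚ] (J → E) →ₗ[ℂ] (J → ℂ) :=
  (LinearMap.compLeft (Algebra.TensorProduct.lift (AlgHom.id ℂ ℂ) e
    fun _ _ => Commute.all _ _).toLinearMap J) ∘ₗ
    (TensorProduct.piRight ℚ ℂ ℂ fun _ : J => E).toLinearMap

end OfMatrix

/-! ### Complexified rational representations, evaluated at points of E -/

section ComplexOfMatrix

variable {F : Type*} [Field F] [NumberField F] {N : ℕ} {α : Fin N → F}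

/-- The columns over ℂ ⊗ E are studied through their values at points E → ℂ; on each such component
the real points act through ℝ ⊗ E → ℂ. -/
theorem evalColumns_complexRep {J : Type} [Fintype J] [DecidableEq J] {E : Type} [CommRing E]
    [Algebra ℚ E] (M : ∀ (R : Type) [CommRing R] [Algebra ℚ R], ResSO α R →* Matrix J J (R ⊗[ℚ] E))
    (hM : ∀ (R S : Type) [CommRing R] [Algebra ℚ R] [CommRing S] [Algebra ℚ S] (f : R →ₐ[ℚ] S)
      (g : ResSO α R), (M R g).map (Algebra.TensorProduct.map f (AlgHom.id ℚ E)) =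
        M S (ResSO.map α f g)) (e : E →ₐ[ℚ] ℂ) (g : RealPointsId α) (v : ℂ ⊗[ℚ] (J → E)) :
    evalColumns e ((RationalRep.ofMatrix M hM).complexRep g v) =
      ((M ℝ g.1).map (Algebra.TensorProduct.lift (Complex.ofRealAm.restrictScalars ℚ) e
        fun _ _ => Commute.all _ _)) *ᵥ evalColumns e v := by
  have h1 : (M ℂ (ResSO.map α (Complex.ofRealAm.restrictScalars ℚ) g.1)).map
      (Algebra.TensorProduct.lift (AlgHom.id ℂ ℂ) e fun _ _ => Commute.all _ _) =
      (M ℝ g.1).map (Algebra.TensorProduct.lift (Complex.ofRealAm.restrictScalars ℚ) e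
        fun _ _ => Commute.all _ _) := by
    rw [← hM]
    ext i j
    simp only [Matrix.map_apply]
    generalize M ℝ g.1 i j = z
    induction z using TensorProduct.induction_on with
    | zero => simp
    | tmul x y => simp
    | add x y hx hy => simp [map_add, hx, hy]
  rw [← h1]
  ext1 i
  simp only [evalColumns, RationalRep.complexRep, RationalRep.ofMatrix, LinearMap.comp_apply,
    MonoidHom.comp_apply, MonoidHom.coe_mk, OneHom.coe_mk, LinearEquiv.coe_coe,
    LinearEquiv.apply_symm_apply, LinearMap.coe_restrictScalars, Matrix.mulVecLin_apply,
    Subgroup.subtype_apply]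
  exact RingHom.map_mulVec (Algebra.TensorProduct.lift (AlgHom.id ℂ ℂ) e
    fun _ _ => Commute.all _ _).toRingHom _ _ i

end ComplexOfMatrix

end ArithSO

end

noncomputable section

open scoped Matrix

namespace ArithSO

/-! ### The representations over a splitting algebra -/

section SplitData

variable {F : Type*} [Field F] [Algebra ℚ F] {N : ℕ}

/-- A `ℚ`-algebra `E` with homomorphisms from `F` that split the conjugates of the diagonal form
with coefficients `α j`. -/
structure SplitData (α : Fin N → F) (κ E : Type) [CommRing E] [Algebra ℚ E] where
  /-- the homomorphisms from `F` -/
  emb : κ → F →ₐ[ℚ] E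
  /-- a square root of `-1` -/
  im : E
  im_mul_im : im * im = -1
  /-- inverse square roots of the conjugates of the coefficients -/
  root : κ → Fin N → E
  root_mul : ∀ k j, root k j * root k j * emb k (α j) = 1

variable {α : Fin N → F} {κ E : Type} [CommRing E] [Algebra ℚ E] {n : ℕ}

namespace SplitData

variable (D : SplitData α κ E) (ε : Fin (n + 1) ⊕ Fin (n + 1) ≃ Fin N)

/-- A matrix over `R ⊗ F`, seen through the `k`-th homomorphism, in the hyperbolic basis. -/
def conj (R : Type) [CommRing R] [Algebra ℚ R] (k : κ) (g : Matrix (Fin N) (Fin N) (R ⊗[ℚ] F)) :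
    Matrix (Fin (n + 1) ⊕ Fin (n + 1)) (Fin (n + 1) ⊕ Fin (n + 1)) (R ⊗[ℚ] E) :=
  hypBasisInv ε ((1 : R) ⊗ₜ[ℚ] D.im) (fun j => (1 : R) ⊗ₜ[ℚ] D.root k j)
      (fun j => (1 : R) ⊗ₜ[ℚ] D.emb k (α j)) *
    g.map (Algebra.TensorProduct.map (AlgHom.id ℚ R) (D.emb k)) *
    hypBasis ε ((1 : R) ⊗ₜ[ℚ] D.im) (fun j => (1 : R) ⊗ₜ[ℚ] D.root k j)

variable (R : Type) [CommRing R] [Algebra ℚ R]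

theorem im_mul_im' : ((1 : R) ⊗ₜ[ℚ] D.im) * (1 ⊗ₜ[ℚ] D.im) = -1 := by
  rw [Algebra.TensorProduct.tmul_mul_tmul, D.im_mul_im, mul_one, TensorProduct.tmul_neg]
  rfl

theorem root_mul' (k : κ) (j : Fin N) : ((1 : R) ⊗ₜ[ℚ] D.root k j) * (1 ⊗ₜ[ℚ] D.root k j) *
    (1 ⊗ₜ[ℚ] D.emb k (α j)) = 1 := by
  rw [Algebra.TensorProduct.tmul_mul_tmul, Algebra.TensorProduct.tmul_mul_tmul, D.root_mul,
    mul_one, mul_one]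
  rfl

theorem conj_one (k : κ) : D.conj ε R k 1 = 1 := by
  rw [conj, Matrix.map_one _ (map_zero _) (map_one _), Matrix.mul_one,
    hypBasisInv_mul (D.im_mul_im' R) (D.root_mul' R k)]

theorem conj_mul (k : κ) (g h : Matrix (Fin N) (Fin N) (R ⊗[ℚ] F)) :
    D.conj ε R k (g * h) = D.conj ε R k g * D.conj ε R k h := by
  have h1 := hypBasis_mul_inv (ε := ε) (D.im_mul_im' R) (D.root_mul' R k)
  simp only [conj]
  rw [Matrix.map_mul]
  set T := hypBasis ε ((1 : R) ⊗ₜ[ℚ] D.im) (fun j => (1 : R) ⊗ₜ[ℚ] D.root k j)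
  set T' := hypBasisInv ε ((1 : R) ⊗ₜ[ℚ] D.im) (fun j => (1 : R) ⊗ₜ[ℚ] D.root k j)
    (fun j => (1 : R) ⊗ₜ[ℚ] D.emb k (α j))
  set x := g.map (Algebra.TensorProduct.map (AlgHom.id ℚ R) (D.emb k))
  set y := h.map (Algebra.TensorProduct.map (AlgHom.id ℚ R) (D.emb k))
  calc T' * (x * y) * T = T' * x * (T * T') * y * T := by
        rw [h1, Matrix.mul_one]; simp only [Matrix.mul_assoc]
    _ = _ := by simp only [Matrix.mul_assoc]

theorem conj_map {S : Type*} [CommRing S] [Algebra ℚ S] (f : R ⊗[ℚ] E →+* S) (k : κ)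
    (g : Matrix (Fin N) (Fin N) (R ⊗[ℚ] F)) :
    (D.conj ε R k g).map f =
      hypBasisInv ε (f ((1 : R) ⊗ₜ[ℚ] D.im)) (fun j => f ((1 : R) ⊗ₜ[ℚ] D.root k j))
        (fun j => f ((1 : R) ⊗ₜ[ℚ] D.emb k (α j))) *
      g.map (f.comp (Algebra.TensorProduct.map (AlgHom.id ℚ R) (D.emb k)).toRingHom) *
      hypBasis ε (f ((1 : R) ⊗ₜ[ℚ] D.im)) (fun j => f ((1 : R) ⊗ₜ[ℚ] D.root k j)) := by
  rw [conj, Matrix.map_mul, Matrix.map_mul, hypBasis_map, hypBasisInv_map]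
  rfl

/-- The map R ⊗ F → R ⊗ E takes a point of G'(R) to the special orthogonal group of a conjugate
form, which is split over E. -/
theorem stable_conj {m r : ℕ} (b : CellBasis n m r) (k : κ) (g : ResSO α R) :
    b.Stable (D.conj ε R k g.1) := by
  have hm := mem_SO.1 (map_mem_SO (Algebra.TensorProduct.map (AlgHom.id ℚ R) (D.emb k)).toRingHom
    (b := fun j => (1 : R) ⊗ₜ[ℚ] D.emb k (α j)) (by intro j; simp) g.2)
  have hd := (Matrix.SpecialLinearGroup.map
    (Algebra.TensorProduct.map (AlgHom.id ℚ R) (D.emb k)).toRingHom g.1).det_coe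
  rw [Matrix.SpecialLinearGroup.map_apply_coe] at hm hd
  have ha : ∀ j, IsUnit ((1 : R) ⊗ₜ[ℚ] D.emb k (α j)) := fun j =>
    IsUnit.of_mul_eq_one_right _ (D.root_mul' R k j)
  exact b.stable_conj ha (hypBasisInv_mul (D.im_mul_im' R) (D.root_mul' R k))
    (hypBasis_mul_inv (D.im_mul_im' R) (D.root_mul' R k))
    (hypBasis_gram (D.im_mul_im' R) (D.root_mul' R k)) hm hd

variable [Fintype κ] [DecidableEq κ]

/-- The tensor product of the conjugates of the representation on the span of the big cell. -/
def matrixHom {m r : ℕ} (b : CellBasis n m r) :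
    ResSO α R →* Matrix (κ → Fin r) (κ → Fin r) (R ⊗[ℚ] E) where
  toFun g := kron fun k => b.rep (D.conj ε R k g.1)
  map_one' := by
    simp only [OneMemClass.coe_one, Matrix.SpecialLinearGroup.coe_one, conj_one,
      CellBasis.rep_one, kron_one]
  map_mul' g h := by
    simp only [Subgroup.coe_mul, Matrix.SpecialLinearGroup.coe_mul, conj_mul]
    rw [kron_mul]
    congr 1
    ext1 k
    exact (D.stable_conj ε R b k h).rep_mul _

theorem matrixHom_natural {m r : ℕ} (b : CellBasis n m r) (R S : Type) [CommRing R] [Algebra ℚ R]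
    [CommRing S] [Algebra ℚ S] (f : R →ₐ[ℚ] S) (g : ResSO α R) :
    (D.matrixHom ε R b g).map (Algebra.TensorProduct.map f (AlgHom.id ℚ E)) =
      D.matrixHom ε S b (ResSO.map α f g) := by
  have h1 : ∀ x : E, (Algebra.TensorProduct.map f (AlgHom.id ℚ E)).toRingHom ((1 : R) ⊗ₜ[ℚ] x) =
      (1 : S) ⊗ₜ[ℚ] x := by intro x; simp
  have h2 : ∀ k, (g.1 : Matrix (Fin N) (Fin N) (R ⊗[ℚ] F)).map
      ((Algebra.TensorProduct.map f (AlgHom.id ℚ E)).toRingHom.comp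
        (Algebra.TensorProduct.map (AlgHom.id ℚ R) (D.emb k)).toRingHom) =
      ((ResSO.map α f g).1 : Matrix (Fin N) (Fin N) (S ⊗[ℚ] F)).map
        (Algebra.TensorProduct.map (AlgHom.id ℚ S) (D.emb k)) := by
    intro k
    ext i j
    change _ = Algebra.TensorProduct.map (AlgHom.id ℚ S) (D.emb k)
      (Algebra.TensorProduct.map f (AlgHom.id ℚ F)
        ((g.1 : Matrix (Fin N) (Fin N) (R ⊗[ℚ] F)) i j))
    rw [Matrix.map_apply]
    generalize (g.1 : Matrix (Fin N) (Fin N) (R ⊗[ℚ] F)) i j = z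
    induction z using TensorProduct.induction_on with
    | zero => rw [map_zero, map_zero, map_zero]
    | tmul x y => simp
    | add x y hx hy => rw [map_add, map_add, map_add, hx, hy]
  have h3 : ∀ k, (D.conj ε R k g.1).map (Algebra.TensorProduct.map f (AlgHom.id ℚ E)).toRingHom =
      D.conj ε S k (ResSO.map α f g).1 := by
    intro k
    rw [conj_map, conj, h2]
    simp only [h1]
  refine (kron_map (Algebra.TensorProduct.map f (AlgHom.id ℚ E)).toRingHom _).trans ?_
  simp only [CellBasis.rep_map, h3]
  rfl

/-- The rational representation on the columns of length `r ^ card κ` over `E`. -/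
def rationalRep {m r : ℕ} (b : CellBasis n m r) : RationalRep α ((κ → Fin r) → E) :=
  RationalRep.ofMatrix (fun R _ _ => D.matrixHom ε R b) fun R S _ _ _ _ f g =>
    D.matrixHom_natural ε b R S f g

end SplitData

end SplitData

/-! ### Components of the representation over the real places -/

section SplitDataReal

variable {F : Type*} [Field F] [NumberField F] {N n : ℕ} {α : Fin N → F} {κ E : Type} [CommRing E]
  [Algebra ℚ E] [Fintype κ] [DecidableEq κ]

/-- A real matrix, seen through the place `σ`, in the hyperbolic basis over `ℂ`. -/
def realConj (ι : F →ₐ[ℚ] ℝ) (σ : F ≃ₐ[ℚ] F) (ε : Fin (n + 1) ⊕ Fin (n + 1) ≃ Fin N) (im : ℂ)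
    (u : Fin N → ℂ) (a : Fin N → ℝ) (g : Matrix (Fin N) (Fin N) (ℝ ⊗[ℚ] F)) :
    Matrix (Fin (n + 1) ⊕ Fin (n + 1)) (Fin (n + 1) ⊕ Fin (n + 1)) ℂ :=
  hypBasisInv ε im u (fun j => (a j : ℂ)) *
    g.map (Complex.ofRealHom.comp (place ι σ).toRingHom) * hypBasis ε im u

/-- At a point of E each embedding of F becomes a real place, so the component is the external
tensor product, over the chosen places, of the representation on the cell span. -/
theorem SplitData.evalColumns_complexRep (D : SplitData α κ E)
    (ε : Fin (n + 1) ⊕ Fin (n + 1) ≃ Fin N) {m r : ℕ} (b : CellBasis n m r) (e : E →ₐ[ℚ] ℂ)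
    (ι : F →ₐ[ℚ] ℝ) (σ : κ → F ≃ₐ[ℚ] F) (hσ : ∀ k x, e (D.emb k x) = (ι (σ k x) : ℂ))
    (g : RealPointsId α) (v : ℂ ⊗[ℚ] ((κ → Fin r) → E)) :
    evalColumns e ((D.rationalRep ε b).complexRep g v) =
      (kron fun k => b.rep (realConj ι (σ k) ε (e D.im) (fun j => e (D.root k j))
        (fun j => ι (σ k (α j))) g.1.1)) *ᵥ evalColumns e v := by
  have h1 : ∀ x : E, (Algebra.TensorProduct.lift (Complex.ofRealAm.restrictScalars ℚ) e
    fun _ _ => Commute.all _ _).toRingHom ((1 : ℝ) ⊗ₜ[ℚ] x) = e x := by intro x; simp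
  have h2 : ∀ k, (Algebra.TensorProduct.lift (Complex.ofRealAm.restrictScalars ℚ) e
      fun _ _ => Commute.all _ _).toRingHom.comp
        (Algebra.TensorProduct.map (AlgHom.id ℚ ℝ) (D.emb k)).toRingHom =
      Complex.ofRealHom.comp (place ι (σ k)).toRingHom := by
    intro k
    refine RingHom.ext fun z => ?_
    induction z using TensorProduct.induction_on with
    | zero => rw [map_zero, map_zero]
    | tmul x y => simp [hσ]
    | add x y hx hy => rw [map_add, map_add, hx, hy]
  have h3 : ∀ k, (D.conj ε ℝ k g.1.1).map (Algebra.TensorProduct.lift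
      (Complex.ofRealAm.restrictScalars ℚ) e fun _ _ => Commute.all _ _).toRingHom =
      realConj ι (σ k) ε (e D.im) (fun j => e (D.root k j)) (fun j => ι (σ k (α j))) g.1.1 := by
    intro k
    rw [SplitData.conj_map, realConj, h2]
    simp only [h1, hσ]
  have h4 : (D.matrixHom ε ℝ b g.1).map (Algebra.TensorProduct.lift
      (Complex.ofRealAm.restrictScalars ℚ) e fun _ _ => Commute.all _ _).toRingHom =
      kron fun k => b.rep (realConj ι (σ k) ε (e D.im) (fun j => e (D.root k j))
        (fun j => ι (σ k (α j))) g.1.1) := by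
    refine (kron_map _ _).trans ?_
    simp only [CellBasis.rep_map, h3]
  rw [← h4]
  exact ArithSO.evalColumns_complexRep _ _ e g v

end SplitDataReal

end ArithSO

end

noncomputable section

open scoped Matrix

namespace ArithSO

/-! ### Splitting algebras of controlled dimension -/

section SquareRoots

/-- The minimal polynomial divides X² - z². The dichotomy keeps the total degree equal to [F : ℚ]
times a power of 2. -/
theorem exists_adjoin_sqrt (K : IntermediateField ℚ ℂ) [FiniteDimensional ℚ K] (z : ℂ)
    (hz : z ^ 2 ∈ K) : ∃ L : IntermediateField ℚ ℂ, K ≤ L ∧ z ∈ L ∧ FiniteDimensional ℚ L ∧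
      (Module.finrank ℚ L = Module.finrank ℚ K ∨
        Module.finrank ℚ L = Module.finrank ℚ K * 2) := by
  have hmonic : (Polynomial.X ^ 2 - Polynomial.C (⟨z ^ 2, hz⟩ : K)).Monic :=
    Polynomial.monic_X_pow_sub_C _ two_ne_zero
  have hroot : Polynomial.aeval z (Polynomial.X ^ 2 - Polynomial.C (⟨z ^ 2, hz⟩ : K)) = 0 := by
    simp only [map_sub, map_pow, Polynomial.aeval_X, Polynomial.aeval_C]
    exact sub_self _
  have hzint : IsIntegral K z := ⟨_, hmonic, by rwa [Polynomial.aeval_def] at hroot⟩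
  have hfin : FiniteDimensional K (IntermediateField.adjoin K {z}) :=
    IntermediateField.adjoin.finiteDimensional hzint
  have hdeg : Module.finrank K (IntermediateField.adjoin K {z}) ≤ 2 := by
    rw [IntermediateField.adjoin.finrank hzint]
    calc _ ≤ (Polynomial.X ^ 2 - Polynomial.C (⟨z ^ 2, hz⟩ : K)).natDegree :=
          Polynomial.natDegree_le_of_dvd (minpoly.dvd K z hroot) hmonic.ne_zero
      _ = 2 := Polynomial.natDegree_X_pow_sub_C
  have hpos : 0 < Module.finrank K (IntermediateField.adjoin K {z}) := Module.finrank_pos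
  refine ⟨(IntermediateField.adjoin K {z}).restrictScalars ℚ, ?_, ?_, ?_, ?_⟩
  · intro x hx
    exact (IntermediateField.adjoin K {z}).algebraMap_mem ⟨x, hx⟩
  · exact IntermediateField.mem_adjoin_simple_self K z
  · exact FiniteDimensional.trans ℚ K (IntermediateField.adjoin K {z})
  · have ht : Module.finrank ℚ K * Module.finrank K (IntermediateField.adjoin K {z}) =
        Module.finrank ℚ ((IntermediateField.adjoin K {z}).restrictScalars ℚ) :=
      Module.finrank_mul_finrank ℚ K (IntermediateField.adjoin K {z})
    interval_cases h : Module.finrank K (IntermediateField.adjoin K {z})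
    · exact Or.inl (by omega)
    · exact Or.inr (by omega)

/-- The exponent `a` counts the roots that enlarge the field; it cannot be prescribed, only bounded.
-/
theorem exists_adjoin_sqrts (K : IntermediateField ℚ ℂ) [FiniteDimensional ℚ K] (l : List ℂ)
    (hl : ∀ z ∈ l, z ^ 2 ∈ K) : ∃ (L : IntermediateField ℚ ℂ) (a : ℕ), K ≤ L ∧ (∀ z ∈ l, z ∈ L) ∧
      FiniteDimensional ℚ L ∧ a ≤ l.length ∧
      Module.finrank ℚ L = Module.finrank ℚ K * 2 ^ a := by
  induction l with
  | nil => exact ⟨K, 0, le_rfl, by simp, inferInstance, le_rfl, by simp⟩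
  | cons z l ih =>
    obtain ⟨L, a, hKL, hL, hfin, ha, hrank⟩ := ih fun w hw => hl w (List.mem_cons_of_mem _ hw)
    obtain ⟨L', hLL', hzL', hfin', hrank'⟩ :=
      exists_adjoin_sqrt L z (hKL (hl z List.mem_cons_self))
    have hmem : ∀ w ∈ z :: l, w ∈ L' := by
      intro w hw
      rcases List.mem_cons.1 hw with rfl | hw
      · exact hzL'
      · exact hLL' (hL w hw)
    rcases hrank' with h | h
    · exact ⟨L', a, hKL.trans hLL', hmem, hfin', by simp; omega, by rw [h, hrank]⟩
    · exact ⟨L', a + 1, hKL.trans hLL', hmem, hfin', by simp; omega,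
        by rw [h, hrank, pow_succ, mul_assoc]⟩

end SquareRoots

/-! ### Enough complex points to separate the complexification -/

section Separation

/-- Distinct characters are linearly independent (Dedekind), so as many points as the dimension make
ℂ ⊗ E → ℂ^X an isomorphism. -/
theorem tensor_eq_zero_of_evaluations {E X : Type} [CommRing E] [Algebra ℚ E] [Module.Finite ℚ E]
    [Fintype X] (e : X → E →ₐ[ℚ] ℂ) (he : Function.Injective e)
    (hcard : Fintype.card X = Module.finrank ℚ E) (z : ℂ ⊗[ℚ] E)
    (hz : ∀ i, Algebra.TensorProduct.lift (AlgHom.id ℂ ℂ) (e i) (fun _ _ => Commute.all _ _) z = 0) :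
    z = 0 := by
  classical
  set Ψ : ℂ ⊗[ℚ] E →ₗ[ℂ] (X → ℂ) := LinearMap.pi fun i =>
    (Algebra.TensorProduct.lift (AlgHom.id ℂ ℂ) (e i) fun _ _ => Commute.all _ _).toLinearMap
    with hΨ
  have hsurj : Function.Surjective Ψ := by
    rw [← LinearMap.range_eq_top]
    by_contra hne
    obtain ⟨f, hf0, hf⟩ := Submodule.exists_le_ker_of_lt_top _ (lt_top_iff_ne_top.2 hne)
    have hinj : Function.Injective (fun i : X => ((e i : E →ₐ[ℚ] ℂ) : E →* ℂ)) := by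
      intro i j h
      exact he (AlgHom.ext fun a => DFunLike.congr_fun h a)
    have hli := (linearIndependent_monoidHom E ℂ).comp _ hinj
    rw [Fintype.linearIndependent_iff] at hli
    have hz := hli (fun i => f (Pi.single i 1)) (by
      ext a
      have h1 : f (Ψ (1 ⊗ₜ a)) = 0 := hf (LinearMap.mem_range.2 ⟨1 ⊗ₜ a, rfl⟩)
      rw [LinearMap.pi_apply_eq_sum_univ f] at h1
      simp only [Finset.sum_apply, Pi.smul_apply, Function.comp, smul_eq_mul, Pi.zero_apply]
      rw [← h1]
      refine Finset.sum_congr rfl fun i _ => ?_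
      have h3 : (fun j => if i = j then (1 : ℂ) else 0) = Pi.single i 1 := by
        ext j; simp [Pi.single_apply, eq_comm]
      rw [h3, smul_eq_mul, mul_comm]
      simp [hΨ])
    apply hf0
    refine LinearMap.ext fun x => ?_
    rw [LinearMap.pi_apply_eq_sum_univ f]
    refine Finset.sum_eq_zero fun i _ => ?_
    have h3 : (fun j => if i = j then (1 : ℂ) else 0) = Pi.single i 1 := by
      ext j; simp [Pi.single_apply, eq_comm]
    rw [h3, hz i, smul_zero]
  have hrank : Module.finrank ℂ (ℂ ⊗[ℚ] E) = Module.finrank ℂ (X → ℂ) := by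
    rw [Module.finrank_baseChange, Module.finrank_fintype_fun_eq_card, hcard]
  apply (LinearMap.injective_iff_surjective_of_finrank_eq_finrank hrank).2 hsurj
  rw [map_zero]
  ext i
  exact hz i

theorem eq_zero_of_evalColumns {E J X : Type} [CommRing E] [Algebra ℚ E] [Fintype J]
    [DecidableEq J] (e : X → E →ₐ[ℚ] ℂ)
    (he : ∀ z : ℂ ⊗[ℚ] E, (∀ i, Algebra.TensorProduct.lift (AlgHom.id ℂ ℂ) (e i)
      (fun _ _ => Commute.all _ _) z = 0) → z = 0) (v : ℂ ⊗[ℚ] (J → E))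
    (hv : ∀ i, evalColumns (e i) v = 0) : v = 0 := by
  apply (TensorProduct.piRight ℚ ℂ ℂ fun _ : J => E).injective
  rw [map_zero]
  ext1 j
  exact he _ fun i => congrFun (hv i) j

end Separation

/-! ### Construction of a splitting algebra -/

section Existence

variable {F : Type*} [Field F] [Algebra ℚ F] {N : ℕ} {α : Fin N → F} {κ E E' : Type}
  [CommRing E] [Algebra ℚ E] [CommRing E'] [Algebra ℚ E']

/-- The image of splitting data under a homomorphism. -/
def SplitData.map (D : SplitData α κ E) (f : E →ₐ[ℚ] E') : SplitData α κ E' where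
  emb k := f.comp (D.emb k)
  im := f D.im
  im_mul_im := by rw [← map_mul, D.im_mul_im, map_neg, map_one]
  root k j := f (D.root k j)
  root_mul k j := by rw [AlgHom.comp_apply, ← map_mul, ← map_mul, D.root_mul, map_one]

theorem exists_splitData_field {F : Type*} [Field F] [NumberField F] {N : ℕ}
    (α : Fin N → F) (hα : ∀ j, α j ≠ 0) (ι : F →ₐ[ℚ] ℝ) {κ : Type} [Fintype κ]
    (σ : κ → F ≃ₐ[ℚ] F) :
    ∃ (L : IntermediateField ℚ ℂ) (a : ℕ) (D : SplitData α κ L) (j : F →ₐ[ℚ] L),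
      FiniteDimensional ℚ L ∧ a ≤ Fintype.card κ * N + 1 ∧
      Module.finrank ℚ L = Module.finrank ℚ F * 2 ^ a ∧ ∀ k x, D.emb k x = j (σ k x) := by
  set f : F →ₐ[ℚ] ℂ := (Complex.ofRealAm.restrictScalars ℚ).comp ι with hf
  choose z hz using fun x : κ × Fin N => IsAlgClosed.exists_pow_nat_eq (f (σ x.1 (α x.2))) two_pos
  have hfin : FiniteDimensional ℚ f.fieldRange :=
    Module.Finite.equiv (AlgEquiv.ofInjectiveField f).toLinearEquiv
  obtain ⟨L, a, hKL, hL, hfin, ha, hrank⟩ := exists_adjoin_sqrts f.fieldRange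
    (Complex.I :: (Finset.univ : Finset (κ × Fin N)).toList.map z) (by
      intro w hw
      rcases List.mem_cons.1 hw with rfl | hw
      · rw [Complex.I_sq]
        exact neg_mem (one_mem _)
      · obtain ⟨x, -, rfl⟩ := List.mem_map.1 hw
        rw [hz]
        exact ⟨_, rfl⟩)
  have hI : Complex.I ∈ L := hL _ List.mem_cons_self
  have hzL : ∀ x, z x ∈ L := fun x =>
    hL _ (List.mem_cons_of_mem _ (List.mem_map_of_mem (by simp)))
  have hz0 : ∀ x, z x ≠ 0 := by
    intro x h
    have h1 := hz x
    rw [h, zero_pow two_ne_zero, eq_comm, map_eq_zero, map_eq_zero] at h1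
    exact hα _ h1
  let j : F →ₐ[ℚ] L := (IntermediateField.inclusion hKL).comp f.rangeRestrict
  have hj : ∀ x, ((j x : L) : ℂ) = f x := fun x => rfl
  -- z² is the conjugate coefficient, so the required inverse square root is z⁻¹.
  refine ⟨L, a, ⟨fun k => j.comp (σ k : F →ₐ[ℚ] F), ⟨Complex.I, hI⟩, ?_,
    fun k i => ⟨(z (k, i))⁻¹, inv_mem (hzL _)⟩, ?_⟩, j, hfin, ?_, ?_, fun k x => rfl⟩
  · exact Subtype.ext Complex.I_mul_I
  · intro k i
    refine Subtype.ext ?_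
    change (z (k, i))⁻¹ * (z (k, i))⁻¹ * f (σ k (α i)) = 1
    rw [← hz (k, i), sq]
    field_simp [hz0 (k, i)]
  · simpa using ha
  · rw [hrank]
    congr 1
    exact (LinearEquiv.finrank_eq (AlgEquiv.ofInjectiveField f).toLinearEquiv).symm

/-- F is Galois, so its complex embeddings are exactly as many as its automorphisms, and the latter
give distinct embeddings through `ι`. -/
theorem exists_algEquiv_of_algHom {F : Type*} [Field F] [NumberField F] [IsGalois ℚ F]
    (ι : F →ₐ[ℚ] ℝ) (f : F →ₐ[ℚ] ℂ) : ∃ τ : F ≃ₐ[ℚ] F, ∀ x, f x = (ι (τ x) : ℂ) := by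
  have hinj : Function.Injective fun τ : F ≃ₐ[ℚ] F =>
      ((Complex.ofRealAm.restrictScalars ℚ).comp ι).comp (τ : F →ₐ[ℚ] F) := by
    intro τ τ' h
    ext x
    exact ((Complex.ofRealAm.restrictScalars ℚ).comp ι).toRingHom.injective (DFunLike.congr_fun h x)
  have hcard : Fintype.card (F ≃ₐ[ℚ] F) = Fintype.card (F →ₐ[ℚ] ℂ) := by
    rw [AlgHom.card, ← Nat.card_eq_fintype_card, IsGalois.card_aut_eq_finrank]
  obtain ⟨τ, hτ⟩ := ((Fintype.bijective_iff_injective_and_card _).2 ⟨hinj, hcard⟩).2 f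
  exact ⟨τ, fun x => (DFunLike.congr_fun hτ x).symm⟩

/-- The degree of a splitting field L depends on the α's, but the leading constant must not. Taking
E as a product of copies of L replaces the unknown power of 2 by a fixed one, and multiplies the
representation only by a multiplicity. -/
theorem exists_splitData {F : Type*} [Field F] [NumberField F] [IsGalois ℚ F] {N : ℕ}
    (α : Fin N → F) (hα : ∀ j, α j ≠ 0) (ι : F →ₐ[ℚ] ℝ) :
    ∃ (E : Type) (_ : CommRing E) (_ : Algebra ℚ E) (_ : Module.Finite ℚ E)
      (D : SplitData α (Fin (Module.finrank ℚ F)) E),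
      Module.finrank ℚ E = Module.finrank ℚ F * 2 ^ ((N + 1) * Module.finrank ℚ F) ∧
      (∀ e : E →ₐ[ℚ] ℂ, ∃ σ : Fin (Module.finrank ℚ F) ≃ (F ≃ₐ[ℚ] F),
        ∀ k x, e (D.emb k x) = (ι (σ k x) : ℂ)) ∧
      ∃ (X : Type) (_ : Fintype X) (e : X → E →ₐ[ℚ] ℂ), ∀ z : ℂ ⊗[ℚ] E,
        (∀ i, Algebra.TensorProduct.lift (AlgHom.id ℂ ℂ) (e i)
          (fun _ _ => Commute.all _ _) z = 0) → z = 0 := by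
  have hd : 0 < Module.finrank ℚ F := Module.finrank_pos
  have hcard : Fintype.card (F ≃ₐ[ℚ] F) = Module.finrank ℚ F := by
    rw [← Nat.card_eq_fintype_card, IsGalois.card_aut_eq_finrank]
  let σ : Fin (Module.finrank ℚ F) ≃ (F ≃ₐ[ℚ] F) := (Fintype.equivFinOfCardEq hcard).symm
  obtain ⟨L, a, D, j, hfin, ha, hrank, hemb⟩ := exists_splitData_field α hα ι σ
  rw [Fintype.card_fin] at ha
  have ha' : a ≤ (N + 1) * Module.finrank ℚ F := by nlinarith
  -- The missing power of 2; the exponent is genuine because a ≤ dN + 1 ≤ (N + 1)d.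
  let μ := 2 ^ ((N + 1) * Module.finrank ℚ F - a)
  have hrank' : Module.finrank ℚ (Fin μ → L) = μ * Module.finrank ℚ L := by
    rw [Module.finrank_pi_fintype]
    simp
  refine ⟨Fin μ → L, inferInstance, inferInstance, inferInstance,
    D.map (AlgHom.pi fun _ => AlgHom.id ℚ L), ?_, ?_, ?_⟩
  · rw [hrank', hrank, mul_left_comm]
    congr 1
    rw [← pow_add, Nat.sub_add_cancel ha']
  · intro e
    obtain ⟨τ, hτ⟩ := exists_algEquiv_of_algHom ι
      ((e.comp (AlgHom.pi fun _ => AlgHom.id ℚ L)).comp j)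
    -- Another point of E twists all places by one automorphism τ; left multiplication still lists
    -- every automorphism once.
    refine ⟨σ.trans (Equiv.mulLeft τ), fun k x => ?_⟩
    change e (AlgHom.pi (fun _ => AlgHom.id ℚ L) (D.emb k x)) = ι (τ (σ k x))
    rw [hemb, ← hτ]
    rfl
  · refine ⟨Fin μ × (L →ₐ[ℚ] ℂ), inferInstance,
      fun x => x.2.comp (Pi.evalAlgHom ℚ (fun _ => L) x.1),
      tensor_eq_zero_of_evaluations _ ?_ ?_⟩
    · rintro ⟨i, e⟩ ⟨i', e'⟩ h
      have hi : i = i' := by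
        by_contra hne
        have h1 := DFunLike.congr_fun h (Pi.single i 1)
        simp [Pi.single_eq_of_ne (Ne.symm hne)] at h1
      subst hi
      refine Prod.ext rfl (AlgHom.ext fun x => ?_)
      exact DFunLike.congr_fun h (fun _ => x)
    · rw [Fintype.card_prod, Fintype.card_fin, AlgHom.card, hrank']

end Existence

end ArithSO

end

noncomputable section

open scoped Matrix

namespace ArithSO

/-! ### Equivariant retractions and semisimplicity -/

section Retraction

variable {G W V K X : Type*} [Group G] [AddCommGroup W] [Module ℂ W] [AddCommGroup V] [Module ℂ V]
  [Fintype K] [DecidableEq K]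

open scoped ComplexOrder in
-- Orthogonal projection (MᴴM)⁻¹Mᴴ onto the image of `f` for the standard Hermitian form. It
-- commutes with the action because the matrices `Y g` are closed under adjoints.
theorem exists_equivariant_retraction [Module.Finite ℂ W] (τ : Representation ℂ G W)
    (Y : G → Matrix K K ℂ) (hY : ∀ g, ∃ g', (Y g)ᴴ = Y g') (f : W →ₗ[ℂ] (K → ℂ))
    (hf : Function.Injective f) (hfY : ∀ g w, f (τ g w) = Y g *ᵥ f w) :
    ∃ R : (K → ℂ) →ₗ[ℂ] W, (∀ w, R (f w) = w) ∧ ∀ g x, R (Y g *ᵥ x) = τ g (R x) := by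
  classical
  let bW := Module.finBasis ℂ W
  let bK := Pi.basisFun ℂ K
  let M := LinearMap.toMatrix bW bK f
  let t : G → Matrix _ _ ℂ := fun g => LinearMap.toMatrix bW bW (τ g)
  have hYlin : ∀ g, LinearMap.toMatrix bK bK (Matrix.toLin' (Y g)) = Y g := fun g =>
    LinearMap.toMatrix'_toLin' (Y g)
  have hMt : ∀ g, M * t g = Y g * M := by
    intro g
    rw [← hYlin g, ← LinearMap.toMatrix_comp, ← LinearMap.toMatrix_comp]
    congr 1
    ext1 w
    exact hfY g w
  have hM : Function.Injective M.mulVec := by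
    have h1 : ∀ x, M *ᵥ x = f (bW.equivFun.symm x) := by
      intro x
      have h2 := LinearMap.toMatrix_mulVec_repr bW bK f (bW.equivFun.symm x)
      have h3 : bW.repr (bW.equivFun.symm x) = x := bW.equivFun.apply_symm_apply x
      rw [h3] at h2
      rw [h2]
      rfl
    intro x y hxy
    rw [h1, h1] at hxy
    exact bW.equivFun.symm.injective (hf hxy)
  have hG : IsUnit (Mᴴ * M).det :=
    (Matrix.isUnit_iff_isUnit_det _).1 (Matrix.PosDef.conjTranspose_mul_self M hM).isUnit
  have key : ∀ g, (Mᴴ * M)⁻¹ * Mᴴ * Y g = t g * ((Mᴴ * M)⁻¹ * Mᴴ) := by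
    intro g
    obtain ⟨g', hg'⟩ := hY g
    have h1 : Mᴴ * Y g = (t g')ᴴ * Mᴴ := by
      rw [← Matrix.conjTranspose_mul, hMt, Matrix.conjTranspose_mul, ← hg',
        Matrix.conjTranspose_conjTranspose]
    have h2 : (Mᴴ * M) * t g = (t g')ᴴ * (Mᴴ * M) := by
      rw [Matrix.mul_assoc, hMt, ← Matrix.mul_assoc, h1, Matrix.mul_assoc]
    calc (Mᴴ * M)⁻¹ * Mᴴ * Y g = (Mᴴ * M)⁻¹ * ((t g')ᴴ * (Mᴴ * M)) * ((Mᴴ * M)⁻¹ * Mᴴ) := by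
          rw [Matrix.mul_assoc, h1, Matrix.mul_assoc, Matrix.mul_assoc (t g')ᴴ,
            Matrix.mul_nonsing_inv_cancel_left _ _ hG]
      _ = _ := by
          rw [← h2, ← Matrix.mul_assoc _ _ (t g), Matrix.nonsing_inv_mul _ hG, Matrix.one_mul]
  have hRm := LinearMap.toMatrix_toLin bK bW ((Mᴴ * M)⁻¹ * Mᴴ)
  refine ⟨Matrix.toLin bK bW ((Mᴴ * M)⁻¹ * Mᴴ), fun w => ?_, fun g x => ?_⟩
  · have h : Matrix.toLin bK bW ((Mᴴ * M)⁻¹ * Mᴴ) ∘ₗ f = LinearMap.id := by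
      apply (LinearMap.toMatrix bW bW).injective
      rw [LinearMap.toMatrix_comp bW bK bW, hRm, LinearMap.toMatrix_id, Matrix.mul_assoc]
      exact Matrix.nonsing_inv_mul _ hG
    exact LinearMap.congr_fun h w
  · have h : Matrix.toLin bK bW ((Mᴴ * M)⁻¹ * Mᴴ) ∘ₗ Matrix.toLin' (Y g) =
        τ g ∘ₗ Matrix.toLin bK bW ((Mᴴ * M)⁻¹ * Mᴴ) := by
      apply (LinearMap.toMatrix bK bW).injective
      rw [LinearMap.toMatrix_comp bK bK bW, LinearMap.toMatrix_comp bK bW bW, hRm, hYlin]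
      exact key g
    exact LinearMap.congr_fun h x

/-- The kernel of the equivariant projection onto a subrepresentation is an invariant complement. -/
theorem isSemisimple_of_adjoint [Module.Finite ℂ V] (ρ : Representation ℂ G V)
    (Y : G → Matrix K K ℂ) (hY : ∀ g, ∃ g', (Y g)ᴴ = Y g') (f : V →ₗ[ℂ] (K → ℂ))
    (hf : Function.Injective f) (hfY : ∀ g w, f (ρ g w) = Y g *ᵥ f w) :
    ρ.IsSemisimpleRepresentation := by
  refine ⟨fun U => ?_⟩
  let τ : Representation ℂ G U.toSubmodule :=
    { toFun := fun g => (ρ g).restrict fun v hv => U.apply_mem_toSubmodule g hv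
      map_one' := by ext; simp
      map_mul' := fun g h => by ext; simp }
  obtain ⟨R, hR, hRY⟩ := exists_equivariant_retraction τ Y hY (f ∘ₗ U.toSubmodule.subtype)
    (hf.comp Subtype.val_injective) fun g w => hfY g w
  let Q : V →ₗ[ℂ] U.toSubmodule := R ∘ₗ f
  have hQ : ∀ g v, Q (ρ g v) = τ g (Q v) := by
    intro g v
    change R (f (ρ g v)) = _
    rw [hfY, hRY]
    rfl
  have hQU : ∀ u : U.toSubmodule, Q u = u := hR
  have hcompl : IsCompl U.toSubmodule (LinearMap.ker Q) := by
    rw [isCompl_iff, Submodule.disjoint_def, Submodule.codisjoint_iff_exists_add_eq]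
    refine ⟨fun x hx hx' => ?_, fun v => ⟨Q v, v - Q v, (Q v).2, ?_, by simp⟩⟩
    · have := hQU ⟨x, hx⟩
      rw [LinearMap.mem_ker] at hx'
      rw [hx'] at this
      exact (congrArg Subtype.val this).symm
    · rw [LinearMap.mem_ker, map_sub, hQU, sub_self]
  let U' : Subrepresentation ρ := ⟨LinearMap.ker Q, fun g v hv => by
    rw [LinearMap.mem_ker] at hv ⊢
    rw [hQ, hv, map_zero]⟩
  refine ⟨U', ?_⟩
  rw [isCompl_iff, disjoint_iff, codisjoint_iff]
  constructor
  · apply Subrepresentation.toSubmodule_injective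
    exact hcompl.inf_eq_bot
  · apply Subrepresentation.toSubmodule_injective
    exact hcompl.sup_eq_top

/-- A jointly injective family is one injective map into the direct sum; the block diagonal action
is closed under adjoints because `g'` does not depend on the block. -/
theorem isSemisimple_of_adjoint_family [Module.Finite ℂ V] [Fintype X] [DecidableEq X]
    (ρ : Representation ℂ G V) (Y : X → G → Matrix K K ℂ)
    (hY : ∀ g, ∃ g', ∀ i, (Y i g)ᴴ = Y i g') (f : X → V →ₗ[ℂ] (K → ℂ))
    (hf : ∀ v, (∀ i, f i v = 0) → v = 0) (hfY : ∀ i g w, f i (ρ g w) = Y i g *ᵥ f i w) :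
    ρ.IsSemisimpleRepresentation := by
  refine isSemisimple_of_adjoint (K := K × X) ρ (fun g => Matrix.blockDiagonal fun i => Y i g) ?_
    (LinearMap.pi fun x => LinearMap.proj x.1 ∘ₗ f x.2) ?_ ?_
  · intro g
    obtain ⟨g', hg'⟩ := hY g
    refine ⟨g', ?_⟩
    rw [Matrix.blockDiagonal_conjTranspose]
    simp only [hg']
  · rw [← LinearMap.ker_eq_bot, LinearMap.ker_eq_bot']
    intro v hv
    refine hf v fun i => ?_
    ext k
    exact congrFun hv (k, i)
  · intro g w
    ext ⟨k, i⟩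
    change f i (ρ g w) k = _
    rw [hfY]
    simp only [Matrix.mulVec, dotProduct, Fintype.sum_prod_type, Matrix.blockDiagonal_apply,
      ite_mul, zero_mul, LinearMap.pi_apply, LinearMap.comp_apply, LinearMap.proj_apply]
    simp

end Retraction

end ArithSO

end

noncomputable section

open scoped Matrix

namespace ArithSO

/-! ### Complex conjugation and the sign involution in the hyperbolic basis -/

section Signs

variable {n N : ℕ} {ε : Fin (n + 1) ⊕ Fin (n + 1) ≃ Fin N} {im : ℂ} {u : Fin N → ℂ}
  {a s : Fin N → ℝ}

theorem star_eq_neg_of_mul_self {z : ℂ} (hz : z * z = -1) : star z = -z := by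
  have h : (z - Complex.I) * (z + Complex.I) = 0 := by
    linear_combination hz - Complex.I_mul_I
  rcases mul_eq_zero.1 h with h | h
  · rw [sub_eq_zero.1 h]
    exact Complex.conj_I
  · rw [eq_neg_of_add_eq_zero_left h, star_neg]
    exact congrArg _ Complex.conj_I

/-- The number z² = 1/c is real, so z is real or imaginary according to the sign `t` of c. -/
theorem star_eq_sign_mul {z : ℂ} {c t : ℝ} (hz : z * z * c = 1) (ht : t * t = 1)
    (hc : 0 < t * c) : star z = t * z := by
  have hcz : star z * star z * c = 1 := by
    have := congrArg star hz
    simpa using this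
  have hn : (z * star z : ℂ) = (Complex.normSq z : ℝ) := Complex.mul_conj z
  have hc0 : (c : ℂ) ≠ 0 := by
    rintro h
    rw [h, mul_zero] at hz
    exact zero_ne_one hz
  have hz0 : z ≠ 0 := by
    rintro rfl
    simp at hz
  have hpos : 0 < Complex.normSq z := Complex.normSq_pos.2 hz0
  have h : (star z - z) * (star z + z) = 0 := by
    apply mul_right_cancel₀ hc0
    linear_combination hcz - hz
  have ht' : t = 1 ∨ t = -1 := mul_self_eq_one_iff.1 ht
  rcases mul_eq_zero.1 h with h | h
  · have hs : star z = z := sub_eq_zero.1 h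
    rcases ht' with rfl | rfl
    · rw [hs]; simp
    · exfalso
      rw [hs] at hn
      rw [hn] at hz
      have : Complex.normSq z * c = 1 := by exact_mod_cast hz
      nlinarith
  · have hs : star z = -z := eq_neg_of_add_eq_zero_left h
    rcases ht' with rfl | rfl
    · exfalso
      rw [hs] at hn
      have hz' : -(z * -z) * c = 1 := by linear_combination hz
      rw [hn] at hz'
      have : -Complex.normSq z * c = 1 := by exact_mod_cast hz'
      nlinarith
    · rw [hs]; simp

theorem hypBasis_mul {Z : Type*} (M : Matrix (Fin (n + 1) ⊕ Fin (n + 1)) Z ℂ) :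
    hypBasis ε im u * M = Matrix.diagonal u * (hypBlock n im * M).submatrix ε.symm id := by
  rw [hypBasis, Matrix.mul_assoc]
  rfl

/-- Complex conjugation exchanges e + ie' with e - ie', which is the split Gram matrix on the right,
and multiplies the scaling factors by the signs `s`. -/
theorem hypBasis_map_star (him : im * im = -1) (hu : ∀ j, u j * u j * a j = 1)
    (hs : ∀ j, s j * s j = 1) (hsa : ∀ j, 0 < s j * a j) :
    (hypBasis ε im u).map star =
      Matrix.diagonal (fun j => (s j : ℂ)) * hypBasis ε im u * splitForm n ℂ := by
  have h1 : (hypBlock n im).map star = hypBlock n im * splitForm n ℂ := by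
    have h2 := hypBlock_map (n := n) (starRingEnd ℂ) im
    have h3 : starRingEnd ℂ im = -im := star_eq_neg_of_mul_self him
    refine h2.trans ?_
    rw [h3, hypBlock, hypBlock, splitForm, Matrix.fromBlocks_multiply]
    simp
  ext i x
  have h4 := congrFun (congrFun h1 (ε.symm i)) x
  rw [Matrix.mul_assoc, hypBasis_mul, ← h1]
  simp only [hypBasis, Matrix.map_apply, Matrix.diagonal_mul, Matrix.submatrix_apply, id,
    star_mul']
  rw [star_eq_sign_mul (hu i) (hs i) (hsa i), mul_assoc]

/-- In the hyperbolic basis the Hermitian adjoint of a real isometry is its inverse conjugated by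
diag(s): the Gram relation replaces gᵀ by g⁻¹, and the signs come from conjugating the basis. -/
theorem conjTranspose_hypConj (him : im * im = -1) (hu : ∀ j, u j * u j * a j = 1)
    (hs : ∀ j, s j * s j = 1) (hsa : ∀ j, 0 < s j * a j) {g g' : Matrix (Fin N) (Fin N) ℂ}
    (hg : g.map star = g) (hiso : gᵀ * Matrix.diagonal (fun j => (a j : ℂ)) * g =
      Matrix.diagonal fun j => (a j : ℂ)) (hinv : g * g' = 1) :
    (hypBasisInv ε im u (fun j => (a j : ℂ)) * g * hypBasis ε im u)ᴴ =
      hypBasisInv ε im u (fun j => (a j : ℂ)) *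
        (Matrix.diagonal (fun j => (s j : ℂ)) * g' * Matrix.diagonal fun j => (s j : ℂ)) *
        hypBasis ε im u := by
  set T := hypBasis ε im u with hT
  set A := Matrix.diagonal fun j => (a j : ℂ) with hA
  set D := Matrix.diagonal fun j => (s j : ℂ) with hD
  set J := splitForm n ℂ with hJ
  have hJt : Jᵀ = J := by simp [hJ, splitForm, Matrix.fromBlocks_transpose]
  have hJh : Jᴴ = J := by simp [hJ, splitForm, Matrix.fromBlocks_conjTranspose]
  have hJJ : J * J = 1 := splitForm_mul_self
  have hAh : Aᴴ = A := by
    rw [hA, Matrix.diagonal_conjTranspose]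
    congr 1
    ext j
    exact Complex.conj_ofReal _
  have hTs : T.map star = D * T * J := hypBasis_map_star him hu hs hsa
  have hTh : Tᴴ = J * Tᵀ * D := by
    have h : Tᴴ = (T.map star)ᵀ := rfl
    rw [h, hTs,
      Matrix.transpose_mul, Matrix.transpose_mul, hJt, hD, Matrix.diagonal_transpose,
      Matrix.mul_assoc]
  have hTth : (Tᵀ)ᴴ = D * T * J := by
    rw [← hTs]
    ext
    rfl
  have hgh : gᴴ = gᵀ := by
    rw [Matrix.conjTranspose, Matrix.transpose_map, hg]
  have hDA : D * A = A * D := by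
    rw [hD, hA, Matrix.diagonal_mul_diagonal, Matrix.diagonal_mul_diagonal]
    congr 1
    ext j
    exact mul_comm _ _
  have hgA : gᵀ * A = A * g' := by
    calc gᵀ * A = gᵀ * A * (g * g') := by rw [hinv, Matrix.mul_one]
      _ = _ := by rw [← Matrix.mul_assoc, hiso]
  have h2 : star (algebraMap ℚ ℂ 2⁻¹) = algebraMap ℚ ℂ 2⁻¹ := by simp
  rw [hypBasisInv, Matrix.conjTranspose_mul, Matrix.conjTranspose_mul,
    Matrix.conjTranspose_smul, Matrix.conjTranspose_mul, Matrix.conjTranspose_mul, h2]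
  rw [← hT, ← hJ, ← hA, hTth, hJh, hTh, hAh, hgh]
  simp only [Matrix.smul_mul, Matrix.mul_smul]
  congr 1
  calc J * Tᵀ * D * (gᵀ * (A * (D * T * J * J)))
      = J * Tᵀ * D * (gᵀ * A) * D * T * (J * J) := by simp only [Matrix.mul_assoc]
    _ = J * Tᵀ * (D * A) * g' * D * T := by
        rw [hgA, hJJ, Matrix.mul_one]; simp only [Matrix.mul_assoc]
    _ = _ := by rw [hDA]; simp only [Matrix.mul_assoc]

/-- The matrix of `diag(s)` in the hyperbolic basis. -/
def signBlock (ε : Fin (n + 1) ⊕ Fin (n + 1) ≃ Fin N) (s : Fin N → ℝ) :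
    Matrix (Fin (n + 1) ⊕ Fin (n + 1)) (Fin (n + 1) ⊕ Fin (n + 1)) ℂ :=
  Matrix.fromBlocks
    (Matrix.diagonal fun j => ((s (ε (Sum.inl j)) + s (ε (Sum.inr j))) / 2 : ℂ))
    (Matrix.diagonal fun j => ((s (ε (Sum.inl j)) - s (ε (Sum.inr j))) / 2 : ℂ))
    (Matrix.diagonal fun j => ((s (ε (Sum.inl j)) - s (ε (Sum.inr j))) / 2 : ℂ))
    (Matrix.diagonal fun j => ((s (ε (Sum.inl j)) + s (ε (Sum.inr j))) / 2 : ℂ))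

theorem signBlock_mul_self (hs : ∀ j, s j * s j = 1) : signBlock ε s * signBlock ε s = 1 := by
  have hs' : ∀ j, (s j : ℂ) * s j = 1 := fun j => by exact_mod_cast hs j
  rw [signBlock, Matrix.fromBlocks_multiply, ← Matrix.fromBlocks_one]
  simp only [Matrix.diagonal_mul_diagonal, Matrix.diagonal_add]
  congr 1
  · rw [← Matrix.diagonal_one]
    congr 1
    ext j
    linear_combination (hs' (ε (Sum.inl j)) + hs' (ε (Sum.inr j))) / 2
  · rw [← Matrix.diagonal_zero]
    congr 1
    ext j
    linear_combination (hs' (ε (Sum.inl j)) - hs' (ε (Sum.inr j))) / 2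
  · rw [← Matrix.diagonal_zero]
    congr 1
    ext j
    linear_combination (hs' (ε (Sum.inl j)) - hs' (ε (Sum.inr j))) / 2
  · rw [← Matrix.diagonal_one]
    congr 1
    ext j
    linear_combination (hs' (ε (Sum.inl j)) + hs' (ε (Sum.inr j))) / 2

/-- Equal signs on a pair e, e' give a scalar on e ± ie'; opposite signs exchange these two vectors
up to sign. -/
theorem diagonal_mul_hypBasis :
    Matrix.diagonal (fun j => (s j : ℂ)) * hypBasis ε im u = hypBasis ε im u * signBlock ε s := by
  have h : Matrix.diagonal (fun x => (s (ε x) : ℂ)) * hypBlock n im =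
      hypBlock n im * signBlock ε s := by
    have h1 : Matrix.diagonal (fun x => (s (ε x) : ℂ)) =
        Matrix.fromBlocks (Matrix.diagonal fun j => (s (ε (Sum.inl j)) : ℂ)) 0 0
          (Matrix.diagonal fun j => (s (ε (Sum.inr j)) : ℂ)) := by
      rw [Matrix.fromBlocks_diagonal]
      congr 1
      ext x
      cases x <;> rfl
    rw [h1, hypBlock, signBlock, Matrix.fromBlocks_multiply, Matrix.fromBlocks_multiply]
    simp only [Matrix.mul_one, Matrix.one_mul, zero_add,
      Matrix.mul_neg, Matrix.neg_mul, Matrix.mul_smul, Matrix.smul_mul]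
    congr 1 <;> ext j l <;> by_cases hjl : j = l
    all_goals first
      | (subst hjl; simp; ring)
      | simp [hjl]
  ext i x
  have h1 := congrFun (congrFun h (ε.symm i)) x
  rw [Matrix.diagonal_mul, ε.apply_symm_apply] at h1
  rw [hypBasis_mul, Matrix.diagonal_mul, Matrix.diagonal_mul, Matrix.submatrix_apply, id, ← h1, hypBasis,
    Matrix.diagonal_mul, Matrix.submatrix_apply, id]
  ring

/-- With χ the indicator of a set of odd size, this is an odd principal minor of a skew matrix.
Without choosing the set: C = 1 - D + DAD satisfies Cᵀ = (1 - 2D)C, and det(1 - 2D) = -1. -/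
theorem det_eq_zero_of_odd_minor {χ : Fin (n + 1) → ℂ} (hχ : ∀ j, χ j * χ j = χ j)
    (hodd : ∏ j, (1 - 2 * χ j) = -1) {A : Matrix (Fin (n + 1)) (Fin (n + 1)) ℂ} (hA : Aᵀ = -A) :
    (Matrix.diagonal (fun j => 1 - χ j) + Matrix.diagonal χ * A).det = 0 := by
  set D := Matrix.diagonal χ with hD
  have hDD : D * D = D := by
    rw [hD, Matrix.diagonal_mul_diagonal]
    simp only [hχ]
  have h1 : Matrix.diagonal (fun j => 1 - χ j) = 1 - D := by
    rw [hD, ← Matrix.diagonal_one, ← Matrix.diagonal_sub]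
  have h2 : Matrix.diagonal (fun j => 1 - 2 * χ j) = 1 - 2 * D := by
    ext i j
    by_cases hij : i = j
    · subst hij
      simp [hD, two_mul]
    · simp [hD, two_mul, hij]
  set C := 1 - D + D * A * D with hC
  have hfac : 1 - D + D * A = (1 + D * A * (1 - D)) * C := by
    have h3 : (1 - D) * (1 - D) = 1 - D := by
      calc (1 - D) * (1 - D) = 1 - D - D + D * D := by noncomm_ring
        _ = _ := by rw [hDD]; noncomm_ring
    have h4 : (1 - D) * D = 0 := by rw [sub_mul, hDD, one_mul, sub_self]
    calc _ = C + D * A * ((1 - D) * (1 - D)) := by rw [h3, hC]; noncomm_ring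
      _ = C + D * A * ((1 - D) * (1 - D)) + D * A * ((1 - D) * D) * A * D := by
          rw [h4]; simp
      _ = _ := by rw [hC]; noncomm_ring
  have hCt : Cᵀ = (1 - 2 * D) * C := by
    calc Cᵀ = 1 - D - D * A * D := by
          rw [hC, Matrix.transpose_add, Matrix.transpose_sub, Matrix.transpose_mul,
            Matrix.transpose_mul, hA, hD, Matrix.diagonal_transpose, Matrix.transpose_one]
          noncomm_ring
      _ = 1 - 3 * D + 2 * (D * D) + D * A * D - 2 * (D * D * A * D) := by
          rw [hDD]; noncomm_ring
      _ = _ := by rw [hC]; noncomm_ring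
  have hdet : C.det = -C.det := by
    conv_lhs => rw [← Matrix.det_transpose, hCt, Matrix.det_mul, ← h2, Matrix.det_diagonal, hodd]
    ring
  rw [h1, hfac, Matrix.det_mul, self_eq_neg.1 hdet, mul_zero]

/-- Total sign -1 means that an odd number of pairs are exchanged. Up to an invertible diagonal
factor the upper block is the matrix of an odd principal minor of A. Geometrically, the improper
isometry sends the cell to the other family, which misses the chart. -/
theorem det_signBlock_mul_cell (hs : ∀ j, s j * s j = 1) (hodd : ∏ j, s j = -1)
    {A : Matrix (Fin (n + 1)) (Fin (n + 1)) ℂ} (hA : Aᵀ = -A) :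
    (signBlock ε s * cell A).toRows₁.det = 0 := by
  have hs' : ∀ j, (s j : ℂ) * s j = 1 := fun j => by exact_mod_cast hs j
  set x : Fin (n + 1) → ℂ := fun j => (s (ε (Sum.inl j)) + s (ε (Sum.inr j))) / 2 with hx
  set y : Fin (n + 1) → ℂ := fun j => (s (ε (Sum.inl j)) - s (ε (Sum.inr j))) / 2 with hy
  have hxy : ∀ j, x j * y j = 0 := fun j => by
    simp only [hx, hy]
    linear_combination (hs' (ε (Sum.inl j)) - hs' (ε (Sum.inr j))) / 4
  have hsum : ∀ j, x j * x j + y j * y j = 1 := fun j => by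
    simp only [hx, hy]
    linear_combination (hs' (ε (Sum.inl j)) + hs' (ε (Sum.inr j))) / 2
  have htop : (signBlock ε s * cell A).toRows₁ = Matrix.diagonal x + Matrix.diagonal y * A := by
    rw [signBlock, cell, Matrix.fromBlocks_mul_fromRows, Matrix.toRows₁_fromRows, Matrix.mul_one]
  have hmul : Matrix.diagonal (fun j => x j + y j) * (Matrix.diagonal x + Matrix.diagonal y * A) =
      Matrix.diagonal (fun j => 1 - y j * y j) + Matrix.diagonal (fun j => y j * y j) * A := by
    rw [mul_add, ← Matrix.mul_assoc, Matrix.diagonal_mul_diagonal, Matrix.diagonal_mul_diagonal]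
    congr 2
    · ext j
      linear_combination hsum j + hxy j
    · congr 1
      ext j
      linear_combination hxy j
  have hzero := det_eq_zero_of_odd_minor (χ := fun j => y j * y j) (fun j => by
      linear_combination y j * y j * hsum j - x j * y j * hxy j) (by
      have h1 : ∏ j, (s j : ℂ) = -1 := by exact_mod_cast congrArg (fun z : ℝ => (z : ℂ)) hodd
      rw [← h1, ← ε.prod_comp, Fintype.prod_sum_type, ← Finset.prod_mul_distrib]
      refine Finset.prod_congr rfl fun j _ => ?_
      simp only [hy]
      linear_combination -(hs' (ε (Sum.inl j)) + hs' (ε (Sum.inr j))) / 2) hA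
  rw [← hmul, Matrix.det_mul, Matrix.det_diagonal] at hzero
  rw [htop]
  refine (mul_eq_zero.1 hzero).resolve_left (Finset.prod_ne_zero_iff.2 fun j _ h => ?_)
  have : (x j + y j) * (x j + y j) = 1 := by linear_combination hsum j + 2 * hxy j
  rw [h, mul_zero] at this
  exact zero_ne_one this

end Signs

end ArithSO

end

noncomputable section

open scoped Matrix

namespace ArithSO

/-! ### Real points from their components -/

section OfPlaces

variable {F : Type*} [Field F] [NumberField F] [IsGalois ℚ F] {N : ℕ} {α : Fin N → F}
  (ι : F →ₐ[ℚ] ℝ)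

theorem place_placesEquiv_symm (x : (F ≃ₐ[ℚ] F) → ℝ) (τ : F ≃ₐ[ℚ] F) :
    place ι τ ((placesEquiv ι).symm x) = x τ :=
  congrFun ((placesEquiv ι).apply_symm_apply x) τ

/-- The matrix over `ℝ ⊗ F` with given components. -/
def matOfPlaces (M : (F ≃ₐ[ℚ] F) → Matrix (Fin N) (Fin N) ℝ) :
    Matrix (Fin N) (Fin N) (ℝ ⊗[ℚ] F) :=
  Matrix.of fun i j => (placesEquiv ι).symm fun τ => M τ i j

theorem matOfPlaces_map_place (M : (F ≃ₐ[ℚ] F) → Matrix (Fin N) (Fin N) ℝ) (τ : F ≃ₐ[ℚ] F) :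
    (matOfPlaces ι M).map (place ι τ).toRingHom = M τ := by
  ext i j
  exact place_placesEquiv_symm ι _ τ

theorem eq_of_place_eq {x y : ℝ ⊗[ℚ] F} (h : ∀ τ, place ι τ x = place ι τ y) : x = y :=
  (placesEquiv ι).injective (funext h)

theorem det_matOfPlaces {M : (F ≃ₐ[ℚ] F) → Matrix (Fin N) (Fin N) ℝ} (hM : ∀ τ, (M τ).det = 1) :
    (matOfPlaces ι M).det = 1 := by
  refine eq_of_place_eq ι fun τ => ?_
  have h := RingHom.map_det (place ι τ).toRingHom (matOfPlaces ι M)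
  rw [RingHom.mapMatrix_apply, matOfPlaces_map_place, hM] at h
  exact h.trans (map_one _).symm

theorem matOfPlaces_isometry {M : (F ≃ₐ[ℚ] F) → Matrix (Fin N) (Fin N) ℝ}
    (hM : ∀ τ, (M τ)ᵀ * Matrix.diagonal (fun j => ι (τ (α j))) * M τ =
      Matrix.diagonal fun j => ι (τ (α j))) :
    (matOfPlaces ι M)ᵀ * Matrix.diagonal (fun j => (1 : ℝ) ⊗ₜ[ℚ] α j) * matOfPlaces ι M =
      Matrix.diagonal fun j => (1 : ℝ) ⊗ₜ[ℚ] α j := by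
  have hd : ∀ τ, (Matrix.diagonal fun j => (1 : ℝ) ⊗ₜ[ℚ] α j).map (place ι τ).toRingHom =
      Matrix.diagonal fun j => ι (τ (α j)) := by
    intro τ
    rw [Matrix.diagonal_map (map_zero _)]
    congr 1
    ext j
    change place ι τ _ = _
    simp
  ext i j
  refine eq_of_place_eq ι fun τ => ?_
  have h := hM τ
  rw [← matOfPlaces_map_place ι M τ, ← hd τ, ← Matrix.transpose_map, ← Matrix.map_mul,
    ← Matrix.map_mul] at h
  exact congrFun (congrFun h i) j

/-- The real point with given components. -/
def resSOOfPlaces (M : (F ≃ₐ[ℚ] F) → Matrix (Fin N) (Fin N) ℝ) (hdet : ∀ τ, (M τ).det = 1)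
    (hM : ∀ τ, (M τ)ᵀ * Matrix.diagonal (fun j => ι (τ (α j))) * M τ =
      Matrix.diagonal fun j => ι (τ (α j))) : ResSO α ℝ :=
  ⟨⟨matOfPlaces ι M, det_matOfPlaces ι hdet⟩, mem_SO.2 (matOfPlaces_isometry ι hM)⟩

theorem continuous_resSOOfPlaces {Z : Type*} [TopologicalSpace Z]
    {M : Z → (F ≃ₐ[ℚ] F) → Matrix (Fin N) (Fin N) ℝ} (hdet : ∀ z τ, (M z τ).det = 1)
    (hM : ∀ z τ, (M z τ)ᵀ * Matrix.diagonal (fun j => ι (τ (α j))) * M z τ =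
      Matrix.diagonal fun j => ι (τ (α j))) (hc : ∀ τ, Continuous fun z => M z τ) :
    Continuous fun z => resSOOfPlaces ι (M z) (hdet z) (hM z) := by
  refine Continuous.subtype_mk (Continuous.subtype_mk ?_ _) _
  refine continuous_matrix fun i j => ?_
  have h1 : Continuous (placesEquiv ι).symm :=
    IsModuleTopology.continuous_of_linearMap (R := ℝ) (placesEquiv ι).symm.toLinearMap
  exact h1.comp (continuous_pi fun τ => (hc τ).matrix_elem i j)

theorem cayley_isometry {a : Fin N → ℝ} {ξ : Matrix (Fin N) (Fin N) ℝ}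
    (hξ : ξᵀ * Matrix.diagonal a = -(Matrix.diagonal a * ξ)) (hdet : (1 + ξ).det ≠ 0) :
    ((1 + ξ).det⁻¹ • cayleyNum ξ)ᵀ * Matrix.diagonal a * ((1 + ξ).det⁻¹ • cayleyNum ξ) =
      Matrix.diagonal a := by
  have hu : (1 + ξ) * ((1 + ξ).det⁻¹ • (1 + ξ).adjugate) = 1 := by
    rw [Matrix.mul_smul, Matrix.mul_adjugate, smul_smul, inv_mul_cancel₀ hdet, one_smul]
  have h := isometry_of_skew hξ hu
  rwa [Matrix.mul_smul] at h

theorem cayley_det {a : Fin N → ℝ} (ha : ∀ j, a j ≠ 0) {ξ : Matrix (Fin N) (Fin N) ℝ}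
    (hξ : ξᵀ * Matrix.diagonal a = -(Matrix.diagonal a * ξ)) (hdet : (1 + ξ).det ≠ 0) :
    ((1 + ξ).det⁻¹ • cayleyNum ξ).det = 1 := by
  refine det_eq_one_of_isUnit_one_add (fun j => isUnit_iff_ne_zero.2 (ha j))
    (cayley_isometry hξ hdet) ?_
  have hu : (1 + ξ) * ((1 + ξ).det⁻¹ • (1 + ξ).adjugate) = 1 := by
    rw [Matrix.mul_smul, Matrix.mul_adjugate, smul_smul, inv_mul_cancel₀ hdet, one_smul]
  have h1 : 1 + (1 + ξ).det⁻¹ • cayleyNum ξ =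
      (2 : ℝ) • ((1 + ξ).det⁻¹ • (1 + ξ).adjugate) := by
    rw [cayleyNum, ← Matrix.mul_smul]
    generalize (1 + ξ).det⁻¹ • (1 + ξ).adjugate = v at hu ⊢
    nth_rewrite 1 [← hu]
    rw [← add_mul, two_smul]
    noncomm_ring
  refine IsUnit.of_mul_eq_one ((2 : ℝ)⁻¹ • (1 + ξ)) ?_
  rw [h1, Matrix.smul_mul, Matrix.mul_smul, smul_smul, mul_inv_cancel₀ two_ne_zero, one_smul]
  exact mul_eq_one_comm.1 hu

/-- The Cayley transforms of sξ form a continuous path from the identity while the denominators are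
nonzero, so they remain in the identity component for small s. -/
theorem exists_cayley_mem_component (hα : ∀ (τ : F ≃ₐ[ℚ] F) j, ι (τ (α j)) ≠ 0)
    {ξ : (F ≃ₐ[ℚ] F) → Matrix (Fin N) (Fin N) ℝ}
    (hξ : ∀ τ, (ξ τ)ᵀ * Matrix.diagonal (fun j => ι (τ (α j))) =
      -(Matrix.diagonal (fun j => ι (τ (α j))) * ξ τ)) :
    ∃ δ : ℝ, 0 < δ ∧ ∀ s ∈ Set.Icc 0 δ, ∃ g : RealPointsId α, ∀ τ, (1 + s • ξ τ).det ≠ 0 ∧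
      (g.1.1 : Matrix (Fin N) (Fin N) (ℝ ⊗[ℚ] F)).map (place ι τ).toRingHom =
        (1 + s • ξ τ).det⁻¹ • cayleyNum (s • ξ τ) := by
  have hcont : ∀ τ, Continuous fun s : ℝ => (1 + s • ξ τ).det := fun τ =>
    (continuous_const.add (continuous_id.smul continuous_const)).matrix_det
  have hev : ∀ᶠ s in nhds (0 : ℝ), ∀ τ, (1 + s • ξ τ).det ≠ 0 := by
    rw [Filter.eventually_all]
    intro τ
    refine (hcont τ).continuousAt.eventually_ne ?_
    simp
  obtain ⟨δ, hδ, hball⟩ := Metric.eventually_nhds_iff.1 hev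
  -- Halving δ places a closed interval inside the open ball.
  have hne : ∀ s : Set.Icc (0 : ℝ) (δ / 2), ∀ τ, (1 + s.1 • ξ τ).det ≠ 0 := by
    rintro ⟨s, hs0, hs1⟩
    apply hball
    rw [Real.dist_eq, sub_zero, abs_of_nonneg hs0]
    linarith
  have hskew : ∀ (s : ℝ) τ, (s • ξ τ)ᵀ * Matrix.diagonal (fun j => ι (τ (α j))) =
      -(Matrix.diagonal (fun j => ι (τ (α j))) * (s • ξ τ)) := by
    intro s τ
    rw [Matrix.transpose_smul, Matrix.smul_mul, hξ, Matrix.mul_smul, smul_neg]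
  let f : Set.Icc (0 : ℝ) (δ / 2) → ResSO α ℝ := fun s =>
    resSOOfPlaces ι (fun τ => (1 + s.1 • ξ τ).det⁻¹ • cayleyNum (s.1 • ξ τ))
      (fun τ => cayley_det (hα τ) (hskew s τ) (hne s τ))
      (fun τ => cayley_isometry (hskew s τ) (hne s τ))
  have hf : Continuous f := by
    refine continuous_resSOOfPlaces ι (M := fun (s : Set.Icc (0 : ℝ) (δ / 2)) τ =>
      (1 + s.1 • ξ τ).det⁻¹ • cayleyNum (s.1 • ξ τ)) _ _ fun τ => ?_
    have h1 : Continuous fun s : Set.Icc (0 : ℝ) (δ / 2) => s.1 • ξ τ :=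
      continuous_subtype_val.smul continuous_const
    refine Continuous.smul (Continuous.inv₀ ((hcont τ).comp continuous_subtype_val)
      fun s => hne s τ) ?_
    exact (continuous_const.sub h1).matrix_mul (continuous_const.add h1).matrix_adjugate
  have hmem0 : (0 : ℝ) ∈ Set.Icc 0 (δ / 2) := ⟨le_rfl, by linarith⟩
  have h0 : f ⟨0, hmem0⟩ = 1 := by
    apply Subtype.ext
    apply Subtype.ext
    change matOfPlaces ι _ = 1
    ext i j
    refine eq_of_place_eq ι fun τ => ?_
    have h1 := congrFun (congrFun (matOfPlaces_map_place ι
      (fun τ => (1 + (0 : ℝ) • ξ τ).det⁻¹ • cayleyNum ((0 : ℝ) • ξ τ)) τ) i) j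
    refine Eq.trans h1 ?_
    simp only [zero_smul, add_zero, Matrix.det_one, inv_one, cayleyNum_zero, one_smul]
    by_cases hij : i = j
    · subst hij; simp
    · simp [hij]
  have : PreconnectedSpace (Set.Icc (0 : ℝ) (δ / 2)) :=
    Subtype.preconnectedSpace isPreconnected_Icc
  have hsub := (isPreconnected_range hf).subset_connectedComponent (x := 1) ⟨_, h0⟩
  refine ⟨δ / 2, by linarith, fun s hs => ⟨⟨f ⟨s, hs⟩, hsub ⟨_, rfl⟩⟩, fun τ =>
    ⟨hne ⟨s, hs⟩ τ, ?_⟩⟩⟩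
  exact matOfPlaces_map_place ι _ τ

end OfPlaces

end ArithSO

end

noncomputable section

open scoped Matrix

namespace ArithSO

/-! ### Polynomial identities on the identity component -/

section Density

variable {n m : ℕ} {κ I : Type*} [Fintype κ] [DecidableEq κ] [Fintype I] [DecidableEq I]

theorem exists_eval_eq (Λ : Matrix (κ → Fin m × Fin (n + 1) → I) (κ → Fin m × Fin (n + 1) → I) ℂ
    →ₗ[ℂ] ℂ) (M : κ → Matrix I I (Polynomial ℂ)) :
    ∃ P : Polynomial ℂ, ∀ z, P.eval z =
      Λ (kron fun k => tensorPow n m ((M k).map (Polynomial.evalRingHom z))) := by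
  refine ⟨∑ x, ∑ y, Polynomial.C (Λ (Matrix.single x y 1)) *
    (kron fun k => tensorPow n m (M k)) x y, fun z => ?_⟩
  simp only [← tensorPow_map]
  rw [← kron_map]
  set Y := kron fun k => tensorPow n m (M k)
  rw [Matrix.matrix_eq_sum_single (Y.map (Polynomial.evalRingHom z))]
  simp only [Polynomial.eval_finsetSum, Polynomial.eval_mul, Polynomial.eval_C, map_sum]
  refine Finset.sum_congr rfl fun x _ => Finset.sum_congr rfl fun y _ => ?_
  have h : Matrix.single x y ((Y.map (Polynomial.evalRingHom z)) x y) =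
      ((Y x y).eval z) • Matrix.single x y (1 : ℂ) := by
    rw [Matrix.smul_single, smul_eq_mul, mul_one]
    rfl
  rw [h, map_smul, smul_eq_mul, mul_comm]

/-- All constructions involved are polynomial in the parameter, so a linear relation on an infinite
set of values holds for all values. -/
theorem forall_eq_zero_of_infinite (Λ : Matrix (κ → Fin m × Fin (n + 1) → I)
    (κ → Fin m × Fin (n + 1) → I) ℂ →ₗ[ℂ] ℂ) (M : κ → Matrix I I (Polynomial ℂ)) {s : Set ℂ}
    (hs : s.Infinite) (h : ∀ z ∈ s,
      Λ (kron fun k => tensorPow n m ((M k).map (Polynomial.evalRingHom z))) = 0) (z : ℂ) :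
    Λ (kron fun k => tensorPow n m ((M k).map (Polynomial.evalRingHom z))) = 0 := by
  obtain ⟨P, hP⟩ := exists_eval_eq Λ M
  have h0 : P = 0 := Polynomial.eq_zero_of_infinite_isRoot P
    (hs.mono fun w hw => (hP w).trans (h w hw))
  rw [← hP, h0, Polynomial.eval_zero]

theorem cayleyNum_conj {X : Type*} [Fintype X] [DecidableEq X] {T : Matrix X I ℂ}
    {T' : Matrix I X ℂ} (h1 : T' * T = 1) (h2 : T * T' = 1) {ξ : Matrix X X ℂ}
    (hdet : (1 + ξ).det ≠ 0) : cayleyNum (T' * ξ * T) = T' * cayleyNum ξ * T := by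
  have ha : ∀ M N : Matrix X X ℂ, T' * M * T * (T' * N * T) = T' * (M * N) * T := by
    intro M N
    calc _ = T' * M * (T * T') * N * T := by simp only [Matrix.mul_assoc]
      _ = _ := by rw [h2, Matrix.mul_one]; simp only [Matrix.mul_assoc]
  have hp : 1 + T' * ξ * T = T' * (1 + ξ) * T := by
    rw [Matrix.mul_add, Matrix.add_mul, Matrix.mul_one, h1]
  have hm : 1 - T' * ξ * T = T' * (1 - ξ) * T := by
    rw [Matrix.mul_sub, Matrix.sub_mul, Matrix.mul_one, h1]
  have hd : (1 + T' * ξ * T).det = (1 + ξ).det := by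
    rw [hp, Matrix.det_conj_of_mul_eq_one h1 h2]
  have hu : IsUnit (1 + T' * ξ * T) := by
    rw [Matrix.isUnit_iff_isUnit_det, hd]
    exact isUnit_iff_ne_zero.2 hdet
  apply hu.mul_right_cancel
  rw [cayleyNum_mul, hd]
  rw [hp, ha, cayleyNum_mul, hm, Matrix.mul_smul, Matrix.smul_mul]

theorem map_eval_X_smul {I : Type*} (B : Matrix I I ℂ) (z : ℂ) :
    ((Polynomial.X : Polynomial ℂ) • B.map Polynomial.C).map (Polynomial.evalRingHom z) =
      z • B := by
  ext i j
  simp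
  ring

theorem map_eval_add_X_smul {I : Type*} (A B : Matrix I I ℂ) (z : ℂ) :
    (A.map Polynomial.C + (Polynomial.X : Polynomial ℂ) • B.map Polynomial.C).map
      (Polynomial.evalRingHom z) = A + z • B := by
  ext i j
  simp
  ring

theorem infinite_image_ofReal_Icc {δ : ℝ} (hδ : 0 < δ) :
    ((fun x : ℝ => (x : ℂ)) '' Set.Icc 0 δ).Infinite :=
  (Set.Icc_infinite hδ).image Complex.ofReal_injective.injOn

end Density

/-! ### Passing from the identity component to complex Cayley transforms -/

section DensityReal

variable {F : Type*} [Field F] [NumberField F] [IsGalois ℚ F] {N n m : ℕ} {α : Fin N → F}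
  (ι : F →ₐ[ℚ] ℝ) {κ : Type*} [Fintype κ] [DecidableEq κ]

/-- For small s the Cayley transforms of sξ lie in the identity component; the relation is
polynomial in s and extends to s = 1, whether or not 1 + ξ is invertible. -/
theorem kron_cayleyNum_real (hα : ∀ (τ : F ≃ₐ[ℚ] F) j, ι (τ (α j)) ≠ 0) (σ : κ ≃ (F ≃ₐ[ℚ] F))
    {T : κ → Matrix (Fin N) (Fin (n + 1) ⊕ Fin (n + 1)) ℂ}
    {T' : κ → Matrix (Fin (n + 1) ⊕ Fin (n + 1)) (Fin N) ℂ} (h1 : ∀ k, T' k * T k = 1)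
    (h2 : ∀ k, T k * T' k = 1)
    (Λ : Matrix (κ → Fin m × Fin (n + 1) → Fin (n + 1) ⊕ Fin (n + 1))
      (κ → Fin m × Fin (n + 1) → Fin (n + 1) ⊕ Fin (n + 1)) ℂ →ₗ[ℂ] ℂ)
    (hΛ : ∀ g : RealPointsId α, Λ (kron fun k => tensorPow n m (T' k *
      (g.1.1 : Matrix (Fin N) (Fin N) (ℝ ⊗[ℚ] F)).map
        (Complex.ofRealHom.comp (place ι (σ k)).toRingHom) * T k)) = 0)
    (ξ : κ → Matrix (Fin N) (Fin N) ℝ)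
    (hξ : ∀ k, (ξ k)ᵀ * Matrix.diagonal (fun j => ι (σ k (α j))) =
      -(Matrix.diagonal (fun j => ι (σ k (α j))) * ξ k)) :
    Λ (kron fun k => tensorPow n m (cayleyNum (T' k * (ξ k).map Complex.ofRealHom * T k))) = 0 := by
  obtain ⟨δ, hδ, hg⟩ := exists_cayley_mem_component ι hα (ξ := fun τ => ξ (σ.symm τ)) (by
    intro τ
    have := hξ (σ.symm τ)
    rwa [σ.apply_symm_apply] at this)
  have key := forall_eq_zero_of_infinite Λ
    (fun k => cayleyNum ((Polynomial.X : Polynomial ℂ) •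
      (T' k * (ξ k).map Complex.ofRealHom * T k).map Polynomial.C))
    (infinite_image_ofReal_Icc hδ) ?_ 1
  · simpa only [cayleyNum_map, map_eval_X_smul, one_smul] using key
  · rintro _ ⟨s, hs, rfl⟩
    obtain ⟨g, hg⟩ := hg s hs
    have hgk : ∀ k, T' k * (g.1.1 : Matrix (Fin N) (Fin N) (ℝ ⊗[ℚ] F)).map
        (Complex.ofRealHom.comp (place ι (σ k)).toRingHom) * T k =
        ((1 + s • ξ k).det⁻¹ : ℂ) • (cayleyNum ((Polynomial.X : Polynomial ℂ) •
      (T' k * (ξ k).map Complex.ofRealHom * T k).map Polynomial.C)).map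
        (Polynomial.evalRingHom (s : ℂ)) := by
      intro k
      obtain ⟨hne, hgm⟩ := hg (σ k)
      rw [σ.symm_apply_apply] at hne hgm
      have h3 : (g.1.1 : Matrix (Fin N) (Fin N) (ℝ ⊗[ℚ] F)).map
          (Complex.ofRealHom.comp (place ι (σ k)).toRingHom) =
          ((1 + s • ξ k).det⁻¹ : ℂ) • cayleyNum ((s • ξ k).map Complex.ofRealHom) := by
        have h4 := congrArg (fun M => Matrix.map M Complex.ofRealHom) hgm
        rw [← cayleyNum_map]
        refine Eq.trans ?_ (h4.trans ?_)
        · ext i j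
          rfl
        · ext i j
          simp
      have h5 : (1 + (s • ξ k).map Complex.ofRealHom).det ≠ 0 := by
        have h6 : 1 + (s • ξ k).map Complex.ofRealHom =
            Complex.ofRealHom.mapMatrix (1 + s • ξ k) := by
          rw [map_add, map_one]
          rfl
        rw [h6, ← RingHom.map_det]
        exact Complex.ofReal_ne_zero.2 hne
      rw [h3, Matrix.mul_smul, Matrix.smul_mul, ← cayleyNum_conj (h1 k) (h2 k) h5, cayleyNum_map,
        map_eval_X_smul]
      have h7 : (s • ξ k).map Complex.ofRealHom = (s : ℂ) • (ξ k).map Complex.ofRealHom := by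
        ext
        simp
      rw [h7, Matrix.mul_smul, Matrix.smul_mul]
    have hz := hΛ g
    simp only [hgk, tensorPow_smul] at hz
    rw [kron_smul (fun k => ((1 + s • ξ k).det⁻¹ : ℂ) ^ (m * (n + 1))), map_smul, smul_eq_mul] at hz
    -- By homogeneity the denominators only contribute a nonzero scalar.
    refine (mul_eq_zero.1 hz).resolve_left (Finset.prod_ne_zero_iff.2 fun k _ => ?_)
    obtain ⟨hne, -⟩ := hg (σ k)
    rw [σ.symm_apply_apply] at hne
    exact pow_ne_zero _ (inv_ne_zero (Complex.ofReal_ne_zero.2 hne))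

/-- A linear relation between the matrix coefficients of the identity component holds on the
Cayley transforms of all complex skew matrices. -/
theorem kron_cayleyNum_complex (hα : ∀ (τ : F ≃ₐ[ℚ] F) j, ι (τ (α j)) ≠ 0)
    (σ : κ ≃ (F ≃ₐ[ℚ] F))
    {T : κ → Matrix (Fin N) (Fin (n + 1) ⊕ Fin (n + 1)) ℂ}
    {T' : κ → Matrix (Fin (n + 1) ⊕ Fin (n + 1)) (Fin N) ℂ} (h1 : ∀ k, T' k * T k = 1)
    (h2 : ∀ k, T k * T' k = 1)
    (hT : ∀ k, (T k)ᵀ * Matrix.diagonal (fun j => (ι (σ k (α j)) : ℂ)) * T k =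
      (2 : ℂ) • splitForm n ℂ)
    (Λ : Matrix (κ → Fin m × Fin (n + 1) → Fin (n + 1) ⊕ Fin (n + 1))
      (κ → Fin m × Fin (n + 1) → Fin (n + 1) ⊕ Fin (n + 1)) ℂ →ₗ[ℂ] ℂ)
    (hΛ : ∀ g : RealPointsId α, Λ (kron fun k => tensorPow n m (T' k *
      (g.1.1 : Matrix (Fin N) (Fin N) (ℝ ⊗[ℚ] F)).map
        (Complex.ofRealHom.comp (place ι (σ k)).toRingHom) * T k)) = 0)
    (η : κ → Matrix (Fin (n + 1) ⊕ Fin (n + 1)) (Fin (n + 1) ⊕ Fin (n + 1)) ℂ)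
    (hη : ∀ k, (η k)ᵀ * splitForm n ℂ = -(splitForm n ℂ * η k)) :
    Λ (kron fun k => tensorPow n m (cayleyNum (η k))) = 0 := by
  set A : κ → Matrix (Fin N) (Fin N) ℂ := fun k =>
    Matrix.diagonal fun j => (ι (σ k (α j)) : ℂ) with hA
  let Z : κ → Matrix (Fin N) (Fin N) ℂ := fun k => T k * η k * T' k
  have hZ : ∀ k, (Z k)ᵀ * A k = -(A k * Z k) := by
    intro k
    have e1 : (T k)ᵀ * A k = (2 : ℂ) • (splitForm n ℂ * T' k) := by
      calc (T k)ᵀ * A k = (T k)ᵀ * A k * (T k * T' k) := by rw [h2, Matrix.mul_one]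
        _ = _ := by rw [← Matrix.mul_assoc, hT, Matrix.smul_mul]
    have e2 : A k * T k = (2 : ℂ) • ((T' k)ᵀ * splitForm n ℂ) := by
      have h3 : (T' k)ᵀ * (T k)ᵀ = 1 := by rw [← Matrix.transpose_mul, h2, Matrix.transpose_one]
      calc A k * T k = (T' k)ᵀ * (T k)ᵀ * (A k * T k) := by rw [h3, Matrix.one_mul]
        _ = (T' k)ᵀ * ((T k)ᵀ * A k * T k) := by simp only [Matrix.mul_assoc]
        _ = _ := by rw [hT, Matrix.mul_smul]
    calc (Z k)ᵀ * A k = (T' k)ᵀ * (η k)ᵀ * ((T k)ᵀ * A k) := by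
          simp only [Z, Matrix.transpose_mul, Matrix.mul_assoc]
      _ = (2 : ℂ) • ((T' k)ᵀ * ((η k)ᵀ * splitForm n ℂ) * T' k) := by
          rw [e1, Matrix.mul_smul]; simp only [Matrix.mul_assoc]
      _ = -(A k * T k * (η k * T' k)) := by
          rw [hη, e2]
          simp only [Matrix.smul_mul, Matrix.mul_neg, Matrix.neg_mul, Matrix.mul_assoc, smul_neg]
      _ = _ := by simp only [Z, Matrix.mul_assoc]
  have hentry : ∀ k i j, Z k j i * (ι (σ k (α j)) : ℂ) = -((ι (σ k (α i)) : ℂ) * Z k i j) := by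
    intro k i j
    have := congrFun (congrFun (hZ k) i) j
    simpa [hA, Matrix.mul_diagonal, Matrix.diagonal_mul] using this
  -- The form has real coefficients, so real and imaginary parts of a complex skew matrix are again
  -- skew. The relation holds for X + tX' with real t, is polynomial in t, and is evaluated at t =
  -- i.
  let X : κ → Matrix (Fin N) (Fin N) ℝ := fun k => (Z k).map Complex.re
  let X' : κ → Matrix (Fin N) (Fin N) ℝ := fun k => (Z k).map Complex.im
  have hX : ∀ (t : ℝ) k, (X k + t • X' k)ᵀ * Matrix.diagonal (fun j => ι (σ k (α j))) =
      -(Matrix.diagonal (fun j => ι (σ k (α j))) * (X k + t • X' k)) := by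
    intro t k
    ext i j
    have hre := congrArg Complex.re (hentry k i j)
    have him := congrArg Complex.im (hentry k i j)
    simp only [Complex.re_mul_ofReal, Complex.im_mul_ofReal, Complex.neg_re, Complex.neg_im,
      Complex.re_ofReal_mul, Complex.im_ofReal_mul] at hre him
    simp only [Matrix.mul_diagonal, Matrix.diagonal_mul, Matrix.neg_apply, Matrix.transpose_apply,
      Matrix.add_apply, Matrix.smul_apply, smul_eq_mul, X, X', Matrix.map_apply]
    linear_combination hre + t * him
  have key := forall_eq_zero_of_infinite Λ
    (fun k => cayleyNum ((T' k * (X k).map Complex.ofRealHom * T k).map Polynomial.C +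
      (Polynomial.X : Polynomial ℂ) •
        (T' k * (X' k).map Complex.ofRealHom * T k).map Polynomial.C))
    (infinite_image_ofReal_Icc one_pos) ?_ Complex.I
  · simp only [cayleyNum_map, map_eval_add_X_smul] at key
    refine Eq.trans (congrArg (fun f => Λ (kron f)) (funext fun k => ?_)) key
    congr 2
    have h3 : Z k = (X k).map Complex.ofRealHom + Complex.I • (X' k).map Complex.ofRealHom := by
      ext i j
      simp only [Matrix.add_apply, Matrix.smul_apply, Matrix.map_apply, X, X', smul_eq_mul]
      rw [mul_comm]
      exact (Complex.re_add_im _).symm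
    have h4 : η k = T' k * Z k * T k := by
      calc η k = (T' k * T k) * η k * (T' k * T k) := by
            rw [h1, Matrix.one_mul, Matrix.mul_one]
        _ = _ := by simp only [Z, Matrix.mul_assoc]
    rw [h4, h3, Matrix.mul_add, Matrix.add_mul, Matrix.mul_smul, Matrix.smul_mul]
  · rintro _ ⟨t, -, rfl⟩
    have h5 := kron_cayleyNum_real ι hα σ h1 h2 Λ hΛ (fun k => X k + t • X' k) (hX t)
    simp only [cayleyNum_map, map_eval_add_X_smul]
    refine Eq.trans (congrArg (fun f => Λ (kron f)) (funext fun k => ?_)) h5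
    congr 2
    have h3 : (X k + t • X' k).map Complex.ofRealHom =
        (X k).map Complex.ofRealHom + (t : ℂ) • (X' k).map Complex.ofRealHom := by
      ext i j
      simp
    rw [h3, Matrix.mul_add, Matrix.add_mul, Matrix.mul_smul, Matrix.smul_mul]

end DensityReal

end ArithSO

end

noncomputable section

open scoped Matrix

namespace ArithSO

/-! ### The cyclic vector of the big cell -/

section Cyclic

variable {n m r : ℕ} {κ : Type*} [Fintype κ] [DecidableEq κ]

/-- The block scalar matrix `diag(2, 1/2)`. -/
def torusElt (n : ℕ) : Matrix (Fin (n + 1) ⊕ Fin (n + 1)) (Fin (n + 1) ⊕ Fin (n + 1)) ℂ :=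
  Matrix.diagonal fun x => ((Sum.elim (fun _ => 2) (fun _ => 1 / 2) x : ℝ) : ℂ)

theorem torusElt_eq_cayley (n : ℕ) :
    ∃ (η : Matrix (Fin (n + 1) ⊕ Fin (n + 1)) (Fin (n + 1) ⊕ Fin (n + 1)) ℂ) (c : ℂ),
      ηᵀ * splitForm n ℂ = -(splitForm n ℂ * η) ∧ c ≠ 0 ∧ cayleyNum η = c • torusElt n := by
  -- The scalar Cayley transform (1 - d)/(1 + d) sends -1/3 to 2 and 1/3 to 1/2.
  let d : Fin (n + 1) ⊕ Fin (n + 1) → ℂ := Sum.elim (fun _ => -1 / 3) fun _ => 1 / 3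
  have hp : 1 + Matrix.diagonal d = Matrix.diagonal fun x => 1 + d x := by
    rw [← Matrix.diagonal_one, Matrix.diagonal_add]
  have hm : 1 - Matrix.diagonal d = Matrix.diagonal fun x => 1 - d x := by
    rw [← Matrix.diagonal_one, Matrix.diagonal_sub]
  have hne : ∀ x, 1 + d x ≠ 0 := by
    rintro (x | x) <;> simp [d] <;> norm_num
  have hdet : (1 + Matrix.diagonal d).det ≠ 0 := by
    rw [hp, Matrix.det_diagonal]
    exact Finset.prod_ne_zero_iff.2 fun x _ => hne x
  refine ⟨Matrix.diagonal d, (1 + Matrix.diagonal d).det, ?_, hdet, ?_⟩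
  · have h1 : Matrix.diagonal d = Matrix.fromBlocks (Matrix.diagonal fun _ => -1 / 3) 0 0
        (Matrix.diagonal fun _ => 1 / 3) := (Matrix.fromBlocks_diagonal _ _).symm
    rw [Matrix.diagonal_transpose, h1, splitForm, Matrix.fromBlocks_multiply,
      Matrix.fromBlocks_multiply, Matrix.fromBlocks_neg]
    congr 1 <;> ext j l <;> by_cases hjl : j = l <;> simp [hjl] <;> norm_num
  · have hu : IsUnit (1 + Matrix.diagonal d) := by
      rw [Matrix.isUnit_iff_isUnit_det]
      exact isUnit_iff_ne_zero.2 hdet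
    apply hu.mul_right_cancel
    rw [cayleyNum_mul, Matrix.smul_mul]
    congr 1
    rw [hm, hp, torusElt, Matrix.diagonal_mul_diagonal]
    congr 1
    ext x
    rcases x with x | x <;> simp [d] <;> norm_num

/-- Here η² = 0, so the Cayley transform is the unipotent 1 - 2η. These elements move the base point
A = 0 to every point of the cell, which makes its vector cyclic. -/
theorem unipotent_eq_cayley {A : Matrix (Fin (n + 1)) (Fin (n + 1)) ℂ} (hA : Aᵀ = -A) :
    ∃ η : Matrix (Fin (n + 1) ⊕ Fin (n + 1)) (Fin (n + 1) ⊕ Fin (n + 1)) ℂ,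
      ηᵀ * splitForm n ℂ = -(splitForm n ℂ * η) ∧ cayleyNum η * cell (0 : Matrix (Fin (n + 1)) (Fin (n + 1)) ℂ) = cell A := by
  set η : Matrix (Fin (n + 1) ⊕ Fin (n + 1)) (Fin (n + 1) ⊕ Fin (n + 1)) ℂ :=
    Matrix.fromBlocks 0 0 (-((1 / 2 : ℂ) • A)) 0 with hη
  have hηη : η * η = 0 := by
    rw [hη, Matrix.fromBlocks_multiply]
    simp
  have h1 : (1 + η) * (1 - η) = 1 := by
    calc (1 + η) * (1 - η) = 1 - η * η := by noncomm_ring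
      _ = 1 := by rw [hηη, sub_zero]
  have hdet : (1 + η).det = 1 := by
    have h2 : 1 + η = Matrix.fromBlocks 1 0 (-((1 / 2 : ℂ) • A)) 1 := by
      rw [hη, ← Matrix.fromBlocks_one, Matrix.fromBlocks_add]
      simp
    rw [h2, Matrix.det_fromBlocks_zero₁₂, Matrix.det_one, mul_one]
  have h3 : cayleyNum η = 1 - (2 : ℂ) • η := by
    have h4 : IsUnit (1 + η) := IsUnit.of_mul_eq_one _ h1
    apply h4.mul_right_cancel
    rw [cayleyNum_mul, hdet, one_smul, two_smul]
    calc 1 - η = 1 - η - η * η - η * η := by rw [hηη, sub_zero, sub_zero]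
      _ = _ := by noncomm_ring
  refine ⟨η, ?_, ?_⟩
  · rw [hη, splitForm, Matrix.fromBlocks_transpose, Matrix.fromBlocks_multiply,
      Matrix.fromBlocks_multiply, Matrix.fromBlocks_neg]
    simp [hA]
  · have h5 : 1 - (2 : ℂ) • η = Matrix.fromBlocks 1 0 A 1 := by
      rw [hη, ← Matrix.fromBlocks_one, Matrix.fromBlocks_smul, sub_eq_add_neg,
        Matrix.fromBlocks_neg, Matrix.fromBlocks_add]
      simp [smul_smul]
    rw [h3, h5, cell, cell, Matrix.fromBlocks_mul_fromRows]
    simp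

theorem kron_mulVec_frameVec (M : κ → Matrix (Fin (n + 1) ⊕ Fin (n + 1))
      (Fin (n + 1) ⊕ Fin (n + 1)) ℂ)
    (l : κ → Matrix (Fin (n + 1) ⊕ Fin (n + 1)) (Fin (n + 1)) ℂ) :
    (kron fun k => tensorPow n m (M k)) *ᵥ (fun x => ∏ k, frameVec m (l k) (x k)) =
      fun x => ∏ k, frameVec m (M k * l k) (x k) := by
  rw [kron_mulVec]
  simp only [tensorPow_mulVec_frameVec]

theorem kron_torusElt {κ : Type*} [Fintype κ] :
    (kron fun _ : κ => tensorPow n m (torusElt n)) = Matrix.diagonal fun x =>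
      ((∏ k, ∏ s, Sum.elim (fun _ => 2) (fun _ => 1 / 2) (x k s) : ℝ) : ℂ) := by
  ext x y
  simp only [kron_apply, tensorPow, torusElt]
  by_cases hxy : x = y
  · subst hxy
    simp
  · rw [Matrix.diagonal_apply_ne _ hxy]
    obtain ⟨k, hk⟩ := Function.ne_iff.1 hxy
    obtain ⟨s, hs⟩ := Function.ne_iff.1 hk
    refine Finset.prod_eq_zero (Finset.mem_univ k) (Finset.prod_eq_zero (Finset.mem_univ s) ?_)
    exact Matrix.diagonal_apply_ne _ hs

theorem torusElt_mul_cell : torusElt n * cell (0 : Matrix (Fin (n + 1)) (Fin (n + 1)) ℂ) =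
    cell (0 : Matrix (Fin (n + 1)) (Fin (n + 1)) ℂ) * Matrix.diagonal (fun _ : Fin (n + 1) => (2 : ℂ)) := by
  have h : torusElt n = Matrix.fromBlocks (Matrix.diagonal fun _ => 2) 0 0
      (Matrix.diagonal fun _ => 1 / 2) := by
    rw [torusElt, Matrix.fromBlocks_diagonal]
    congr 1
    ext x
    rcases x with x | x <;> simp
  rw [h, cell, Matrix.fromBlocks_mul_fromRows, Matrix.fromRows_mul]
  simp

/-- The torus acts diagonally, by 2 on each left index and by 1/2 on each right one; the extremal
eigenvalue occurs only when all indices are left. -/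
theorem eq_zero_of_torus_eigenvector
    {w : (κ → Fin m × Fin (n + 1) → Fin (n + 1) ⊕ Fin (n + 1)) → ℂ}
    (hw : (kron fun _ : κ => tensorPow n m (torusElt n)) *ᵥ w =
      (∏ _k : κ, (2 : ℂ) ^ ((n + 1) * m)) • w)
    {x : κ → Fin m × Fin (n + 1) → Fin (n + 1) ⊕ Fin (n + 1)} {k : κ} {s : Fin m × Fin (n + 1)}
    (hx : (x k s).isRight) : w x = 0 := by
  have h := congrFun hw x
  rw [kron_torusElt, Matrix.mulVec_diagonal, Pi.smul_apply, smul_eq_mul] at h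
  by_contra hne
  have h1 := mul_right_cancel₀ hne h
  have h2 : (∏ k, ∏ s, Sum.elim (fun _ => 2) (fun _ => 1 / 2) (x k s) : ℝ) =
      ∏ k : κ, ∏ s : Fin m × Fin (n + 1), (2 : ℝ) := by
    have h3 : ∏ k : κ, ∏ s : Fin m × Fin (n + 1), (2 : ℝ) = ∏ _k : κ, (2 : ℝ) ^ ((n + 1) * m) := by
      simp [mul_comm]
    rw [h3]
    exact_mod_cast h1
  have hpos : ∀ y : Fin (n + 1) ⊕ Fin (n + 1),
      (0 : ℝ) < Sum.elim (fun _ => 2) (fun _ => 1 / 2) y := by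
    rintro (y | y) <;> simp
  have hle : ∀ y : Fin (n + 1) ⊕ Fin (n + 1),
      (Sum.elim (fun _ => 2) (fun _ => 1 / 2) y : ℝ) ≤ 2 := by
    rintro (y | y) <;> simp
    norm_num
  have hlt : (Sum.elim (fun _ => 2) (fun _ => 1 / 2) (x k s) : ℝ) < 2 := by
    obtain ⟨y, hy⟩ := Sum.isRight_iff.1 hx
    rw [hy]
    norm_num
  refine absurd h2 (ne_of_lt ?_)
  refine Finset.prod_lt_prod (fun k _ => Finset.prod_pos fun s _ => hpos _)
    (fun k _ => Finset.prod_le_prod (fun s _ => (hpos _).le) fun s _ => hle _)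
    ⟨k, Finset.mem_univ _, ?_⟩
  exact Finset.prod_lt_prod (fun s _ => hpos _) (fun s _ => hle _) ⟨s, Finset.mem_univ _, hlt⟩

/-- Left indices see only the upper block, so each of the `m` factors is a multiple of its
determinant; one factor is needed, hence m > 0. -/
theorem frameVec_eq_zero_of_det_eq_zero (hm : 0 < m)
    {l : Matrix (Fin (n + 1) ⊕ Fin (n + 1)) (Fin (n + 1)) ℂ} (hl : l.toRows₁.det = 0)
    {x : Fin m × Fin (n + 1) → Fin (n + 1) ⊕ Fin (n + 1)} (hx : ∀ s, ¬ (x s).isRight) :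
    frameVec m l x = 0 := by
  refine Finset.prod_eq_zero (Finset.mem_univ ⟨0, hm⟩) ?_
  have hx' : ∀ s, ∃ y, x s = Sum.inl y := fun s => by
    have := hx s
    rwa [Sum.not_isRight, Sum.isLeft_iff] at this
  choose y hy using hx'
  have h : l.submatrix (fun a => x (⟨0, hm⟩, a)) id =
      (1 : Matrix (Fin (n + 1)) (Fin (n + 1)) ℂ).submatrix (fun a => y (⟨0, hm⟩, a)) id *
        l.toRows₁ := by
    ext i j
    simp [Matrix.mul_apply, hy, Matrix.one_apply]
  rw [h, Matrix.det_mul, hl, mul_zero]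

/-- A highest weight argument: an operator commuting with the torus keeps the cyclic vector in the
extremal weight space, yet its image lies in the span of P times the cell, whose extremal
coordinates vanish. Hence it kills the cyclic vector and, by commuting with unipotents, all of the
cell. -/
theorem mul_kron_vecs_eq_zero (b : CellBasis n m r) (hm : 0 < m)
    (P : κ → Matrix (Fin (n + 1) ⊕ Fin (n + 1)) (Fin (n + 1) ⊕ Fin (n + 1)) ℂ) (k₀ : κ)
    (hP : ∀ A : Matrix (Fin (n + 1)) (Fin (n + 1)) ℂ, Aᵀ = -A → (P k₀ * cell A).toRows₁.det = 0)
    (Φ : Matrix (κ → Fin r) (κ → Fin m × Fin (n + 1) → Fin (n + 1) ⊕ Fin (n + 1)) ℂ)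
    (hΦ : ∀ η : κ → Matrix (Fin (n + 1) ⊕ Fin (n + 1)) (Fin (n + 1) ⊕ Fin (n + 1)) ℂ,
      (∀ k, (η k)ᵀ * splitForm n ℂ = -(splitForm n ℂ * η k)) →
      Commute ((kron fun k => tensorPow n m (P k)) * ((kron fun _ : κ => b.vecs ℂ) * Φ))
        (kron fun k => tensorPow n m (cayleyNum (η k)))) :
    (kron fun k => tensorPow n m (P k)) * ((kron fun _ : κ => b.vecs ℂ) * Φ) *
      (kron fun _ : κ => b.vecs ℂ) = 0 := by
  set Ψ := (kron fun k => tensorPow n m (P k)) * ((kron fun _ : κ => b.vecs ℂ) * Φ) with hΨ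
  set v : (κ → Matrix (Fin (n + 1)) (Fin (n + 1)) ℂ) →
    (κ → Fin m × Fin (n + 1) → Fin (n + 1) ⊕ Fin (n + 1)) → ℂ :=
    fun A x => ∏ k, frameVec m (cell (A k)) (x k) with hv
  have hskew : ∀ i, ((b.pt i).map (algebraMap ℚ ℂ))ᵀ = -(b.pt i).map (algebraMap ℚ ℂ) := by
    intro i
    rw [← Matrix.transpose_map, b.skew, Matrix.map_neg _ (map_neg _)]
  have h0 : Ψ *ᵥ v (fun _ => 0) = 0 := by
    obtain ⟨η, c, hη, hc, hηc⟩ := torusElt_eq_cayley n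
    have hcomm := hΦ (fun _ => η) fun _ => hη
    simp only [hηc, tensorPow_smul] at hcomm
    rw [kron_smul (fun _ : κ => c ^ (m * (n + 1)))] at hcomm
    have hc' : (∏ _k : κ, c ^ (m * (n + 1))) ≠ 0 :=
      Finset.prod_ne_zero_iff.2 fun _ _ => pow_ne_zero _ hc
    have hcomm' : Ψ * (kron fun _ : κ => tensorPow n m (torusElt n)) =
        (kron fun _ : κ => tensorPow n m (torusElt n)) * Ψ := by
      have h1 := hcomm.eq
      rw [Matrix.mul_smul, Matrix.smul_mul] at h1
      exact smul_right_injective _ hc' h1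
    have heig : (kron fun _ : κ => tensorPow n m (torusElt n)) *ᵥ v (fun _ => 0) =
        (∏ _k : κ, (2 : ℂ) ^ ((n + 1) * m)) • v (fun _ => 0) := by
      rw [hv, kron_mulVec_frameVec]
      ext x
      simp only [torusElt_mul_cell, frameVec_mul_right, Matrix.det_diagonal, Finset.prod_const,
        Finset.card_univ, Fintype.card_fin, Pi.smul_apply, smul_eq_mul, Finset.prod_mul_distrib,
        ← pow_mul]
    have hw : (kron fun _ : κ => tensorPow n m (torusElt n)) *ᵥ (Ψ *ᵥ v fun _ => 0) =
        (∏ _k : κ, (2 : ℂ) ^ ((n + 1) * m)) • (Ψ *ᵥ v fun _ => 0) := by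
      rw [Matrix.mulVec_mulVec, ← hcomm', ← Matrix.mulVec_mulVec, heig, Matrix.mulVec_smul]
    -- A coordinate with some right index vanishes by the torus weight; one with only left indices
    -- vanishes by `hP` at the factor `k₀`.
    ext x
    by_cases hx : ∃ k s, (x k s).isRight
    · obtain ⟨k, s, hks⟩ := hx
      exact eq_zero_of_torus_eigenvector hw hks
    · push Not at hx
      rw [hΨ, ← Matrix.mul_assoc, kron_mul, ← Matrix.mulVec_mulVec]
      refine Finset.sum_eq_zero fun i _ => ?_
      refine mul_eq_zero_of_left ?_ _
      refine Finset.prod_eq_zero (Finset.mem_univ k₀) ?_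
      have h2 := tensorPow_mulVec_frameVec (m := m) (P k₀)
        (cell ((b.pt (i k₀)).map (algebraMap ℚ ℂ)))
      refine (congrFun h2 (x k₀)).trans ?_
      exact frameVec_eq_zero_of_det_eq_zero hm (hP _ (hskew _)) fun s => by simpa using hx k₀ s
  have hA : ∀ A : κ → Matrix (Fin (n + 1)) (Fin (n + 1)) ℂ, (∀ k, (A k)ᵀ = -A k) →
      Ψ *ᵥ v A = 0 := by
    intro A hA
    choose η hη hηA using fun k => unipotent_eq_cayley (hA k)
    have h1 : v A = (kron fun k => tensorPow n m (cayleyNum (η k))) *ᵥ v fun _ => 0 := by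
      rw [hv, kron_mulVec_frameVec]
      simp only [hηA]
    rw [h1, Matrix.mulVec_mulVec, (hΦ η hη).eq, ← Matrix.mulVec_mulVec, h0, Matrix.mulVec_zero]
  ext x i
  exact congrFun (hA (fun k => (b.pt (i k)).map (algebraMap ℚ ℂ)) fun k => hskew (i k)) x

end Cyclic

end ArithSO

end

noncomputable section

open scoped Matrix

namespace ArithSO

/-! ### The ambient tensor representation of the identity component -/

section Ambient

variable {F : Type*} [Field F] [NumberField F] {N n : ℕ} {α : Fin N → F}
  (ι : F →ₐ[ℚ] ℝ) {κ : Type*} [Fintype κ]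

open scoped Classical in
/-- The signs of the diagonal entries of the matrix that defines the Cartan involution. -/
def signAt (p : ℕ) (σ : F ≃ₐ[ℚ] F) (j : Fin N) : ℝ := if σ = 1 ∧ p ≤ (j : ℕ) then -1 else 1

theorem signAt_mul_self (p : ℕ) (σ : F ≃ₐ[ℚ] F) (j : Fin N) :
    signAt p σ j * signAt p σ j = 1 := by
  rw [signAt]
  split_ifs <;> norm_num

theorem prod_signAt_one {p q : ℕ} (hq : Odd q) :
    ∏ j : Fin (p + q), signAt p (1 : F ≃ₐ[ℚ] F) j = -1 := by
  rw [Fin.prod_univ_add]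
  have h1 : ∀ i : Fin p, signAt p (1 : F ≃ₐ[ℚ] F) (Fin.castAdd q i) = 1 := by
    intro i
    rw [signAt, if_neg]
    simp
  have h2 : ∀ i : Fin q, signAt p (1 : F ≃ₐ[ℚ] F) (Fin.natAdd p i) = -1 := by
    intro i
    rw [signAt, if_pos]
    simp
  simp only [h1, h2, Finset.prod_const, one_pow, one_mul, Finset.card_univ, Fintype.card_fin]
  exact hq.neg_one_pow

theorem map_place_mul_inv (σ : F ≃ₐ[ℚ] F) (g : RealPointsId α) :
    (g.1.1 : Matrix (Fin N) (Fin N) (ℝ ⊗[ℚ] F)).map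
        (Complex.ofRealHom.comp (place ι σ).toRingHom) *
      (g⁻¹.1.1 : Matrix (Fin N) (Fin N) (ℝ ⊗[ℚ] F)).map
        (Complex.ofRealHom.comp (place ι σ).toRingHom) = 1 := by
  have h : (g.1.1 : Matrix (Fin N) (Fin N) (ℝ ⊗[ℚ] F)) *
      (g⁻¹.1.1 : Matrix (Fin N) (Fin N) (ℝ ⊗[ℚ] F)) = 1 := by
    have h1 : g.1.1 * g⁻¹.1.1 = 1 := by
      rw [← Subgroup.coe_mul, ← Subgroup.coe_mul, mul_inv_cancel]
      rfl
    rw [← Matrix.SpecialLinearGroup.coe_mul, h1, Matrix.SpecialLinearGroup.coe_one]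
  rw [← Matrix.map_mul, h, Matrix.map_one _ (map_zero _) (map_one _)]

theorem map_place_mem_SO (σ : F ≃ₐ[ℚ] F) (g : RealPointsId α) :
    Matrix.SpecialLinearGroup.map (Complex.ofRealHom.comp (place ι σ).toRingHom) g.1.1 ∈
      SO fun j => (ι (σ (α j)) : ℂ) := by
  refine map_mem_SO _ (fun j => ?_) g.1.2
  change ((place ι σ ((1 : ℝ) ⊗ₜ[ℚ] α j) : ℝ) : ℂ) = _
  rw [place_tmul, one_mul]

variable (ε : Fin (n + 1) ⊕ Fin (n + 1) ≃ Fin N) (σ : κ → F ≃ₐ[ℚ] F) (im : ℂ)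
  (u : κ → Fin N → ℂ) (m : ℕ)

/-- The action of the identity component on the ambient tensor space. -/
def ambient (g : RealPointsId α) :
    Matrix (κ → Fin m × Fin (n + 1) → Fin (n + 1) ⊕ Fin (n + 1))
      (κ → Fin m × Fin (n + 1) → Fin (n + 1) ⊕ Fin (n + 1)) ℂ :=
  kron fun k => tensorPow n m
    (realConj ι (σ k) ε im (u k) (fun j => ι (σ k (α j))) g.1.1)

variable {ε σ im u m}

/-- The columns of `vecs` intertwine the cell representation with the ambient tensors, where
adjoints are visible. -/
theorem vecs_mul_rep_realConj [DecidableEq κ] {r : ℕ} (b : CellBasis n m r) (him : im * im = -1)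
    (hu : ∀ k j, u k j * u k j * (ι (σ k (α j)) : ℂ) = 1) (g : RealPointsId α) :
    (kron fun _ : κ => b.vecs ℂ) * (kron fun k =>
        b.rep (realConj ι (σ k) ε im (u k) (fun j => ι (σ k (α j))) g.1.1)) =
      ambient ι ε σ im u m g * kron fun _ : κ => b.vecs ℂ := by
  rw [ambient, kron_mul, kron_mul]
  congr 1
  ext1 k
  apply CellBasis.Stable.vecs_mul_rep
  have hiso := mem_SO.1 (map_place_mem_SO ι (σ k) g)
  have hdet := (Matrix.SpecialLinearGroup.map
    (Complex.ofRealHom.comp (place ι (σ k)).toRingHom) g.1.1).det_coe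
  rw [Matrix.SpecialLinearGroup.map_apply_coe, RingHom.mapMatrix_apply] at hiso hdet
  have ha : ∀ j, IsUnit (ι (σ k (α j)) : ℂ) := fun j =>
    IsUnit.of_mul_eq_one_right _ (hu k j)
  exact b.stable_conj ha (hypBasisInv_mul him (hu k)) (hypBasis_mul_inv him (hu k))
    (hypBasis_gram him (hu k)) hiso hdet

theorem vecs_injective [DecidableEq κ] {r : ℕ} (b : CellBasis n m r) {v : (κ → Fin r) → ℂ}
    (hv : (kron fun _ : κ => b.vecs ℂ) *ᵥ v = 0) : v = 0 := by
  have h : (kron fun _ : κ => b.coords ℂ) * (kron fun _ : κ => b.vecs ℂ) = 1 := by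
    rw [kron_mul]
    simp only [b.coords_mul_vecs, kron_one]
  rw [← Matrix.one_mulVec v, ← h, ← Matrix.mulVec_mulVec, hv, Matrix.mulVec_zero]

variable [IsGalois ℚ F]

theorem place_signDiag (p : ℕ) (σ : F ≃ₐ[ℚ] F) (j : Fin N) :
    place ι σ (signDiag ι p j) = signAt p σ j :=
  place_placesEquiv_symm ι _ σ

theorem map_place_theta (p : ℕ) (σ : F ≃ₐ[ℚ] F) (g : RealPointsId α) :
    ((theta α ι p g).1.1 : Matrix (Fin N) (Fin N) (ℝ ⊗[ℚ] F)).map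
        (Complex.ofRealHom.comp (place ι σ).toRingHom) =
      Matrix.diagonal (fun j => (signAt p σ j : ℂ)) *
        (g.1.1 : Matrix (Fin N) (Fin N) (ℝ ⊗[ℚ] F)).map
          (Complex.ofRealHom.comp (place ι σ).toRingHom) *
        Matrix.diagonal fun j => (signAt p σ j : ℂ) := by
  have h1 : ((theta α ι p g).1.1 : Matrix (Fin N) (Fin N) (ℝ ⊗[ℚ] F)) =
      Matrix.diagonal (signDiag ι p) * (g.1.1 : Matrix (Fin N) (Fin N) (ℝ ⊗[ℚ] F)) *
        Matrix.diagonal (signDiag ι p) := rfl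
  have h2 : (Matrix.diagonal (signDiag (N := N) ι p)).map
      (Complex.ofRealHom.comp (place ι σ).toRingHom) =
      Matrix.diagonal fun j => (signAt p σ j : ℂ) := by
    rw [Matrix.diagonal_map (map_zero _)]
    congr 1
    ext j
    exact congrArg (fun x : ℝ => (x : ℂ)) (place_signDiag ι p σ j)
  rw [h1, Matrix.map_mul, Matrix.map_mul, h2]

/-- The hypothesis `hs` says that twisting by the signs of θ makes the form positive definite at
every place; this is what makes the adjoint of g act as θ(g⁻¹). -/
theorem ambient_conjTranspose (him : im * im = -1)
    (hu : ∀ k j, u k j * u k j * (ι (σ k (α j)) : ℂ) = 1) {p : ℕ}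
    (hs : ∀ k j, 0 < signAt p (σ k) j * ι (σ k (α j))) (g : RealPointsId α) :
    (ambient ι ε σ im u m g)ᴴ = ambient ι ε σ im u m (theta α ι p g⁻¹) := by
  have key : ∀ k, (realConj ι (σ k) ε im (u k) (fun j => ι (σ k (α j))) g.1.1)ᴴ =
      realConj ι (σ k) ε im (u k) (fun j => ι (σ k (α j))) (theta α ι p g⁻¹).1.1 := by
    intro k
    have hiso := mem_SO.1 (map_place_mem_SO ι (σ k) g)
    rw [Matrix.SpecialLinearGroup.map_apply_coe, RingHom.mapMatrix_apply] at hiso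
    have hreal : ((g.1.1 : Matrix (Fin N) (Fin N) (ℝ ⊗[ℚ] F)).map
        (Complex.ofRealHom.comp (place ι (σ k)).toRingHom)).map star =
        (g.1.1 : Matrix (Fin N) (Fin N) (ℝ ⊗[ℚ] F)).map
          (Complex.ofRealHom.comp (place ι (σ k)).toRingHom) := by
      ext i j
      exact Complex.conj_ofReal _
    have hinv := map_place_mul_inv ι (σ k) g
    rw [realConj, realConj, map_place_theta]
    generalize (g.1.1 : Matrix (Fin N) (Fin N) (ℝ ⊗[ℚ] F)).map
      (Complex.ofRealHom.comp (place ι (σ k)).toRingHom) = h at hiso hreal hinv ⊢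
    exact conjTranspose_hypConj him (hu k) (signAt_mul_self p (σ k)) (hs k) hreal hiso hinv
  rw [ambient, kron_conjTranspose, ambient]
  simp only [tensorPow_conjTranspose, key]

/-- On the ambient space θ is inner, being implemented by the signs, which need not have determinant
1; the cell span need not be preserved by them. -/
theorem signBlock_mul_ambient [DecidableEq κ] (him : im * im = -1)
    (hu : ∀ k j, u k j * u k j * (ι (σ k (α j)) : ℂ) = 1) (p : ℕ) (g : RealPointsId α) :
    (kron fun k => tensorPow n m (signBlock ε (signAt p (σ k)))) *
        ambient ι ε σ im u m (theta α ι p g) =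
      ambient ι ε σ im u m g * kron fun k => tensorPow n m (signBlock ε (signAt p (σ k))) := by
  rw [ambient, ambient, kron_mul, kron_mul]
  congr 1
  ext1 k
  rw [← tensorPow_mul, ← tensorPow_mul]
  congr 1
  rw [realConj, realConj, map_place_theta]
  set T := hypBasis ε im (u k)
  set T' := hypBasisInv ε im (u k) fun j => (ι (σ k (α j)) : ℂ)
  set s := Matrix.diagonal fun j => (signAt p (σ k) j : ℂ)
  set P := signBlock ε (signAt p (σ k))
  set h := (g.1.1 : Matrix (Fin N) (Fin N) (ℝ ⊗[ℚ] F)).map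
    (Complex.ofRealHom.comp (place ι (σ k)).toRingHom)
  have h1 : T' * T = 1 := hypBasisInv_mul him (hu k)
  have h2 : T * T' = 1 := hypBasis_mul_inv him (hu k)
  have hsT : s * T = T * P := diagonal_mul_hypBasis
  have hss : s * s = 1 := by
    rw [Matrix.diagonal_mul_diagonal, ← Matrix.diagonal_one]
    congr 1
    ext j
    exact_mod_cast signAt_mul_self p (σ k) j
  have hPT : P * T' = T' * s := by
    calc P * T' = T' * T * P * T' := by rw [h1, Matrix.one_mul]
      _ = T' * (T * P) * T' := by simp only [Matrix.mul_assoc]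
      _ = T' * s * (T * T') := by rw [← hsT]; simp only [Matrix.mul_assoc]
      _ = _ := by rw [h2, Matrix.mul_one]
  calc P * (T' * (s * h * s) * T) = P * T' * s * h * (s * T) := by simp only [Matrix.mul_assoc]
    _ = T' * (s * s) * h * (T * P) := by rw [hPT, hsT]; simp only [Matrix.mul_assoc]
    _ = T' * h * T * P := by rw [hss, Matrix.mul_one]; simp only [Matrix.mul_assoc]

end Ambient

/-! ### Excluding constituents isomorphic to their conjugate under θ -/

section SelfConjugate

variable {F : Type*} [Field F] [NumberField F] [IsGalois ℚ F] {N n m r : ℕ} {α : Fin N → F}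
  {ι : F →ₐ[ℚ] ℝ} {κ : Type*} [Fintype κ] [DecidableEq κ]
  {ε : Fin (n + 1) ⊕ Fin (n + 1) ≃ Fin N} {σ : κ ≃ (F ≃ₐ[ℚ] F)} {im : ℂ} {u : κ → Fin N → ℂ}

/-- Each entry of a commutator with Ψ is a linear functional of the other matrix, so the density
statement applies entry by entry. -/
theorem commute_cayleyNum (him : im * im = -1)
    (hu : ∀ k j, u k j * u k j * (ι (σ k (α j)) : ℂ) = 1)
    {Ψ : Matrix (κ → Fin m × Fin (n + 1) → Fin (n + 1) ⊕ Fin (n + 1))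
      (κ → Fin m × Fin (n + 1) → Fin (n + 1) ⊕ Fin (n + 1)) ℂ}
    (hΨ : ∀ g : RealPointsId α, Commute Ψ (ambient ι ε σ im u m g))
    {η : κ → Matrix (Fin (n + 1) ⊕ Fin (n + 1)) (Fin (n + 1) ⊕ Fin (n + 1)) ℂ}
    (hη : ∀ k, (η k)ᵀ * splitForm n ℂ = -(splitForm n ℂ * η k)) :
    Commute Ψ (kron fun k => tensorPow n m (cayleyNum (η k))) := by
  have hα : ∀ (τ : F ≃ₐ[ℚ] F) j, ι (τ (α j)) ≠ 0 := by
    intro τ j h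
    have h1 := hu (σ.symm τ) j
    rw [σ.apply_symm_apply, h] at h1
    simp at h1
  rw [commute_iff_eq, ← sub_eq_zero]
  ext x y
  exact kron_cayleyNum_complex ι hα σ (fun k => hypBasisInv_mul him (hu k))
    (fun k => hypBasis_mul_inv him (hu k)) (fun k => hypBasis_gram him (hu k))
    (Matrix.entryLinearMap ℂ ℂ x y ∘ₗ (LinearMap.mulLeft ℂ Ψ - LinearMap.mulRight ℂ Ψ))
    (fun g => by
      have h := sub_eq_zero.2 (hΨ g).eq
      exact congrFun (congrFun h x) y) η hη

/-- An irreducible representation that embeds into the span of the big cell is not isomorphic to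
its conjugate under the Cartan involution. -/
theorem isEmpty_equiv_theta {W : Type*} [AddCommGroup W] [Module ℂ W] [Module.Finite ℂ W]
    (b : CellBasis n m r) (hm : 0 < m) (him : im * im = -1)
    (hu : ∀ k j, u k j * u k j * (ι (σ k (α j)) : ℂ) = 1) {p : ℕ}
    (hs : ∀ k j, 0 < signAt p (σ k) j * ι (σ k (α j)))
    (hodd : ∏ j : Fin N, signAt p (1 : F ≃ₐ[ℚ] F) j = -1)
    (τ : Representation ℂ (RealPointsId α) W) (hτ : τ.IsIrreducible)
    (f : W →ₗ[ℂ] ((κ → Fin r) → ℂ)) (hf : f ≠ 0)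
    (hfτ : ∀ g w, f (τ g w) = (kron fun k =>
      b.rep (realConj ι (σ k) ε im (u k) (fun j => ι (σ k (α j))) g.1.1)) *ᵥ f w) :
    IsEmpty (τ.Equiv (τ.comp (theta α ι p))) := by
  refine ⟨fun A => ?_⟩
  let B := kron fun _ : κ => b.vecs ℂ
  let f' : W →ₗ[ℂ] _ := B.mulVecLin ∘ₗ f
  have hf' : ∀ g w, f' (τ g w) = ambient ι ε σ im u m g *ᵥ f' w := by
    intro g w
    change B *ᵥ f (τ g w) = _ *ᵥ (B *ᵥ f w)
    rw [hfτ, Matrix.mulVec_mulVec, Matrix.mulVec_mulVec, vecs_mul_rep_realConj ι b him hu]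
  have hker : ∀ w, f' w = 0 → f w = 0 := fun w hw => vecs_injective b hw
  -- The kernel is a subrepresentation of an irreducible representation, and f is not zero.
  have hinj : Function.Injective f' := by
    let U : Subrepresentation τ := ⟨LinearMap.ker f', fun g w hw => by
      rw [LinearMap.mem_ker] at hw ⊢
      rw [hf', hw, Matrix.mulVec_zero]⟩
    have : IsSimpleOrder (Subrepresentation τ) := hτ
    rcases eq_bot_or_eq_top U with h | h
    · rw [← LinearMap.ker_eq_bot]
      exact congrArg Subrepresentation.toSubmodule h
    · exfalso
      apply hf
      ext1 w
      apply hker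
      have h1 : LinearMap.ker f' = ⊤ := congrArg Subrepresentation.toSubmodule h
      rw [← LinearMap.mem_ker, h1]
      exact Submodule.mem_top
  obtain ⟨R, hR, hRY⟩ := exists_equivariant_retraction τ (ambient ι ε σ im u m)
    (fun g => ⟨_, ambient_conjTranspose ι him hu hs g⟩) f' hinj hf'
  let A' : W →ₗ[ℂ] W := A.toLinearEquiv.toLinearMap
  have hA' : ∀ g w, A' (τ g w) = τ (theta α ι p g) (A' w) := fun g w =>
    LinearMap.congr_fun (A.isIntertwining' g) w
  -- Project the ambient space onto W, apply the supposed isomorphism, and embed again. The result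
  -- intertwines the action with its twist by θ, and multiplication by `P` removes the twist.
  let Φ := LinearMap.toMatrix' (f ∘ₗ A' ∘ₗ R)
  have hΦ : ∀ x, (B * Φ) *ᵥ x = f' (A' (R x)) := by
    intro x
    rw [← Matrix.mulVec_mulVec, ← Matrix.toLin'_apply Φ, Matrix.toLin'_toMatrix']
    rfl
  have hΦY : ∀ g, B * Φ * ambient ι ε σ im u m g =
      ambient ι ε σ im u m (theta α ι p g) * (B * Φ) := by
    intro g
    apply Matrix.toLin'.injective
    refine LinearMap.ext fun x => ?_
    rw [Matrix.toLin'_apply, Matrix.toLin'_apply, ← Matrix.mulVec_mulVec x (B * Φ),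
      ← Matrix.mulVec_mulVec x _ (B * Φ), hΦ, hΦ, hRY, hA', hf']
  let P := kron fun k => tensorPow n m (signBlock ε (signAt p (σ k)))
  have hPP : P * P = 1 := by
    simp only [P]
    rw [kron_mul]
    simp only [← tensorPow_mul, signBlock_mul_self (signAt_mul_self p _), tensorPow_one, kron_one]
  have hcomm : ∀ g : RealPointsId α, Commute (P * (B * Φ)) (ambient ι ε σ im u m g) := by
    intro g
    rw [commute_iff_eq, Matrix.mul_assoc, hΦY, ← Matrix.mul_assoc, signBlock_mul_ambient ι him hu,
      Matrix.mul_assoc]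
  -- The vanishing is fed in at the index of σ = 1, the only place where θ acts nontrivially and
  -- where the total sign is -1.
  have hzero := mul_kron_vecs_eq_zero b hm (fun k => signBlock ε (signAt p (σ k))) (σ.symm 1)
    (fun X hX => det_signBlock_mul_cell (signAt_mul_self p _)
      (by rw [σ.apply_symm_apply]; exact hodd) hX) Φ
    fun η hη => commute_cayleyNum him hu hcomm hη
  have hzero' : B * Φ * B = 0 := by
    have h1 : P * (P * (B * Φ) * B) = 0 := by
      rw [show P * (B * Φ) * B = 0 from hzero, Matrix.mul_zero]
    rwa [← Matrix.mul_assoc, ← Matrix.mul_assoc, hPP, Matrix.one_mul] at h1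
  have hA0 : ∀ w, A' w = 0 := by
    intro w
    apply hinj
    rw [map_zero]
    -- On the image of W the projection is the identity, so the vanishing reaches the isomorphism
    -- itself.
    have h1 : f' (A' (R (f' w))) = 0 := by
      rw [← hΦ]
      change _ *ᵥ (B *ᵥ f w) = 0
      rw [Matrix.mulVec_mulVec, hzero', Matrix.zero_mulVec]
    rwa [hR] at h1
  apply hf
  ext1 w
  have hAinj : Function.Injective A' := A.toLinearEquiv.injective
  have : w = 0 := hAinj ((hA0 w).trans (map_zero A').symm)
  rw [this, map_zero, map_zero]

end SelfConjugate

end ArithSO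

end

noncomputable section

open scoped Matrix

namespace ArithSO

/-! ### The complex constituents of the rational representations -/

section Constituents

variable {F : Type*} [Field F] [NumberField F] {N n m r : ℕ} {α : Fin N → F}
  {ι : F →ₐ[ℚ] ℝ} {κ E X : Type} [CommRing E] [Algebra ℚ E]
  {D : SplitData α κ E} {ε : Fin (n + 1) ⊕ Fin (n + 1) ≃ Fin N} {e : E →ₐ[ℚ] ℂ}

theorem SplitData.map_im_mul_im (D : SplitData α κ E) (e : E →ₐ[ℚ] ℂ) :
    e D.im * e D.im = -1 := by
  rw [← map_mul, D.im_mul_im, map_neg, map_one]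

theorem SplitData.map_root_mul {σ : κ → F ≃ₐ[ℚ] F}
    (hσ : ∀ k x, e (D.emb k x) = (ι (σ k x) : ℂ)) (k : κ) (j : Fin N) :
    e (D.root k j) * e (D.root k j) * (ι (σ k (α j)) : ℂ) = 1 := by
  rw [← hσ, ← map_mul, ← map_mul, D.root_mul, map_one]

variable [IsGalois ℚ F] [Fintype κ] [DecidableEq κ]

theorem isSemisimple_complexRep [Fintype X] [Module.Finite ℚ E] (b : CellBasis n m r)
    (e : X → E →ₐ[ℚ] ℂ) (he : ∀ z : ℂ ⊗[ℚ] E, (∀ i, Algebra.TensorProduct.lift (AlgHom.id ℂ ℂ) (e i)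
      (fun _ _ => Commute.all _ _) z = 0) → z = 0)
    (σ : X → κ → F ≃ₐ[ℚ] F) (hσ : ∀ i k x, e i (D.emb k x) = (ι (σ i k x) : ℂ)) {p : ℕ}
    (hs : ∀ (τ : F ≃ₐ[ℚ] F) j, 0 < signAt p τ j * ι (τ (α j))) :
    (D.rationalRep ε b).complexRep.IsSemisimpleRepresentation := by
  classical
  refine isSemisimple_of_adjoint_family _
    (fun i => ambient ι ε (σ i) (e i D.im) (fun k j => e i (D.root k j)) m)
    (fun g => ⟨theta α ι p g⁻¹, fun i => ambient_conjTranspose ι (D.map_im_mul_im (e i))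
      (SplitData.map_root_mul (hσ i)) (fun k j => hs _ j) g⟩)
    (fun i => (kron fun _ : κ => b.vecs ℂ).mulVecLin ∘ₗ evalColumns (e i)) ?_ ?_
  · intro v hv
    exact eq_zero_of_evalColumns e he v fun i => vecs_injective b (hv i)
  · intro i g v
    rw [LinearMap.comp_apply, LinearMap.comp_apply, Matrix.mulVecLin_apply,
      Matrix.mulVecLin_apply, D.evalColumns_complexRep ε b (e i) ι (σ i) (hσ i),
      Matrix.mulVec_mulVec, Matrix.mulVec_mulVec, vecs_mul_rep_realConj ι b (D.map_im_mul_im (e i))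
        (SplitData.map_root_mul (hσ i))]

/-- A nonzero intertwining map remains nonzero at one of the separating points of E, which gives a
nonzero equivariant map into a tensor product of cell spans. -/
theorem isEmpty_equiv_theta_of_multiplicity (b : CellBasis n m r) (hm : 0 < m)
    (e : X → E →ₐ[ℚ] ℂ) (he : ∀ z : ℂ ⊗[ℚ] E, (∀ i, Algebra.TensorProduct.lift (AlgHom.id ℂ ℂ) (e i)
      (fun _ _ => Commute.all _ _) z = 0) → z = 0)
    (σ : X → κ ≃ (F ≃ₐ[ℚ] F)) (hσ : ∀ i k x, e i (D.emb k x) = (ι (σ i k x) : ℂ)) {p : ℕ}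
    (hs : ∀ (τ : F ≃ₐ[ℚ] F) j, 0 < signAt p τ j * ι (τ (α j)))
    (hodd : ∏ j : Fin N, signAt p (1 : F ≃ₐ[ℚ] F) j = -1) {W : Type*} [AddCommGroup W] [Module ℂ W]
    [Module.Finite ℂ W] (τ : Representation ℂ (RealPointsId α) W) (hτ : τ.IsIrreducible)
    (hmult : multiplicity (D.rationalRep ε b).complexRep τ ≠ 0) :
    IsEmpty (τ.Equiv (τ.comp (theta α ι p))) := by
  have : Nontrivial (Representation.IntertwiningMap τ (D.rationalRep ε b).complexRep) :=
    Module.nontrivial_of_finrank_pos (R := ℂ) (Nat.pos_of_ne_zero hmult)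
  obtain ⟨f, hf⟩ := exists_ne (0 : Representation.IntertwiningMap τ (D.rationalRep ε b).complexRep)
  obtain ⟨i, hi⟩ : ∃ i, evalColumns (e i) ∘ₗ f.toLinearMap ≠ 0 := by
    by_contra! hall
    apply hf
    ext w
    exact eq_zero_of_evalColumns e he _ fun i => LinearMap.congr_fun (hall i) w
  refine isEmpty_equiv_theta (ε := ε) b hm (D.map_im_mul_im (e i)) (SplitData.map_root_mul (hσ i))
    (fun k j => hs _ j) hodd τ hτ _ hi fun g w => ?_
  have h1 : f.toLinearMap (τ g w) = (D.rationalRep ε b).complexRep g (f.toLinearMap w) :=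
    LinearMap.congr_fun (f.isIntertwining' g) w
  rw [LinearMap.comp_apply, h1, D.evalColumns_complexRep ε b (e i) ι (σ i) (hσ i)]
  rfl

end Constituents

section Dimension

theorem finrank_columns {E : Type} [CommRing E] [Algebra ℚ E] [Module.Finite ℚ E] (d r : ℕ) :
    Module.finrank ℚ ((Fin d → Fin r) → E) = r ^ d * Module.finrank ℚ E := by
  rw [Module.finrank_pi_fintype]
  simp

theorem natDegree_shift (a : ℝ) (ha : a ≠ 0) (Q : Polynomial ℝ) (m₀ : ℝ) (d : ℕ) :
    (Polynomial.C a * (Q.comp (Polynomial.X + Polynomial.C m₀)) ^ d).natDegree =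
      d * Q.natDegree := by
  rw [Polynomial.natDegree_C_mul ha, Polynomial.natDegree_pow, Polynomial.natDegree_comp,
    Polynomial.natDegree_X_add_C, mul_one]

theorem leadingCoeff_shift (a : ℝ) (Q : Polynomial ℝ) (m₀ : ℝ) (d : ℕ) :
    (Polynomial.C a * (Q.comp (Polynomial.X + Polynomial.C m₀)) ^ d).leadingCoeff =
      a * Q.leadingCoeff ^ d := by
  rw [Polynomial.leadingCoeff_mul, Polynomial.leadingCoeff_C, Polynomial.leadingCoeff_pow,
    Polynomial.leadingCoeff_comp (by rw [Polynomial.natDegree_X_add_C]; exact one_ne_zero),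
    Polynomial.leadingCoeff_X_add_C, one_pow, mul_one]

end Dimension

end ArithSO

end

/-! ### The main theorem -/

theorem mainTheorem3 (n : ℕ) :
    ∃ c : ℝ, 0 < c ∧
      ∀ (p q : ℕ) (_hp : Odd p) (_hq : Odd q) (_hn : p + q = 2 * n + 2)
        (F : Type*) [Field F] [NumberField F] [NumberField.IsTotallyReal F] [IsGalois ℚ F]
        (_hd : 1 < Module.finrank ℚ F) (ι : F →ₐ[ℚ] ℝ) (α : Fin (p + q) → F)
        (_hpos : ∀ j : Fin (p + q), (j : ℕ) < p → 0 < ι (α j))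
        (_hneg : ∀ j : Fin (p + q), p ≤ (j : ℕ) → ι (α j) < 0)
        (_hdef : ∀ σ : F ≃ₐ[ℚ] F, σ ≠ 1 → ∀ j, 0 < ι (σ (α j))),
        ∃ (V : ℕ → Type) (_ : ∀ m, AddCommGroup (V m)) (_ : ∀ m, Module ℚ (V m))
          (_ : ∀ m, Module.Finite ℚ (V m)) (ρ : ∀ m, ArithSO.RationalRep α (V m)),
          (∀ m : ℕ, 1 ≤ m →
            (ρ m).complexRep.IsSemisimpleRepresentation ∧
            ∀ (W : Type) [AddCommGroup W] [Module ℂ W] [Module.Finite ℂ W]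
              (τ : Representation ℂ (ArithSO.RealPointsId α) W),
              τ.IsIrreducible → ArithSO.multiplicity (ρ m).complexRep τ ≠ 0 →
                IsEmpty (τ.Equiv (τ.comp (ArithSO.theta α ι p)))) ∧
          ∃ P : Polynomial ℝ,
            P.natDegree = Module.finrank ℚ F * (n * (n + 1) / 2) ∧
            P.leadingCoeff = c ^ Module.finrank ℚ F * Module.finrank ℚ F ∧
            ∀ m : ℕ, 1 ≤ m → (Module.finrank ℚ (V m) : ℝ) = P.eval (m : ℝ) := by
  obtain ⟨Q, hQdeg, hQpos, m₀, hQ⟩ := ArithSO.exists_finrank_cellSpan_eq_eval n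
  -- The algebra E has dimension d·2^{(N+1)d} with N = 2n + 2, and the tensor product contributes
  -- Q^d; together they give d·(2^{2n+3}·lc Q)^d.
  refine ⟨2 ^ (2 * n + 3) * Q.leadingCoeff, by positivity, ?_⟩
  intro p q hp hq hn F _ _ _ _ hd ι α hpos hneg hdef
  have hs : ∀ (τ : F ≃ₐ[ℚ] F) j, 0 < ArithSO.signAt p τ j * ι (τ (α j)) := by
    intro τ j
    rw [ArithSO.signAt]
    by_cases hτ : τ = 1
    · subst hτ
      by_cases hj : p ≤ (j : ℕ)
      · rw [if_pos ⟨rfl, hj⟩]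
        have := hneg j hj
        simpa using this
      · rw [if_neg fun h => hj h.2]
        have := hpos j (not_le.1 hj)
        simpa using this
    · rw [if_neg fun h => hτ h.1, one_mul]
      exact hdef τ hτ j
  have hα : ∀ j, α j ≠ 0 := by
    intro j h
    have := hs 1 j
    rw [h, map_zero, map_zero, mul_zero] at this
    exact lt_irrefl _ this
  obtain ⟨E, _, _, _, D, hrank, hemb, X, _, e, he⟩ := ArithSO.exists_splitData α hα ι
  choose σ hσ using fun i => hemb (e i)
  let ε : Fin (n + 1) ⊕ Fin (n + 1) ≃ Fin (p + q) :=
    finSumFinEquiv.trans (finCongr (by omega))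
  -- Shifting by `m₀` makes the dimension polynomial from the start; degree and leading coefficient
  -- are unaffected.
  let b := fun m : ℕ => (ArithSO.exists_cellBasis n (m + m₀)).some
  refine ⟨fun m => (Fin (Module.finrank ℚ F) →
    Fin (Module.finrank ℚ (ArithSO.cellSpan n (m + m₀)))) → E, fun _ => inferInstance,
    fun _ => inferInstance, fun _ => inferInstance, fun m => D.rationalRep ε (b m),
    fun m hm => ⟨?_, ?_⟩, ?_⟩
  · exact ArithSO.isSemisimple_complexRep (b m) e he (fun i => σ i) hσ hs
  · intro W _ _ _ τ hτ hmult
    exact ArithSO.isEmpty_equiv_theta_of_multiplicity (b m) (by omega) e he σ hσ hs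
      (ArithSO.prod_signAt_one hq) τ hτ hmult
  · have hd0 : (Module.finrank ℚ F : ℝ) ≠ 0 := by
      exact_mod_cast (by omega : Module.finrank ℚ F ≠ 0)
    refine ⟨Polynomial.C ((2 : ℝ) ^ ((2 * n + 3) * Module.finrank ℚ F) * Module.finrank ℚ F) *
      (Q.comp (Polynomial.X + Polynomial.C (m₀ : ℝ))) ^ Module.finrank ℚ F, ?_, ?_, ?_⟩
    · rw [ArithSO.natDegree_shift _ (mul_ne_zero (by positivity) hd0), hQdeg]
    · rw [ArithSO.leadingCoeff_shift, mul_pow, ← pow_mul]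
      ring
    · intro m _
      have h1 := hQ (m + m₀) (Nat.le_add_left _ _)
      rw [ArithSO.finrank_columns, hrank, Nat.cast_mul, Nat.cast_pow, h1, hn]
      simp only [Polynomial.eval_mul, Polynomial.eval_C, Polynomial.eval_pow, Polynomial.eval_comp,
        Polynomial.eval_add, Polynomial.eval_X]
      push_cast
      ring
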